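/- **Setting.** For every security parameter $\lambda\in\mathbb N$ let $(\mathbb G,\mathbb G_T)$ be groups of odd prime order $p>2^\lambda$ with a map $e:\mathbb G\times\mathbb G\to\mathbb G_T$ such that $e(u^a,v^b)=e(u,v)^{ab}$ for all $u,v\in\mathbb G$, $a,b\in\mathbb Z$, and $e(u,v)\ne 1$ for $u,v\neq 1$. Group elements are represented by strings of length polynomial in $\lambda$. "PPT" means: computed by one fixed randomized program which on input $1^\lambda$ and further data makes at most polynomially many (in $\lambda$) steps; the arithmetic of $\mathbb Z_p,\mathbb G,\mathbb G_T$ (including exponentiation), equality tests, the pairing $e$, and the choice of a random bit or random scalar are elementary steps. A function of $\lambda$ is *negligible* if it is $o(\lambda^{-c})$ for every $c$. **Assumption.** Let $q=q(\lambda)\ge 1$ be polynomially bounded. The $q$-ADBDHE assumption says that every PPT algorithm has negligible advantage in distinguishing $\big(g,g^{\alpha},\dots,g^{(\alpha^q)},h,h^{(\alpha^{q+2})},e(g,h)^{(\alpha^{q+1})}\big)$ from $\big(g,g^{\alpha},\dots,g^{(\alpha^q)},h,h^{(\alpha^{q+2})},e(g,h)^{\beta}\big)$, where $g,h$ are uniform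 in $\mathbb G\setminus\{1\}$ and $\alpha,\beta$ are uniform in $\mathbb Z_p^*$. **Scheme.** *Setup*: choose a random generator $g$ of $\mathbb G$, a random $h\in\mathbb G$ and $\alpha\in\mathbb Z_p^*$; $\mathsf{msk}=\alpha$, $\mathsf{mpk}=(g,g_1=g^\alpha,h)$. *Keygen* for $\mathsf{ID}\in\mathbb Z_p$: the user sends $R=g^{-t_0}(g_1g^{-\mathsf{ID}})^{\theta}$ and proves knowledge of $(t_0,\theta)$ by Okamoto's three-move witness-indistinguishable protocol (first message $a\in\mathbb G$, uniform challenge $c\in\mathbb Z_p$, response $(z_1,z_2)$, check $g^{-z_1}(g_1g^{-\mathsf{ID}})^{z_2}=aR^c$). If the proof is invalid (or $\mathsf{ID}=\alpha$, where no key exists) the PKG returns $\bot$; otherwise it picks $t_1$ uniformly in $\mathbb Z_p^*$ and returns $\big((hRg^{-t_1})^{1/(\alpha-\mathsf{ID})},t_1\big)$. A pair $(d,t)\in\mathbb G\times\mathbb Z_p$ is a *valid key* for $\mathsf{ID}$ if $e(d,g_1g^{-\mathsf{ID}})=e(h,g)\,e(g,g)^{-t}$. *Encrypt* $m\in\mathbb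 G_T$: $\big((g_1g^{-\mathsf{ID}})^s,\,e(g,g)^s,\,m\,e(g,h)^s\big)$ with $s$ uniform in $\mathbb Z_p^*$. A *device* $\mathbb D$ is a stateless randomized algorithm; it is *$\varepsilon$-useful* for $\mathsf{ID}$ if it returns $m$ with probability at least $\varepsilon$ on a fresh encryption under $\mathsf{ID}$ of a uniformly random $m$. *Trace*$^{\mathbb D}(\mathsf{mpk},\mathsf{ID},(d,t),\varepsilon)$: return $\bot$ if $(d,t)$ is not a valid key for $\mathsf{ID}$. Otherwise repeat $\lceil 16\lambda/\varepsilon\rceil$ times, independently: choose uniformly random distinct $s,s'\in\mathbb Z_p^*$ and $m\in\mathbb G_T$, put $C_1=(g_1g^{-\mathsf{ID}})^s$, $C_2=w^{s'}$, $C_3=m\,e(C_1,d)\,C_2^{t}$, and increment a counter $ctr$ (initially $0$) if $\mathbb D(C_1,C_2,C_3)=m$. Here $w=e(g,h)$ or $w=e(g,g)$ (the theorem holds for either choice). Accuse the PKG if finally $ctr=0$, otherwise the user. **Adaptive-ID (black-box) ComputeNewKey game.** The challenger runs Setup and gives $\mathsf{mpk}$ to the dishonest user $\mathcal A$, who adaptively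 takes part, as user, in at most $q$ sequential executions of Keygen for distinct identities of her choice. She then outputs an identity $\mathsf{ID}^\star$ (queried or not), a key $(d^\star,t^\star)$ and a device $\mathbb D$ (a PPT program with a value of her choice hardwired). She wins if $\mathbb D$ is $\varepsilon$-useful for $\mathsf{ID}^\star$ and Trace$^{\mathbb D}(\mathsf{mpk},\mathsf{ID}^\star,(d^\star,t^\star),\varepsilon)$ accuses the PKG. **Theorem.** Let $\varepsilon=\varepsilon(\lambda)\in(0,1]$ satisfy $\varepsilon(\lambda)\ge\lambda^{-c}$ for some constant $c$ and all large $\lambda$. If the $q$-ADBDHE assumption holds, then every PPT dishonest user $\mathcal A$ that makes at most $q$ key generation queries wins the adaptive-ID ComputeNewKey game with probability negligible in $\lambda$. -/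

import Mathlib

namespace AIBE

noncomputable section

open scoped Classical

/-! ## Data: finite binary trees, the only values that algorithms handle -/

/-- Finite binary trees. -/
inductive Data : Type
  | nil : Data
  | node : Data → Data → Data

namespace Data

/-- Number of nodes. -/
def size : Data → ℕ
  | nil => 1
  | node a b => a.size + b.size + 1

/-- Length of a tree read as a list `node x₁ (node x₂ (… nil))`. -/
def length : Data → ℕ
  | nil => 0
  | node _ b => b.length + 1

/-- The truth value "true"; `nil` is "false". -/
def tt : Data := node nil nil

def ofBool (b : Bool) : Data := if b then tt else nil

def ofList : List Data → Data
  | [] => nil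
  | a :: l => node a (ofList l)

/-- The string `1ⁿ`. -/
def unary : ℕ → Data
  | 0 => nil
  | n + 1 => node nil (unary n)

end Data

/-- Partial inverse of an (injective) encoding. -/
def decode {α : Type} (enc : α → Data) (t : Data) : Option α :=
  if h : ∃ a, enc a = t then some h.choose else none

/-! ## Bilinear groups -/

/-- A (symmetric) bilinear group `(G, GT, e)` of odd prime order `p`, together with the
representation of the group elements as data. -/
structure BilinearGroup where
  p : ℕ
  prime : p.Prime
  two_lt : 2 < p
  G : Type
  GT : Type
  [commG : CommGroup G]
  [commGT : CommGroup GT]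
  [fintypeG : Fintype G]
  [fintypeGT : Fintype GT]
  card_G : Fintype.card G = p
  card_GT : Fintype.card GT = p
  e : G → G → GT
  bilinear : ∀ (x y : G) (a b : ℤ), e (x ^ a) (y ^ b) = e x y ^ (a * b)
  nondegenerate : ∀ x y : G, x ≠ 1 → y ≠ 1 → e x y ≠ 1
  encG : G → Data
  encG_injective : Function.Injective encG
  encGT : GT → Data
  encGT_injective : Function.Injective encGT

namespace BilinearGroup

instance (B : BilinearGroup) : CommGroup B.G := B.commG
instance (B : BilinearGroup) : CommGroup B.GT := B.commGT
instance (B : BilinearGroup) : Fintype B.G := B.fintypeG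
instance (B : BilinearGroup) : Fintype B.GT := B.fintypeGT
instance (B : BilinearGroup) : Fact B.p.Prime := ⟨B.prime⟩

variable (B : BilinearGroup)

/-- Scalars, the elements of `ℤ/pℤ`; identities are scalars as well. -/
abbrev Scalar : Type := ZMod B.p

/-- Exponentiation by a scalar. -/
def exp {H : Type} [Monoid H] (x : H) (s : B.Scalar) : H := x ^ s.val

/-- Scalars are written in binary. -/
def encZ (s : B.Scalar) : Data := Data.ofList (s.val.bits.map Data.ofBool)

def decZ : Data → Option B.Scalar := decode B.encZ
def decG : Data → Option B.G := decode B.encG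
def decGT : Data → Option B.GT := decode B.encGT

/-- The uniform distribution on the elements of `G` other than `1` (the generators of `G`). -/
def randGen : PMF B.G :=
  PMF.uniformOfFinset (Finset.univ.filter fun x : B.G => x ≠ 1) (by
    have : Nontrivial B.G := Fintype.one_lt_card_iff_nontrivial.mp (by
      rw [B.card_G]; exact B.prime.one_lt)
    obtain ⟨x, hx⟩ := exists_ne (1 : B.G)
    exact ⟨x, by simpa using hx⟩)

/-- The uniform distribution on the pairs of distinct elements of `ℤ_p^*`. -/
def randDistinct : PMF (B.Scalarˣ × B.Scalarˣ) :=
  PMF.uniformOfFinset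
    (Finset.univ.filter fun x : B.Scalarˣ × B.Scalarˣ => x.1 ≠ x.2) (by
    have : Fact (2 < B.p) := ⟨B.two_lt⟩
    refine ⟨(1, -1), ?_⟩
    simp only [Finset.mem_filter, Finset.mem_univ, true_and, ne_eq]
    intro h
    exact ZMod.neg_one_ne_one (n := B.p) (by simpa using (congrArg Units.val h).symm))

end BilinearGroup

/-- One bilinear group for every security parameter `n`, of prime order `p > 2 ^ n`, whose
elements have representations of polynomial length. -/
structure BilinearFamily where
  grp : ℕ → BilinearGroup
  order_gt : ∀ n, 2 ^ n < (grp n).p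
  encG_size : ∃ P : Polynomial ℕ, ∀ n x, ((grp n).encG x).size ≤ P.eval n
  encGT_size : ∃ P : Polynomial ℕ, ∀ n x, ((grp n).encGT x).size ≤ P.eval n

/-! ## Probabilistic algorithms with a step count

A program is a finite text in a small language on binary trees, with bounded loops, random
choices and elementary instructions for the arithmetic of `ℤ/pℤ`, `G`, `GT` and for the pairing. It
works on the representations of the group elements and can therefore inspect them. -/

/-- Elementary instructions. -/
inductive Op : Type
  | zone | zadd | zneg | zmul | zinv | zeq
  | gmul | gpow | geq
  | tmul | tpow | teq
  | pairing

/-- Apply `f` to the two components of a pair, provided that both can be decoded. -/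
def liftPair {α β : Type} (dα : Data → Option α) (dβ : Data → Option β) (f : α → β → Data) :
    Data → Data
  | Data.nil => Data.nil
  | Data.node a b =>
    match dα a, dβ b with
    | some x, some y => f x y
    | _, _ => Data.nil

/-- Apply `f` to a value that can be decoded. -/
def liftOne {α : Type} (dα : Data → Option α) (f : α → Data) (t : Data) : Data :=
  match dα t with
  | some x => f x
  | none => Data.nil

/-- The effect of an elementary instruction; the result is `nil` on operands of the wrong form. -/
def Op.eval (B : BilinearGroup) : Op → Data → Data
  | zone => fun _ => B.encZ 1
  | zadd => liftPair B.decZ B.decZ fun x y => B.encZ (x + y)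
  | zneg => liftOne B.decZ fun x => B.encZ (-x)
  | zmul => liftPair B.decZ B.decZ fun x y => B.encZ (x * y)
  | zinv => liftOne B.decZ fun x => B.encZ x⁻¹
  | zeq => liftPair B.decZ B.decZ fun x y => Data.ofBool (decide (x = y))
  | gmul => liftPair B.decG B.decG fun x y => B.encG (x * y)
  | gpow => liftPair B.decG B.decZ fun x s => B.encG (B.exp x s)
  | geq => liftPair B.decG B.decG fun x y => Data.ofBool (decide (x = y))
  | tmul => liftPair B.decGT B.decGT fun x y => B.encGT (x * y)
  | tpow => liftPair B.decGT B.decZ fun x s => B.encGT (B.exp x s)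
  | teq => liftPair B.decGT B.decGT fun x y => Data.ofBool (decide (x = y))
  | pairing => liftPair B.decG B.decG fun x y => B.encGT (B.e x y)

/-- Programs. Each of them maps an input tree to an output tree. -/
inductive Prog : Type
  /-- return the input -/
  | skip : Prog
  /-- return `nil` -/
  | nil : Prog
  /-- left and right component of a pair -/
  | fst : Prog
  | snd : Prog
  /-- run both programs on the input and pair the results -/
  | pair : Prog → Prog → Prog
  /-- run the first program, then the second one on its result -/
  | seq : Prog → Prog → Prog
  /-- `cond c f g`: run `f` on the input if `c` returns something other than `nil`, else `g` -/
  | cond : Prog → Prog → Prog → Prog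
  /-- on input `node l x`: apply the body `l.length` times, starting with `x` -/
  | loop : Prog → Prog
  /-- a uniformly random bit -/
  | coin : Prog
  /-- a uniformly random scalar -/
  | rand : Prog
  | op : Op → Prog

/-- `k`-fold iteration with a step count. -/
def iterSteps (f : Data → PMF (Data × ℕ)) : ℕ → Data → PMF (Data × ℕ)
  | 0, x => PMF.pure (x, 1)
  | k + 1, x => (f x).bind fun r => (iterSteps f k r.1).bind fun r' =>
      PMF.pure (r'.1, r.2 + r'.2 + 1)

/-- The joint distribution of the output and of the number of steps. -/
def Prog.run (B : BilinearGroup) : Prog → Data → PMF (Data × ℕ)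
  | skip => fun t => PMF.pure (t, 1)
  | nil => fun _ => PMF.pure (Data.nil, 1)
  | fst => fun t => PMF.pure (match t with
      | Data.nil => Data.nil
      | Data.node a _ => a, 1)
  | snd => fun t => PMF.pure (match t with
      | Data.nil => Data.nil
      | Data.node _ b => b, 1)
  | pair f g => fun t => (f.run B t).bind fun r => (g.run B t).bind fun r' =>
      PMF.pure (Data.node r.1 r'.1, r.2 + r'.2 + 1)
  | seq f g => fun t => (f.run B t).bind fun r => (g.run B r.1).bind fun r' =>
      PMF.pure (r'.1, r.2 + r'.2 + 1)
  | cond c f g => fun t => (c.run B t).bind fun r =>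
      (if r.1 = Data.nil then g.run B t else f.run B t).bind fun r' =>
        PMF.pure (r'.1, r.2 + r'.2 + 1)
  | loop f => fun t => match t with
      | Data.nil => PMF.pure (Data.nil, 1)
      | Data.node l x => iterSteps (f.run B) l.length x
  | coin => fun _ => (PMF.uniformOfFintype Bool).bind fun b => PMF.pure (Data.ofBool b, 1)
  | rand => fun _ => (PMF.uniformOfFintype B.Scalar).bind fun s => PMF.pure (B.encZ s, 1)
  | op o => fun t => PMF.pure (o.eval B t, 1)

/-- The distribution of the output of a program on input `(1ⁿ, x)`. -/
def Prog.output (𝒢 : BilinearFamily) (P : Prog) (n : ℕ) (x : Data) : PMF Data :=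
  (P.run (𝒢.grp n) (Data.node (Data.unary n) x)).map Prod.fst

/-- Probabilistic polynomial time: on every input `(1ⁿ, x)` and for every outcome of the random
choices, the number of steps is at most polynomial in the security parameter `n`. -/
def Prog.IsPPT (𝒢 : BilinearFamily) (P : Prog) : Prop :=
  ∃ T : Polynomial ℕ, ∀ (n : ℕ) (x : Data),
    ∀ r ∈ (P.run (𝒢.grp n) (Data.node (Data.unary n) x)).support, r.2 ≤ T.eval n

/-- `q n` is bounded by a polynomial in `n`. -/
def PolyBounded (q : ℕ → ℕ) : Prop := ∃ P : Polynomial ℕ, ∀ n, q n ≤ P.eval n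

/-- `f n` is a negligible function of `n`. -/
def Negligible (f : ℕ → ℝ) : Prop :=
  Asymptotics.SuperpolynomialDecay Filter.atTop (fun n : ℕ => (n : ℝ)) f

/-- `f n` is at least the inverse of a polynomial in `n`, for all large `n`. -/
def Noticeable (f : ℕ → ℝ) : Prop :=
  ∃ c : ℕ, ∀ᶠ n : ℕ in Filter.atTop, ((n : ℝ) ^ c)⁻¹ ≤ f n

/-! ## The `q`-ADBDHE assumption -/

/-- The tuple `(g, g^α, …, g^(α^q), h, h^(α^(q+2)), T)` as data. -/
def adbdheTuple (B : BilinearGroup) (q : ℕ) (g h : B.G) (α : B.Scalar) (T : B.GT) : Data :=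
  Data.node (Data.ofList ((List.range (q + 1)).map fun i => B.encG (B.exp g (α ^ i))))
    (Data.node (B.encG h) (Data.node (B.encG (B.exp h (α ^ (q + 2)))) (B.encGT T)))

/-- The output of the distinguisher on a tuple with `T = e(g,h)^(α^(q+1))`. -/
def adbdheReal (𝒢 : BilinearFamily) (q : ℕ → ℕ) (D : Prog) (n : ℕ) : PMF Data :=
  let B := 𝒢.grp n
  B.randGen.bind fun g => B.randGen.bind fun h =>
    (PMF.uniformOfFintype B.Scalarˣ).bind fun α =>
      D.output 𝒢 n (adbdheTuple B (q n) g h α (B.exp (B.e g h) ((α : B.Scalar) ^ (q n + 1))))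

/-- The output of the distinguisher on a tuple with `T = e(g,h)^β`. -/
def adbdheRandom (𝒢 : BilinearFamily) (q : ℕ → ℕ) (D : Prog) (n : ℕ) : PMF Data :=
  let B := 𝒢.grp n
  B.randGen.bind fun g => B.randGen.bind fun h =>
    (PMF.uniformOfFintype B.Scalarˣ).bind fun α =>
      (PMF.uniformOfFintype B.Scalarˣ).bind fun β =>
        D.output 𝒢 n (adbdheTuple B (q n) g h α (B.exp (B.e g h) (β : B.Scalar)))

/-- The advantage of a distinguisher against `q`-ADBDHE. -/
def adbdheAdv (𝒢 : BilinearFamily) (q : ℕ → ℕ) (D : Prog) (n : ℕ) : ℝ :=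
  |(adbdheReal 𝒢 q D n Data.tt).toReal - (adbdheRandom 𝒢 q D n Data.tt).toReal|

/-- The `q`-ADBDHE assumption: PPT distinguishers have negligible advantage. -/
def ADBDHEAssumption (𝒢 : BilinearFamily) (q : ℕ → ℕ) : Prop :=
  ∀ D : Prog, D.IsPPT 𝒢 → Negligible (adbdheAdv 𝒢 q D)

/-! ## The scheme -/

/-- Master public keys `(g, g₁, h)`. -/
structure PublicKey (B : BilinearGroup) where
  g : B.G
  g₁ : B.G
  h : B.G

/-- Private keys `(d, t)`; the scalar `t` is the key family number. -/
structure UserKey (B : BilinearGroup) where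
  d : B.G
  t : B.Scalar

section Scheme

variable (B : BilinearGroup)

/-- Setup: a random generator `g`, a random `h ∈ G` and `α ∈ ℤ_p^*`; the result is
`((g, g^α, h), α)`. -/
def setup : PMF (PublicKey B × B.Scalar) :=
  B.randGen.bind fun g => (PMF.uniformOfFintype B.G).bind fun h =>
    (PMF.uniformOfFintype B.Scalarˣ).bind fun α =>
      PMF.pure (⟨g, B.exp g (α : B.Scalar), h⟩, (α : B.Scalar))

variable {B}

/-- `g₁ · g^(-ID)`. -/
def PublicKey.idBase (mpk : PublicKey B) (id : B.Scalar) : B.G :=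
  mpk.g₁ * B.exp mpk.g (-id)

/-- `g^(-x) · (g₁ · g^(-ID))^y`, the commitment to `x` with opening `y`. -/
def PublicKey.commit (mpk : PublicKey B) (id x y : B.Scalar) : B.G :=
  B.exp mpk.g (-x) * B.exp (mpk.idBase id) y

/-- The verifier's check in the three-move (Okamoto) proof of knowledge of `(t₀, θ)` with
`R = g^(-t₀) · (g₁ · g^(-ID))^θ`. The prover sends `a = g^(-x) · (g₁ · g^(-ID))^y`, receives the
challenge `c` and answers with `z₁ = x + c t₀` and `z₂ = y + c θ`. -/
def PublicKey.PokAccepts (mpk : PublicKey B) (id : B.Scalar) (R a : B.G) (c z₁ z₂ : B.Scalar) :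
    Prop :=
  mpk.commit id z₁ z₂ = a * B.exp R c

/-- The PKG's last message `((h · R · g^(-t₁))^(1/(α - ID)), t₁)` in the key generation protocol,
once it has accepted the proof of knowledge. No key exists for `ID = α`: the answer is then `⊥`,
that is `nil`. -/
def keygenAnswer (mpk : PublicKey B) (α id : B.Scalar) (R : B.G) : PMF Data :=
  if id = α then PMF.pure Data.nil
  else (PMF.uniformOfFintype B.Scalarˣ).bind fun t₁ =>
    PMF.pure (Data.node
      (B.encG (B.exp (mpk.h * R * B.exp mpk.g (-(t₁ : B.Scalar))) (α - id)⁻¹))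
      (B.encZ (t₁ : B.Scalar)))

/-- `d_ID` is a well-formed key for `ID`: `e(d, g₁ · g^(-ID)) = e(h,g) · e(g,g)^(-t)`. -/
def UserKey.Valid (mpk : PublicKey B) (id : B.Scalar) (k : UserKey B) : Prop :=
  B.e k.d (mpk.idBase id) = B.e mpk.h mpk.g * B.exp (B.e mpk.g mpk.g) (-k.t)

/-- A ciphertext `(C₁, C₂, C₃)` as data. -/
def ciphertext (C₁ : B.G) (C₂ C₃ : B.GT) : Data :=
  Data.node (B.encG C₁) (Data.node (B.encGT C₂) (B.encGT C₃))

/-- Encryption of `m` under `ID`: `((g₁ · g^(-ID))^s, e(g,g)^s, m · e(g,h)^s)`. -/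
def encrypt (mpk : PublicKey B) (id : B.Scalar) (m : B.GT) : PMF Data :=
  (PMF.uniformOfFintype B.Scalarˣ).bind fun s =>
    PMF.pure (ciphertext (B.exp (mpk.idBase id) (s : B.Scalar))
      (B.exp (B.e mpk.g mpk.g) (s : B.Scalar)) (m * B.exp (B.e mpk.g mpk.h) (s : B.Scalar)))

/-- The base of the second component of the tracer's ill-formed ciphertexts:
`e(g,h)` or `e(g,g)`. -/
inductive ProbeBase : Type
  | gh
  | gg

def ProbeBase.value (b : ProbeBase) (mpk : PublicKey B) : B.GT :=
  match b with
  | gh => B.e mpk.g mpk.h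
  | gg => B.e mpk.g mpk.g

/-- A stateless decryption device: it answers every ciphertext afresh. -/
abbrev Device : Type := Data → PMF Data

/-- Does the device open a fresh encryption of a random message? -/
def decryptTest (mpk : PublicKey B) (id : B.Scalar) (𝔻 : Device) : PMF Bool :=
  (PMF.uniformOfFintype B.GT).bind fun m => (encrypt mpk id m).bind fun C =>
    (𝔻 C).bind fun m' => PMF.pure (decide (m' = B.encGT m))

/-- The device opens ciphertexts for `ID` with probability at least `ε`. -/
def Useful (mpk : PublicKey B) (id : B.Scalar) (ε : ℝ) (𝔻 : Device) : Prop :=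
  ε ≤ (decryptTest mpk id 𝔻 true).toReal

/-- One iteration of the tracing algorithm; `true` means that the counter is incremented. -/
def probe (b : ProbeBase) (mpk : PublicKey B) (id : B.Scalar) (k : UserKey B) (𝔻 : Device) :
    PMF Bool :=
  B.randDistinct.bind fun s => (PMF.uniformOfFintype B.GT).bind fun m =>
    let C₁ := B.exp (mpk.idBase id) (s.1 : B.Scalar)
    let C₂ := B.exp (b.value mpk) (s.2 : B.Scalar)
    let C₃ := m * B.e C₁ k.d * B.exp C₂ k.t
    (𝔻 (ciphertext C₁ C₂ C₃)).bind fun m' => PMF.pure (decide (m' = B.encGT m))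

/-- The counter after `L` iterations. -/
def counter (b : ProbeBase) (mpk : PublicKey B) (id : B.Scalar) (k : UserKey B) (𝔻 : Device) :
    ℕ → PMF ℕ
  | 0 => PMF.pure 0
  | L + 1 => (counter b mpk id k 𝔻 L).bind fun ctr => (probe b mpk id k 𝔻).bind fun x =>
      PMF.pure (if x then ctr + 1 else ctr)

inductive Verdict : Type
  | bot
  | pkg
  | user

/-- The tracing algorithm, with `16 n / ε` iterations. Ill-formed keys are rejected. -/
def trace (b : ProbeBase) (n : ℕ) (ε : ℝ) (mpk : PublicKey B) (id : B.Scalar) (k : UserKey B)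
    (𝔻 : Device) : PMF Verdict :=
  if k.Valid mpk id then
    (counter b mpk id k 𝔻 ⌈16 * (n : ℝ) / ε⌉₊).bind fun ctr =>
      PMF.pure (if ctr = 0 then Verdict.pkg else Verdict.user)
  else PMF.pure Verdict.bot

end Scheme

/-! ## The adaptive-ID black-box ComputeNewKey game -/

/-- A dishonest user. `user` is the interactive program: in each activation it maps its state and
an incoming message to a new state and an outgoing message. `device` is the program of
the decryption device: the device which the user hands over is `device` with a value of the user's
choice hardwired into it. -/
structure Adversary where
  user : Prog
  device : Prog

def Adversary.IsPPT (𝒢 : BilinearFamily) (A : Adversary) : Prop :=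
  A.user.IsPPT 𝒢 ∧ A.device.IsPPT 𝒢

/-- The device with the value `w` hardwired into it. -/
def Adversary.mkDevice (𝒢 : BilinearFamily) (A : Adversary) (n : ℕ) (w : Data) : Device :=
  fun C => A.device.output 𝒢 n (Data.node w C)

/-- One activation of the dishonest user; the result is `node state' message`. -/
def Adversary.activate (𝒢 : BilinearFamily) (A : Adversary) (n : ℕ) (state msg : Data) :
    PMF Data :=
  A.user.output 𝒢 n (Data.node state msg)

/-- What the user does next: start the key generation protocol for an identity, with the
commitment `R` and the first message `a` of the proof of knowledge, or finish with an identity, a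
key for it and a device. -/
inductive Move (B : BilinearGroup) : Type
  | query (id : B.Scalar) (R a : B.G) : Move B
  | finish (id : B.Scalar) (k : UserKey B) (w : Data) : Move B

/-- `node nil (ID, R, a)` is a query and `node (node _ _) (ID, d, t, w)` a final output. -/
def parseMove (B : BilinearGroup) : Data → Option (Move B)
  | Data.node Data.nil (Data.node i (Data.node r a)) =>
      match B.decZ i, B.decG r, B.decG a with
      | some id, some R, some a => some (Move.query id R a)
      | _, _, _ => none
  | Data.node (Data.node _ _) (Data.node i (Data.node d (Data.node t w))) =>
      match B.decZ i, B.decG d, B.decZ t with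
      | some id, some d, some t => some (Move.finish id ⟨d, t⟩ w)
      | _, _, _ => none
  | _ => none

/-- The PKG's reaction to the last message `z` of the proof of knowledge. -/
def pkgReply {B : BilinearGroup} (mpk : PublicKey B) (α id : B.Scalar) (R a : B.G) (c : B.Scalar)
    (z : Data) : PMF Data :=
  match z with
  | Data.nil => PMF.pure Data.nil
  | Data.node z₁ z₂ =>
    match B.decZ z₁, B.decZ z₂ with
    | some z₁, some z₂ =>
        if mpk.PokAccepts id R a c z₁ z₂ then keygenAnswer mpk α id R else PMF.pure Data.nil
    | _, _ => PMF.pure Data.nil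

/-- The interaction of the dishonest user with the PKG. The executions of the key
generation protocol are sequential; at most `k` of them remain and `Q` lists the identities queried
so far. The identities must be distinct. `none` means that the user violated the rules. -/
def play (𝒢 : BilinearFamily) (A : Adversary) (n : ℕ) (mpk : PublicKey (𝒢.grp n))
    (α : (𝒢.grp n).Scalar) : ℕ → List (𝒢.grp n).Scalar → Data → Data →
      PMF (Option ((𝒢.grp n).Scalar × UserKey (𝒢.grp n) × Data))
  | k, Q, state, msg => (A.activate 𝒢 n state msg).bind fun out =>
    match out with
    | Data.nil => PMF.pure none
    | Data.node state₁ move =>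
      match parseMove (𝒢.grp n) move with
      | none => PMF.pure none
      | some (Move.finish id key w) => PMF.pure (some (id, key, w))
      | some (Move.query id R a) =>
        match k with
        | 0 => PMF.pure none
        | k + 1 =>
          if id ∈ Q then PMF.pure none
          else (PMF.uniformOfFintype (𝒢.grp n).Scalar).bind fun c =>
            (A.activate 𝒢 n state₁ ((𝒢.grp n).encZ c)).bind fun out' =>
              match out' with
              | Data.nil => PMF.pure none
              | Data.node state₂ z =>
                (pkgReply mpk α id R a c z).bind fun reply =>
                  play 𝒢 A n mpk α k (id :: Q) state₂ reply

/-- A master public key as data. -/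
def PublicKey.toData {B : BilinearGroup} (mpk : PublicKey B) : Data :=
  Data.node (B.encG mpk.g) (Data.node (B.encG mpk.g₁) (B.encG mpk.h))

/-- The game, with at most `q n` key generation queries. The user wins if she outputs an
`ε`-useful device and a key on which the tracing algorithm incriminates the PKG. -/
def computeNewKeyGame (𝒢 : BilinearFamily) (q : ℕ → ℕ) (b : ProbeBase) (ε : ℕ → ℝ)
    (A : Adversary) (n : ℕ) : PMF Bool :=
  (setup (𝒢.grp n)).bind fun keys =>
    (play 𝒢 A n keys.1 keys.2 (q n) [] Data.nil keys.1.toData).bind fun result =>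
      match result with
      | none => PMF.pure false
      | some (id, key, w) =>
        if Useful keys.1 id (ε n) (A.mkDevice 𝒢 n w) then
          (trace b n (ε n) keys.1 id key (A.mkDevice 𝒢 n w)).bind fun v =>
            PMF.pure (decide (v = Verdict.pkg))
        else PMF.pure false

/-- The advantage of the dishonest user: the probability of winning. -/
def computeNewKeyAdv (𝒢 : BilinearFamily) (q : ℕ → ℕ) (b : ProbeBase) (ε : ℕ → ℝ)
    (A : Adversary) (n : ℕ) : ℝ :=
  (computeNewKeyGame 𝒢 q b ε A n true).toReal

end

end AIBE

namespace AIBE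

noncomputable section

open scoped Classical ENNReal Polynomial

/-! A winning user is turned into a distinguisher for the challenge `g^(α^i)` (`i ≤ q`), `h' = g^η`,
`h'^(α^(q+2))`, `T`. The public key is simulated with a uniformly random polynomial `f` of degree at
most `q`, by `h = g^f(α)`. For every `ID ≠ α` the pair `(g^((f(α) - f(ID))/(α - ID)), f(ID))` is
then a valid key, and synthetic division in the exponent computes it from the given powers of `g`
(`foldl_coeffData`). No identity has to be guessed in advance, which is why adaptive queries are
harmless.

To answer a query, the user is rewound until a second accepting transcript with another challenge
appears. The two transcripts open `R` to some `(t₀, θ)` (`commit_of_accepts`), and the PKG's answer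
with `t₁ = f(ID) - t₀` becomes computable (`wp_reply`). The polynomial has `q + 1` free
coefficients. The public key fixes `f(α)`, and each of the at most `q` queries uses one value at a
new point; such a value is uniform given the past (`ex_randPoly_succ`), so `t₁` has the right law up
to `1/p` (`query_le`, `play_le`).

Rewinding is cut off after `M = n^K` attempts. If an attempt is accepted with probability `a`, then
an accepted first run followed by `M` failures has probability about `a (1 - a)^M ≤ 1/M`
(`mul_pow_failure_le`). The total loss `q/M` is only inverse polynomial, but negligibility is tested
for one exponent at a time, and `K` is chosen after the exponent.

Let `(d, t)` be the final key for `ID`, assumed valid, and let `μ = (ID α^(q+1) - ID^(q+2))/(α -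
ID)`, which involves only the powers of `α` up to `q`. Since `α^(q+2) - ID^(q+2) = (α - ID)(α^(q+1)
+ μ)`, the elements `C₁ = h'^(α^(q+2) - ID^(q+2))` and `C₂ = T · e(g^μ, h')` are computable. For a
real `T` they carry the same exponent `η (α^(q+1) + μ)`; for a random `T` their exponents are
independent up to `O(1/p)`. With `C₃` formed from the key as in the tracing algorithm, the device
receives an encryption in the first case and a probe in the second. If `t ≠ f(ID)`, two different
keys yield `g^(1/(α - ID))`, and the real value of `T` is computed outright; the degenerate cases
`ID = α` and `α^(q+1) + μ = 0` also allow this (`wp_exploit`).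

Let `u` and `v` be the probabilities that the device opens encryptions and probes. The distinguisher
runs the device once on a sample of its own of each kind, with results `x` and `y`, and then on the
challenge, with result `z`. It outputs `z` if only `x` is true, the negation of `z` if only `y` is
true, and false otherwise. Its advantage is about `(u - v)^2`; this is nonnegative, so outputs of
the user that do not win do no harm (`gain_bound`). For a useful device, either `v < ε/2` and the
gain is at least `ε^2/4`, or the tracing algorithm accuses the PKG with probability at most
`exp(-8n)` (`trace_le_exp`). Altogether the advantage is at least `ε^2/4` times the winning
probability, up to small errors (`computeNewKeyAdv_le`). -/

/-! ## Expectations -/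

/-- The expectation of a nonnegative function. -/
def ex {α : Type*} (μ : PMF α) (f : α → ℝ≥0∞) : ℝ≥0∞ := ∑' a, μ a * f a

section Expectation

variable {α β : Type*}

@[simp] theorem ex_pure (a : α) (f : α → ℝ≥0∞) : ex (PMF.pure a) f = f a := by
  unfold ex
  rw [tsum_eq_single a]
  · simp
  · intro b hb; simp [PMF.pure_apply, hb]

@[simp] theorem ex_bind (μ : PMF α) (κ : α → PMF β) (f : β → ℝ≥0∞) :
    ex (μ.bind κ) f = ex μ fun a => ex (κ a) f := by
  unfold ex
  simp only [PMF.bind_apply, ← ENNReal.tsum_mul_right, ← ENNReal.tsum_mul_left]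
  rw [ENNReal.tsum_comm]
  simp only [mul_assoc]

@[simp] theorem ex_map (μ : PMF α) (g : α → β) (f : β → ℝ≥0∞) :
    ex (μ.map g) f = ex μ fun a => f (g a) := by
  rw [← PMF.bind_pure_comp, ex_bind]; simp

theorem ex_mono_support {μ : PMF α} {f g : α → ℝ≥0∞} (h : ∀ a ∈ μ.support, f a ≤ g a) :
    ex μ f ≤ ex μ g := by
  refine ENNReal.tsum_le_tsum fun a => ?_
  by_cases ha : μ a = 0
  · simp [ha]
  · gcongr; exact h a ((PMF.mem_support_iff _ _).2 ha)

theorem ex_mono {μ : PMF α} {f g : α → ℝ≥0∞} (h : ∀ a, f a ≤ g a) : ex μ f ≤ ex μ g :=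
  ex_mono_support fun a _ => h a

@[simp] theorem ex_const (μ : PMF α) (c : ℝ≥0∞) : (ex μ fun _ => c) = c := by
  unfold ex; rw [ENNReal.tsum_mul_right, PMF.tsum_coe, one_mul]

theorem ex_add (μ : PMF α) (f g : α → ℝ≥0∞) :
    (ex μ fun a => f a + g a) = ex μ f + ex μ g := by
  unfold ex; simp only [mul_add]; exact ENNReal.tsum_add

theorem ex_const_mul (μ : PMF α) (c : ℝ≥0∞) (f : α → ℝ≥0∞) :
    (ex μ fun a => c * f a) = c * ex μ f := by
  unfold ex; rw [← ENNReal.tsum_mul_left]; exact tsum_congr fun a => by ring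

theorem ex_mul_const (μ : PMF α) (c : ℝ≥0∞) (f : α → ℝ≥0∞) :
    (ex μ fun a => f a * c) = ex μ f * c := by
  simp only [mul_comm _ c]; exact ex_const_mul μ c f

theorem ex_le_const {μ : PMF α} {f : α → ℝ≥0∞} {c : ℝ≥0∞} (h : ∀ a, f a ≤ c) : ex μ f ≤ c :=
  (ex_mono h).trans (ex_const μ c).le

theorem const_le_ex {μ : PMF α} {f : α → ℝ≥0∞} {c : ℝ≥0∞} (h : ∀ a, c ≤ f a) : c ≤ ex μ f :=
  (ex_const μ c).ge.trans (ex_mono h)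

theorem ex_comm (μ : PMF α) (ν : PMF β) (f : α → β → ℝ≥0∞) :
    (ex μ fun a => ex ν fun b => f a b) = ex ν fun b => ex μ fun a => f a b := by
  unfold ex
  simp only [← ENNReal.tsum_mul_left]
  rw [ENNReal.tsum_comm]
  exact tsum_congr fun b => tsum_congr fun a => by ring

theorem apply_eq_ex [DecidableEq α] (μ : PMF α) (a : α) :
    μ a = ex μ fun b => if b = a then 1 else 0 := by
  unfold ex
  rw [tsum_eq_single a]
  · simp
  · intro b hb; simp [hb]

theorem ex_uniformOfFintype [Fintype α] [Nonempty α] (f : α → ℝ≥0∞) :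
    ex (PMF.uniformOfFintype α) f = (∑ a, f a) / Fintype.card α := by
  unfold ex
  simp only [PMF.uniformOfFintype_apply]
  rw [ENNReal.tsum_mul_left, tsum_fintype, div_eq_mul_inv, mul_comm]

theorem ex_uniformOfFinset (s : Finset α) (hs : s.Nonempty) (f : α → ℝ≥0∞) :
    ex (PMF.uniformOfFinset s hs) f = (∑ a ∈ s, f a) / s.card := by
  unfold ex
  rw [tsum_eq_sum (s := s)]
  · rw [div_eq_mul_inv, Finset.sum_mul]
    refine Finset.sum_congr rfl fun a ha => ?_
    rw [PMF.uniformOfFinset_apply_of_mem hs ha, mul_comm]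
  · intro a ha
    rw [PMF.uniformOfFinset_apply_of_notMem hs ha, zero_mul]

theorem ex_uniform_equiv [Fintype α] [Nonempty α] [Fintype β] [Nonempty β] (σ : α ≃ β)
    (f : β → ℝ≥0∞) :
    (ex (PMF.uniformOfFintype α) fun a => f (σ a)) = ex (PMF.uniformOfFintype β) f := by
  rw [ex_uniformOfFintype, ex_uniformOfFintype, Fintype.card_congr σ, Equiv.sum_comp σ f]

/-- Averaging over a subset that misses few points changes the mean value of a function with
values in `[0, 1]` only slightly: upper bound. -/
theorem ex_uniformOfFinset_le [Fintype α] [DecidableEq α] [Nonempty α] {s : Finset α} (hs : s.Nonempty)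
    {f : α → ℝ≥0∞} (hf : ∀ a, f a ≤ 1) :
    ex (PMF.uniformOfFinset s hs) f ≤
      ex (PMF.uniformOfFintype α) f + (sᶜ.card : ℝ≥0∞) / Fintype.card α := by
  rw [ex_uniformOfFinset, ex_uniformOfFintype]
  have hsum : ∑ a ∈ s, f a ≤ s.card := by
    calc ∑ a ∈ s, f a ≤ ∑ a ∈ s, 1 := Finset.sum_le_sum fun a _ => hf a
      _ = s.card := by simp
  have hle : ∑ a ∈ s, f a ≤ ∑ a, f a :=
    Finset.sum_le_sum_of_subset (Finset.subset_univ s)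
  have hcard : (Fintype.card α : ℝ≥0∞) = s.card + sᶜ.card := by
    rw [← Nat.cast_add, Finset.card_add_card_compl]
  have hs0 : (s.card : ℝ≥0∞) ≠ 0 := by simpa using hs.ne_empty
  have hn0 : (Fintype.card α : ℝ≥0∞) ≠ 0 := by simp
  rw [← ENNReal.add_div]
  refine ENNReal.div_le_of_le_mul ?_
  rw [← ENNReal.mul_div_right_comm]
  refine (ENNReal.le_div_iff_mul_le (Or.inl hn0) (Or.inl (by simp))).2 ?_
  rw [hcard, mul_add, add_mul]
  exact add_le_add (by gcongr) (by rw [mul_comm]; gcongr)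

/-- Averaging over a subset that misses few points changes the mean value of a function with
values in `[0, 1]` only slightly: lower bound. -/
theorem le_ex_uniformOfFinset [Fintype α] [DecidableEq α] [Nonempty α] {s : Finset α} (hs : s.Nonempty)
    {f : α → ℝ≥0∞} (hf : ∀ a, f a ≤ 1) :
    ex (PMF.uniformOfFintype α) f ≤
      ex (PMF.uniformOfFinset s hs) f + (sᶜ.card : ℝ≥0∞) / Fintype.card α := by
  rw [ex_uniformOfFinset, ex_uniformOfFintype]
  have hsum : ∑ a ∈ sᶜ, f a ≤ sᶜ.card := by
    calc ∑ a ∈ sᶜ, f a ≤ ∑ a ∈ sᶜ, 1 := Finset.sum_le_sum fun a _ => hf a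
      _ = sᶜ.card := by simp
  rw [← Finset.sum_add_sum_compl s f, ENNReal.add_div]
  gcongr
  exact_mod_cast Finset.card_le_univ s

end Expectation

/-! ## Repeating a trial until it succeeds -/

/-- The distribution of the state after `N` steps of a Markov chain. -/
def iter {α : Type*} (κ : α → PMF α) : ℕ → α → PMF α
  | 0, a => PMF.pure a
  | N + 1, a => (κ a).bind (iter κ N)

/-- Expectation transformers compose backwards. This lets a program loop, whose semantics is an
iterated transformer, be read as a Markov chain. -/
theorem ex_iter {α : Type*} (κ : α → PMF α) (φ : α → ℝ≥0∞) (N : ℕ) (a : α) :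
    ex (iter κ N a) φ = (fun ψ a => ex (κ a) ψ)^[N] φ a := by
  induction N generalizing a with
  | zero => simp [iter]
  | succ N ih =>
    rw [Function.iterate_succ_apply']
    simp only [iter, ex_bind, ih]

/-- In each step the chain draws `b` from `μ` and moves to `g b` if `b` is good; otherwise it stays.
After `N` steps the value of the state is at least `X`, up to the probability that none of the
draws was good. -/
theorem le_ex_iter {α β : Type*} (μ : PMF β) (P : β → Prop)
    [DecidablePred P] (g : β → α) (φ : α → ℝ≥0∞)
    (X : ℝ≥0∞) (hX : X ≤ 1) (hφ : ∀ b, P b → X ≤ φ (g b)) (N : ℕ) (a : α) :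
    X ≤ ex (iter (fun a => μ.bind fun b => PMF.pure (if P b then g b else a)) N a) φ +
      (ex μ fun b => if P b then 0 else 1) ^ N := by
  -- The bound `X ≤ φ a` is an invariant of the chain: each draw keeps the state or replaces it by
  -- another good one.
  have key : ∀ N a, X ≤ φ a →
      X ≤ ex (iter (fun a => μ.bind fun b => PMF.pure (if P b then g b else a)) N a) φ := by
    intro N
    induction N with
    | zero => intro a ha; simpa [iter] using ha
    | succ N ih =>
      intro a ha
      simp only [iter, ex_bind, ex_pure]
      refine const_le_ex fun b => ih _ ?_
      split_ifs with h
      · exact hφ b h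
      · exact ha
  induction N generalizing a with
  | zero => simpa using hX.trans le_add_self
  | succ N ih =>
    simp only [iter, ex_bind, ex_pure]
    -- One factor of the failure probability is absorbed into the first draw: a good draw is settled
    -- by `key`, a bad one leaves `N` further attempts.
    rw [pow_succ', ← ex_mul_const, ← ex_add]
    refine const_le_ex fun b => ?_
    split_ifs with h
    · rw [zero_mul, add_zero]
      exact key _ _ (hφ b h)
    · rw [one_mul]
      exact ih a

/-- The probability of succeeding once and then failing `N` times is small. -/
theorem mul_pow_failure_le {a c b : ℝ≥0∞} (hab : a + b ≤ 1) {N : ℕ} (hN : N ≠ 0) :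
    a * (min 1 (b + c)) ^ N ≤ (N : ℝ≥0∞)⁻¹ + c := by
  rcases eq_or_ne c ⊤ with rfl | hc
  · simp
  have ha : a ≠ ⊤ := ne_top_of_le_ne_top ENNReal.one_ne_top (le_self_add.trans hab)
  have hb : b ≠ ⊤ := ne_top_of_le_ne_top ENNReal.one_ne_top (le_add_self.trans hab)
  lift a to NNReal using ha
  lift b to NNReal using hb
  lift c to NNReal using hc
  have hab' : a + b ≤ 1 := by exact_mod_cast hab
  have hN' : (N : NNReal) ≠ 0 := by exact_mod_cast hN
  have hr : ((N : ℝ≥0∞))⁻¹ = ((N : NNReal)⁻¹ : NNReal) := by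
    rw [ENNReal.coe_inv hN']; simp
  rw [hr]
  suffices h : a * (min 1 (b + c)) ^ N ≤ (N : NNReal)⁻¹ + c by exact_mod_cast h
  rw [← NNReal.coe_le_coe]
  rw [← NNReal.coe_le_coe] at hab'
  push_cast at hab' ⊢
  set x : ℝ := min 1 ((b : ℝ) + c) with hx
  have hx0 : 0 ≤ x := by positivity
  have hx1 : x ≤ 1 := min_le_left _ _
  have hxa : (a : ℝ) ≤ (1 - x) + c := by
    rcases min_le_iff.1 (le_refl x) with h | h
    · have : x = 1 ∨ x = b + c := by rcases min_choice (1 : ℝ) (b + c) with h | h <;> simp [hx, h]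
      rcases this with h' | h'
      · have : (1 : ℝ) ≤ b + c := by rw [← h', hx]; exact min_le_right _ _
        linarith
      · linarith
    · linarith [min_le_right (1 : ℝ) ((b : ℝ) + c), hab']
  have hpow : x ^ N ≤ 1 := pow_le_one₀ hx0 hx1
  have hNpos : (0 : ℝ) < N := by exact_mod_cast Nat.pos_of_ne_zero hN
  -- Each of the `N` terms of the geometric sum is at least `x ^ N`, and `1 - x` times the sum
  -- telescopes to at most `1`.
  have hmain : (1 - x) * x ^ N ≤ (N : ℝ)⁻¹ := by
    have hsum : (1 - x) * ∑ i ∈ Finset.range N, x ^ i = 1 - x ^ N := by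
      have := mul_neg_geom_sum x N
      linarith
    have hge : (N : ℝ) * x ^ N ≤ ∑ i ∈ Finset.range N, x ^ i := by
      calc (N : ℝ) * x ^ N = ∑ i ∈ Finset.range N, x ^ N := by simp
        _ ≤ _ := Finset.sum_le_sum fun i hi =>
          pow_le_pow_of_le_one hx0 hx1 (Finset.mem_range.1 hi).le
    rw [← mul_le_mul_iff_right₀ hNpos, mul_inv_cancel₀ hNpos.ne']
    have h1 : (1 - x) * (N * x ^ N) ≤ (1 - x) * ∑ i ∈ Finset.range N, x ^ i :=
      mul_le_mul_of_nonneg_left hge (by linarith)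
    have h2 : 0 ≤ x ^ N := by positivity
    nlinarith
  have hc0 : (0 : ℝ) ≤ c := c.2
  calc (a : ℝ) * x ^ N ≤ ((1 - x) + c) * x ^ N := by gcongr
    _ = (1 - x) * x ^ N + c * x ^ N := by ring
    _ ≤ (N : ℝ)⁻¹ + c := by nlinarith

/-! ## Random polynomials -/

section RandPoly

open Polynomial

variable {F : Type} [Field F]

/-- Splitting off the value `y` at `x` uses up exactly one coefficient; this keeps the degree
bookkeeping of the simulation exact. -/
theorem degree_C_add_mul_lt {j : ℕ} {r : F[X]} (hr : r.degree < j) (y x : F) :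
    (C y + (X - C x) * r : F[X]).degree < ((j + 1 : ℕ) : WithBot ℕ) := by
  refine (degree_add_le _ _).trans_lt (max_lt ?_ ?_)
  · exact degree_C_le.trans_lt (by exact_mod_cast Nat.succ_pos j)
  · by_cases h0 : r = 0
    · simp only [h0, mul_zero, degree_zero]
      exact WithBot.bot_lt_coe _
    · rw [degree_mul, degree_X_sub_C, degree_eq_natDegree h0]
      rw [degree_eq_natDegree h0] at hr
      have : r.natDegree < j := by exact_mod_cast hr
      exact_mod_cast (by omega : 1 + r.natDegree < j + 1)

variable (F) [Fintype F]

/-- A uniformly random polynomial of degree less than the argument. -/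
def randPoly : ℕ → PMF F[X]
  | 0 => PMF.pure 0
  | j + 1 => (PMF.uniformOfFintype F).bind fun y => (randPoly j).bind fun r =>
      PMF.pure (C y + X * r)

variable {F}

/-- The value of a random polynomial at a point is uniform and independent of the quotient. -/
theorem ex_randPoly_succ (x : F) (j : ℕ) (φ : F[X] → ℝ≥0∞) :
    ex (randPoly F (j + 1)) φ = ex (PMF.uniformOfFintype F) fun y => ex (randPoly F j) fun r =>
      φ (C y + (X - C x) * r) := by
  induction j generalizing φ with
  | zero => simp [randPoly]
  | succ j ih =>
    have h1 : ex (randPoly F (j + 1 + 1)) φ = ex (PMF.uniformOfFintype F) fun y =>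
        ex (randPoly F (j + 1)) fun r => φ (C y + X * r) := by
      conv_lhs => rw [randPoly]
      simp
    have h2 : ∀ y, (ex (randPoly F (j + 1)) fun r => φ (C y + (X - C x) * r)) =
        ex (PMF.uniformOfFintype F) fun y' => ex (randPoly F j) fun r =>
          φ (C y + (X - C x) * (C y' + X * r)) := by
      intro y
      conv_lhs => rw [randPoly]
      simp
    rw [h1]
    simp only [h2, ih]
    rw [ex_comm]
    conv_rhs => rw [ex_comm]
    refine congrArg (ex _) (funext fun y' => ?_)
    -- The two decompositions differ only by `x * y'` in the constant term, and translation by it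
    -- preserves the uniform law of `y`.
    refine Eq.trans (congrArg (ex _) (funext fun y => ?_))
      (ex_uniform_equiv (Equiv.addRight (x * y')) _)
    refine congrArg (ex _) (funext fun r => congrArg φ ?_)
    simp only [Equiv.coe_addRight, C_add, C_mul]
    ring

theorem degree_lt_of_mem_support_randPoly {j : ℕ} {r : F[X]} (hr : r ∈ (randPoly F j).support) :
    r.degree < j := by
  induction j generalizing r with
  | zero =>
    simp only [randPoly, PMF.support_pure, Set.mem_singleton_iff] at hr
    simp [hr]
  | succ j ih =>
    simp only [randPoly, PMF.mem_support_bind_iff, PMF.support_pure, Set.mem_singleton_iff] at hr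
    obtain ⟨y, -, r', hr', rfl⟩ := hr
    simpa using degree_C_add_mul_lt (ih hr') y 0

end RandPoly

/-! ## Programs: combinators, semantics and cost -/

namespace Data

/-- Left component; `nil` for `nil`. -/
def left : Data → Data
  | nil => nil
  | node a _ => a

/-- Right component; `nil` for `nil`. -/
def right : Data → Data
  | nil => nil
  | node _ b => b

@[simp] theorem left_node (a b : Data) : (node a b).left = a := rfl
@[simp] theorem right_node (a b : Data) : (node a b).right = b := rfl
@[simp] theorem left_nil : nil.left = nil := rfl
@[simp] theorem right_nil : nil.right = nil := rfl

@[simp] theorem length_unary (n : ℕ) : (unary n).length = n := by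
  induction n with
  | zero => rfl
  | succ n ih => simp [unary, length, ih]

/-- The second alternative for `nil`, the first one for all other values. -/
def branch {γ : Type*} : Data → γ → γ → γ
  | nil, _, y => y
  | node _ _, x, _ => x

@[simp] theorem branch_nil {γ : Type*} (x y : γ) : nil.branch x y = y := rfl
@[simp] theorem branch_node {γ : Type*} (a b : Data) (x y : γ) : (node a b).branch x y = x := rfl
@[simp] theorem branch_tt {γ : Type*} (x y : γ) : tt.branch x y = x := rfl

theorem branch_of_ne {γ : Type*} {a : Data} (h : a ≠ nil) (x y : γ) : a.branch x y = x := by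
  cases a with
  | nil => exact absurd rfl h
  | node a b => rfl

theorem branch_eq_ite {γ : Type*} (a : Data) (x y : γ) :
    a.branch x y = if a = nil then y else x := by
  split_ifs with h
  · rw [h, branch_nil]
  · exact branch_of_ne h x y

@[simp] theorem branch_ofBool {γ : Type*} (b : Bool) (x y : γ) :
    (ofBool b).branch x y = if b then x else y := by
  cases b <;> simp [ofBool]

theorem ofList_injective : Function.Injective ofList := by
  intro l l' h
  induction l generalizing l' with
  | nil => cases l' with
    | nil => rfl
    | cons b l' => simp [ofList] at h
  | cons a l ih => cases l' with
    | nil => simp [ofList] at h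
    | cons b l' =>
      simp only [ofList, node.injEq] at h
      rw [h.1, ih h.2]

theorem ofBool_injective : Function.Injective ofBool := by
  intro a b h
  cases a <;> cases b <;> simp_all [ofBool, tt]

@[simp] theorem ofBool_eq_nil (b : Bool) : ofBool b = nil ↔ b = false := by
  cases b <;> simp [ofBool, tt]

end Data

/-! ### Decoding and the elementary instructions -/

theorem decode_enc {α : Type} {enc : α → Data} (h : Function.Injective enc) (a : α) :
    decode enc (enc a) = some a := by
  have hex : ∃ a', enc a' = enc a := ⟨a, rfl⟩
  rw [decode, dif_pos hex, h hex.choose_spec]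

theorem enc_of_decode {α : Type} {enc : α → Data} {t : Data} {a : α} (h : decode enc t = some a) :
    enc a = t := by
  unfold decode at h
  split_ifs at h with hex
  rw [← Option.some.inj h]
  exact hex.choose_spec

namespace BilinearGroup

variable (B : BilinearGroup)

theorem encZ_injective : Function.Injective B.encZ := by
  intro s t h
  have h1 := Data.ofList_injective h
  have h2 := List.map_injective_iff.2 Data.ofBool_injective h1
  apply ZMod.val_injective
  refine (Nat.digits_inj_iff (b := 2)).1 ?_
  rw [Nat.digits_two_eq_bits, h2, Nat.digits_two_eq_bits]

@[simp] theorem decZ_encZ (s : B.Scalar) : B.decZ (B.encZ s) = some s :=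
  decode_enc B.encZ_injective s
@[simp] theorem decG_encG (x : B.G) : B.decG (B.encG x) = some x :=
  decode_enc B.encG_injective x
@[simp] theorem decGT_encGT (x : B.GT) : B.decGT (B.encGT x) = some x :=
  decode_enc B.encGT_injective x

end BilinearGroup

namespace Op

variable (B : BilinearGroup)

@[simp] theorem eval_zone (t : Data) : zone.eval B t = B.encZ 1 := rfl
@[simp] theorem eval_zadd (x y : B.Scalar) :
    zadd.eval B (.node (B.encZ x) (B.encZ y)) = B.encZ (x + y) := by simp [eval, liftPair]
@[simp] theorem eval_zmul (x y : B.Scalar) :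
    zmul.eval B (.node (B.encZ x) (B.encZ y)) = B.encZ (x * y) := by simp [eval, liftPair]
@[simp] theorem eval_zneg (x : B.Scalar) : zneg.eval B (B.encZ x) = B.encZ (-x) := by
  simp [eval, liftOne]
@[simp] theorem eval_zinv (x : B.Scalar) : zinv.eval B (B.encZ x) = B.encZ x⁻¹ := by
  simp [eval, liftOne]
@[simp] theorem eval_zeq (x y : B.Scalar) :
    zeq.eval B (.node (B.encZ x) (B.encZ y)) = Data.ofBool (decide (x = y)) := by
  simp [eval, liftPair]
@[simp] theorem eval_gmul (x y : B.G) :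
    gmul.eval B (.node (B.encG x) (B.encG y)) = B.encG (x * y) := by simp [eval, liftPair]
@[simp] theorem eval_gpow (x : B.G) (s : B.Scalar) :
    gpow.eval B (.node (B.encG x) (B.encZ s)) = B.encG (B.exp x s) := by simp [eval, liftPair]
@[simp] theorem eval_geq (x y : B.G) :
    geq.eval B (.node (B.encG x) (B.encG y)) = Data.ofBool (decide (x = y)) := by
  simp [eval, liftPair]
@[simp] theorem eval_tmul (x y : B.GT) :
    tmul.eval B (.node (B.encGT x) (B.encGT y)) = B.encGT (x * y) := by simp [eval, liftPair]
@[simp] theorem eval_tpow (x : B.GT) (s : B.Scalar) :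
    tpow.eval B (.node (B.encGT x) (B.encZ s)) = B.encGT (B.exp x s) := by simp [eval, liftPair]
@[simp] theorem eval_teq (x y : B.GT) :
    teq.eval B (.node (B.encGT x) (B.encGT y)) = Data.ofBool (decide (x = y)) := by
  simp [eval, liftPair]
@[simp] theorem eval_pairing (x y : B.G) :
    pairing.eval B (.node (B.encG x) (B.encG y)) = B.encGT (B.e x y) := by simp [eval, liftPair]

/-- Ill-formed operands give `nil`, so comparing a datum with itself is how a program tests whether
it encodes a scalar. -/
theorem eval_zeq_self (t : Data) :
    zeq.eval B (.node t t) = Data.ofBool (B.decZ t).isSome := by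
  cases h : B.decZ t <;> simp [eval, liftPair, h, Data.ofBool]
theorem eval_geq_self (t : Data) :
    geq.eval B (.node t t) = Data.ofBool (B.decG t).isSome := by
  cases h : B.decG t <;> simp [eval, liftPair, h, Data.ofBool]
theorem eval_teq_enc (t : Data) (y : B.GT) :
    teq.eval B (.node t (B.encGT y)) = Data.ofBool (decide (t = B.encGT y)) := by
  cases h : B.decGT t with
  | none =>
    have : t ≠ B.encGT y := by rintro rfl; simp at h
    simp [eval, liftPair, h, this, Data.ofBool]
  | some x =>
    rw [← enc_of_decode h]
    simp [B.encGT_injective.eq_iff]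

end Op

namespace Prog

/-! ### Combinators

A program runs on `node 1ⁿ e` where the environment `e` lists the values of the variables. -/

/-- Run `Q` on the result of `P`. -/
def call (P Q : Prog) : Prog := seq (pair fst P) Q

/-- Push the result of `P` to the environment and run `Q`. -/
def letIn (P Q : Prog) : Prog := seq (pair fst (pair P snd)) Q

def left (P : Prog) : Prog := seq P fst
def right (P : Prog) : Prog := seq P snd
def op1 (o : Op) (P : Prog) : Prog := seq P (op o)
def op2 (o : Op) (P Q : Prog) : Prog := seq (pair P Q) (op o)

/-- The environment without its first `i` entries. -/
def env : ℕ → Prog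
  | 0 => snd
  | i + 1 => right (env i)

/-- The `i`-th entry of the environment. -/
def var (i : ℕ) : Prog := left (env i)

/-- Iterate `P`, as a map on environments, `n ^ K` times. -/
def rep : ℕ → Prog → Prog
  | 0, P => P
  | K + 1, P => seq (seq (pair fst skip) (loop (pair fst (rep K P)))) snd

/-- Starting with the value of `init`, iterate `body`, which finds the current value as the
first entry of the environment, `n ^ K` times. -/
def forLoop (K : ℕ) (init body : Prog) : Prog :=
  letIn init (left (rep K (pair body (env 1))))

/-! ### Semantics -/

/-- The expectation of a function of the output on the input `t`. -/
def ev (B : BilinearGroup) (P : Prog) (t : Data) (φ : Data → ℝ≥0∞) : ℝ≥0∞ :=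
  ex (P.run B t) fun r => φ r.1

/-- The expectation of a function of the output on the input `(1ⁿ, x)`. -/
def wp (𝒢 : BilinearFamily) (n : ℕ) (P : Prog) (x : Data) (φ : Data → ℝ≥0∞) : ℝ≥0∞ :=
  ex (P.output 𝒢 n x) φ

section Ev

variable (B : BilinearGroup) (P Q C : Prog) (t : Data) (φ : Data → ℝ≥0∞)

@[simp] theorem ev_skip : ev B skip t φ = φ t := by simp [ev, run]
@[simp] theorem ev_nil : ev B nil t φ = φ .nil := by simp [ev, run]
@[simp] theorem ev_fst : ev B fst t φ = φ t.left := by cases t <;> simp [ev, run]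
@[simp] theorem ev_snd : ev B snd t φ = φ t.right := by cases t <;> simp [ev, run]
@[simp] theorem ev_pair :
    ev B (pair P Q) t φ = ev B P t fun a => ev B Q t fun b => φ (.node a b) := by
  simp [ev, run]
@[simp] theorem ev_seq : ev B (seq P Q) t φ = ev B P t fun a => ev B Q a φ := by
  simp [ev, run]
@[simp] theorem ev_cond :
    ev B (cond C P Q) t φ = ev B C t fun a => a.branch (ev B P t φ) (ev B Q t φ) := by
  simp only [ev, run, ex_bind, ex_pure, Data.branch_eq_ite]
  congr 1
  funext r
  split_ifs <;> rfl
@[simp] theorem ev_op (o : Op) : ev B (op o) t φ = φ (o.eval B t) := by simp [ev, run]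
@[simp] theorem ev_rand :
    ev B rand t φ = ex (PMF.uniformOfFintype B.Scalar) fun s => φ (B.encZ s) := by
  simp [ev, run]

theorem ev_loop (x l : Data) :
    ev B (loop P) (.node l x) φ = (fun ψ y => ev B P y ψ)^[l.length] φ x := by
  have : ∀ k x, (ex (iterSteps (P.run B) k x) fun r => φ r.1) =
      (fun ψ y => ev B P y ψ)^[k] φ x := by
    intro k
    induction k with
    | zero => intro x; simp [iterSteps]
    | succ k ih =>
      intro x
      rw [Function.iterate_succ_apply']
      simp only [iterSteps, ex_bind, ex_pure, ih]
      rfl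
  exact this _ _

end Ev

section Wp

variable (𝒢 : BilinearFamily) (n : ℕ) (P Q C : Prog) (x : Data) (φ : Data → ℝ≥0∞)

theorem wp_eq_ev : wp 𝒢 n P x φ = ev (𝒢.grp n) P (.node (.unary n) x) φ := by
  simp [wp, output, ev]

@[simp] theorem wp_nil : wp 𝒢 n nil x φ = φ .nil := by simp [wp_eq_ev]
@[simp] theorem wp_snd : wp 𝒢 n snd x φ = φ x := by simp [wp_eq_ev]
@[simp] theorem wp_pair :
    wp 𝒢 n (pair P Q) x φ = wp 𝒢 n P x fun a => wp 𝒢 n Q x fun b => φ (.node a b) := by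
  simp [wp_eq_ev]
@[simp] theorem wp_cond :
    wp 𝒢 n (cond C P Q) x φ =
      wp 𝒢 n C x fun a => a.branch (wp 𝒢 n P x φ) (wp 𝒢 n Q x φ) := by
  simp [wp_eq_ev]
@[simp] theorem wp_rand : wp 𝒢 n rand x φ =
    ex (PMF.uniformOfFintype (𝒢.grp n).Scalar) fun s => φ ((𝒢.grp n).encZ s) := by
  simp [wp_eq_ev]
@[simp] theorem wp_call : wp 𝒢 n (call P Q) x φ = wp 𝒢 n P x fun y => wp 𝒢 n Q y φ := by
  simp [wp_eq_ev, call]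
@[simp] theorem wp_letIn :
    wp 𝒢 n (letIn P Q) x φ = wp 𝒢 n P x fun y => wp 𝒢 n Q (.node y x) φ := by
  simp [wp_eq_ev, letIn]
@[simp] theorem wp_left : wp 𝒢 n (left P) x φ = wp 𝒢 n P x fun y => φ y.left := by
  simp [wp_eq_ev, left]
@[simp] theorem wp_right : wp 𝒢 n (right P) x φ = wp 𝒢 n P x fun y => φ y.right := by
  simp [wp_eq_ev, right]
@[simp] theorem wp_op1 (o : Op) :
    wp 𝒢 n (op1 o P) x φ = wp 𝒢 n P x fun y => φ (o.eval (𝒢.grp n) y) := by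
  simp [wp_eq_ev, op1]
@[simp] theorem wp_op2 (o : Op) : wp 𝒢 n (op2 o P Q) x φ =
    wp 𝒢 n P x fun y => wp 𝒢 n Q x fun z => φ (o.eval (𝒢.grp n) (.node y z)) := by
  simp [wp_eq_ev, op2]
@[simp] theorem wp_env (i : ℕ) : wp 𝒢 n (env i) x φ = φ (Data.right^[i] x) := by
  induction i generalizing φ with
  | zero => simp [env]
  | succ i ih => rw [env, wp_right, ih, Function.iterate_succ_apply']
@[simp] theorem wp_var (i : ℕ) : wp 𝒢 n (var i) x φ = φ (Data.right^[i] x).left := by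
  simp [var]

/-- The only counter at hand is `1ⁿ`. Each nested loop carries it along as the left component and
multiplies the number of passes by `n`. -/
theorem wp_rep (K : ℕ) :
    wp 𝒢 n (rep K P) x φ = (fun ψ y => wp 𝒢 n P y ψ)^[n ^ K] φ x := by
  induction K generalizing x φ with
  | zero => simp [rep]
  | succ K ih =>
    have h : ∀ m x (ψ : Data → ℝ≥0∞),
        (fun ψ y => ev (𝒢.grp n) (pair fst (rep K P)) y ψ)^[m] (fun y => ψ y.right)
          (.node (.unary n) x) = (fun ψ y => wp 𝒢 n P y ψ)^[n ^ K * m] ψ x := by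
      intro m
      induction m with
      | zero => intro x ψ; simp
      | succ m ihm =>
        intro x ψ
        rw [Function.iterate_succ_apply', mul_add_one, add_comm, Function.iterate_add_apply,
          ← ih, wp_eq_ev]
        rw [ev_pair, ev_fst]
        exact congrArg (ev _ _ _) (funext fun a => ihm a ψ)
    rw [wp_eq_ev, rep, pow_succ]
    simp only [ev_seq, ev_pair, ev_fst, ev_skip, Data.left_node, ev_snd]
    rw [ev_loop, Data.length_unary, h]

@[simp] theorem wp_forLoop (K : ℕ) :
    wp 𝒢 n (forLoop K P Q) x φ =
      wp 𝒢 n P x fun d => (fun ψ d => wp 𝒢 n Q (.node d x) ψ)^[n ^ K] φ d := by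
  have h : ∀ m d, (fun ψ y => wp 𝒢 n (pair Q (env 1)) y ψ)^[m] (fun y => φ y.left)
      (.node d x) = (fun ψ d => wp 𝒢 n Q (.node d x) ψ)^[m] φ d := by
    intro m
    induction m with
    | zero => intro d; rfl
    | succ m ih =>
      intro d
      rw [Function.iterate_succ_apply', Function.iterate_succ_apply']
      rw [wp_pair]
      refine congrArg (wp _ _ _ _) (funext fun a => ?_)
      rw [wp_env]
      exact ih a
  rw [forLoop, wp_letIn]
  simp only [wp_left, wp_rep, h]

end Wp

/-! ### Cost -/

section Cost

variable {𝒢 : BilinearFamily} {P Q C : Prog}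

theorem isPPT_const {k : ℕ} (h : ∀ B t, ∀ r ∈ (P.run B t).support, r.2 ≤ k) : P.IsPPT 𝒢 :=
  ⟨Polynomial.C k, fun n x r hr => by simpa using h _ _ r hr⟩

theorem isPPT_nil : nil.IsPPT 𝒢 := isPPT_const (k := 1) fun B t r hr => by
  simp only [run, PMF.support_pure, Set.mem_singleton_iff] at hr; simp [hr]
theorem isPPT_snd : snd.IsPPT 𝒢 := isPPT_const (k := 1) fun B t r hr => by
  simp only [run, PMF.support_pure, Set.mem_singleton_iff] at hr; simp [hr]
theorem isPPT_rand : rand.IsPPT 𝒢 := isPPT_const (k := 1) fun B t r hr => by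
  simp only [run, PMF.mem_support_bind_iff, PMF.support_pure, Set.mem_singleton_iff] at hr
  obtain ⟨s, -, rfl⟩ := hr
  simp

theorem isPPT_pair (hP : P.IsPPT 𝒢) (hQ : Q.IsPPT 𝒢) : (pair P Q).IsPPT 𝒢 := by
  obtain ⟨T, hT⟩ := hP
  obtain ⟨U, hU⟩ := hQ
  refine ⟨T + U + 1, fun n x r hr => ?_⟩
  simp only [run, PMF.mem_support_bind_iff, PMF.support_pure, Set.mem_singleton_iff] at hr
  obtain ⟨a, ha, b, hb, rfl⟩ := hr
  have := hT n x a ha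
  have := hU n x b hb
  simp only [Polynomial.eval_add, Polynomial.eval_one]
  omega

theorem isPPT_cond (hC : C.IsPPT 𝒢) (hP : P.IsPPT 𝒢) (hQ : Q.IsPPT 𝒢) :
    (cond C P Q).IsPPT 𝒢 := by
  obtain ⟨S, hS⟩ := hC
  obtain ⟨T, hT⟩ := hP
  obtain ⟨U, hU⟩ := hQ
  refine ⟨S + T + U + 1, fun n x r hr => ?_⟩
  simp only [run, PMF.mem_support_bind_iff, PMF.support_pure, Set.mem_singleton_iff] at hr
  obtain ⟨a, ha, b, hb, rfl⟩ := hr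
  have := hS n x a ha
  simp only [Polynomial.eval_add, Polynomial.eval_one]
  split_ifs at hb
  · have := hU n x b hb
    omega
  · have := hT n x b hb
    omega

theorem isPPT_seq_const {k : ℕ} (hP : P.IsPPT 𝒢)
    (hQ : ∀ B t, ∀ r ∈ (Q.run B t).support, r.2 ≤ k) : (seq P Q).IsPPT 𝒢 := by
  obtain ⟨T, hT⟩ := hP
  refine ⟨T + Polynomial.C k + 1, fun n x r hr => ?_⟩
  simp only [run, PMF.mem_support_bind_iff, PMF.support_pure, Set.mem_singleton_iff] at hr
  obtain ⟨a, ha, b, hb, rfl⟩ := hr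
  have := hT n x a ha
  have := hQ _ _ b hb
  simp only [Polynomial.eval_add, Polynomial.eval_one, Polynomial.eval_C]
  omega

theorem isPPT_left (hP : P.IsPPT 𝒢) : (left P).IsPPT 𝒢 :=
  isPPT_seq_const (k := 1) hP fun B t r hr => by
    simp only [run, PMF.support_pure, Set.mem_singleton_iff] at hr; simp [hr]
theorem isPPT_right (hP : P.IsPPT 𝒢) : (right P).IsPPT 𝒢 :=
  isPPT_seq_const (k := 1) hP fun B t r hr => by
    simp only [run, PMF.support_pure, Set.mem_singleton_iff] at hr; simp [hr]
theorem isPPT_op1 (o : Op) (hP : P.IsPPT 𝒢) : (op1 o P).IsPPT 𝒢 :=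
  isPPT_seq_const (k := 1) hP fun B t r hr => by
    simp only [run, PMF.support_pure, Set.mem_singleton_iff] at hr; simp [hr]
theorem isPPT_op2 (o : Op) (hP : P.IsPPT 𝒢) (hQ : Q.IsPPT 𝒢) : (op2 o P Q).IsPPT 𝒢 :=
  isPPT_seq_const (k := 1) (isPPT_pair hP hQ) fun B t r hr => by
    simp only [run, PMF.support_pure, Set.mem_singleton_iff] at hr; simp [hr]

theorem mem_support_run_pair_fst {B : BilinearGroup} {l x : Data} {r : Data × ℕ}
    (hr : r ∈ ((pair fst P).run B (.node l x)).support) :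
    ∃ a ∈ (P.run B (.node l x)).support, r = (.node l a.1, a.2 + 2) := by
  simp only [run, PMF.mem_support_bind_iff, PMF.support_pure, Set.mem_singleton_iff] at hr
  obtain ⟨-, rfl, a, ha, rfl⟩ := hr
  exact ⟨a, ha, by simp; omega⟩

/-- The step bound in `IsPPT` depends on `n` alone and holds for all inputs. Since `call` passes
`1ⁿ` on, no bound on the size of intermediate results is needed; the same remark covers loops. -/
theorem isPPT_call (hP : P.IsPPT 𝒢) (hQ : Q.IsPPT 𝒢) : (call P Q).IsPPT 𝒢 := by
  obtain ⟨T, hT⟩ := hP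
  obtain ⟨U, hU⟩ := hQ
  refine ⟨T + U + 3, fun n x r hr => ?_⟩
  rw [call, run] at hr
  simp only [PMF.mem_support_bind_iff, PMF.support_pure, Set.mem_singleton_iff] at hr
  obtain ⟨a, ha, b, hb, rfl⟩ := hr
  obtain ⟨a, ha', rfl⟩ := mem_support_run_pair_fst ha
  have := hT n x a ha'
  have := hU n _ b hb
  simp only [Polynomial.eval_add, Polynomial.eval_ofNat]
  omega

theorem isPPT_letIn (hP : P.IsPPT 𝒢) (hQ : Q.IsPPT 𝒢) : (letIn P Q).IsPPT 𝒢 :=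
  isPPT_call (isPPT_pair hP isPPT_snd) hQ

theorem isPPT_env (i : ℕ) : (env i).IsPPT 𝒢 := by
  induction i with
  | zero => exact isPPT_snd
  | succ i ih => exact isPPT_right ih

theorem isPPT_var (i : ℕ) : (var i).IsPPT 𝒢 := isPPT_left (isPPT_env i)

theorem isPPT_loop (hP : P.IsPPT 𝒢) : (seq (pair fst skip) (loop (pair fst P))).IsPPT 𝒢 := by
  obtain ⟨T, hT⟩ := hP
  have h : ∀ n k x, ∀ r ∈ (iterSteps ((pair fst P).run (𝒢.grp n)) k
      (.node (.unary n) x)).support, r.2 ≤ k * (T.eval n + 3) + 1 := by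
    intro n k
    induction k with
    | zero =>
      intro x r hr
      simp only [iterSteps, PMF.support_pure, Set.mem_singleton_iff] at hr
      simp [hr]
    | succ k ih =>
      intro x r hr
      rw [iterSteps] at hr
      simp only [PMF.mem_support_bind_iff, PMF.support_pure, Set.mem_singleton_iff] at hr
      obtain ⟨a, ha, b, hb, rfl⟩ := hr
      obtain ⟨a, ha', rfl⟩ := mem_support_run_pair_fst ha
      have := hT n x a ha'
      have := ih _ b hb
      simp only [add_mul, one_mul] at *
      omega
  refine ⟨Polynomial.X * (T + 3) + 5, fun n x r hr => ?_⟩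
  rw [run] at hr
  simp only [PMF.mem_support_bind_iff, PMF.support_pure, Set.mem_singleton_iff] at hr
  obtain ⟨a, ha, b, hb, rfl⟩ := hr
  obtain ⟨a, ha', rfl⟩ := mem_support_run_pair_fst ha
  simp only [run, PMF.support_pure, Set.mem_singleton_iff] at ha'
  subst ha'
  simp only [run, Data.length_unary] at hb
  have := h n n _ b hb
  simp only [Polynomial.eval_add, Polynomial.eval_ofNat, Polynomial.eval_mul, Polynomial.eval_X]
  omega

theorem isPPT_rep (K : ℕ) (hP : P.IsPPT 𝒢) : (rep K P).IsPPT 𝒢 := by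
  induction K with
  | zero => exact hP
  | succ K ih => exact isPPT_right (isPPT_loop ih)

theorem isPPT_forLoop (K : ℕ) (hP : P.IsPPT 𝒢) (hQ : Q.IsPPT 𝒢) :
    (forLoop K P Q).IsPPT 𝒢 :=
  isPPT_letIn hP (isPPT_left (isPPT_rep K (isPPT_pair hQ (isPPT_env 1))))

end Cost

end Prog

/-! ## Exponents -/

namespace BilinearGroup

variable (B : BilinearGroup)

section Exp

variable {H : Type} [CommGroup H]

theorem exp_zero (x : H) : B.exp x 0 = 1 := by simp [exp]
theorem exp_one (x : H) : B.exp x 1 = x := by simp [exp, ZMod.val_one]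
theorem one_exp (a : B.Scalar) : B.exp (1 : H) a = 1 := by simp [exp]
theorem exp_add {x : H} (hx : x ^ B.p = 1) (a b : B.Scalar) :
    B.exp x (a + b) = B.exp x a * B.exp x b := by
  rw [exp, ZMod.val_add, ← pow_eq_pow_mod _ hx, pow_add]; rfl

theorem exp_mul {x : H} (hx : x ^ B.p = 1) (a b : B.Scalar) :
    B.exp x (a * b) = B.exp (B.exp x a) b := by
  rw [exp, ZMod.val_mul, ← pow_eq_pow_mod _ hx, pow_mul]; rfl

theorem exp_neg {x : H} (hx : x ^ B.p = 1) (a : B.Scalar) : B.exp x (-a) = (B.exp x a)⁻¹ := by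
  rw [eq_inv_iff_mul_eq_one, ← B.exp_add hx, neg_add_cancel, exp_zero]

theorem exp_injective {x : H} (hx : x ^ B.p = 1) (h1 : x ≠ 1) :
    Function.Injective (B.exp x) := by
  intro a b h
  by_contra hab
  have hab' : a - b ≠ 0 := sub_ne_zero.2 hab
  have h0 : B.exp x (a - b) = 1 := by
    rw [sub_eq_add_neg, B.exp_add hx, B.exp_neg hx, h, mul_inv_cancel]
  apply h1
  rw [← B.exp_one x, ← mul_inv_cancel₀ hab', B.exp_mul hx, h0, B.one_exp]

end Exp

theorem pow_p (x : B.G) : x ^ B.p = 1 := by rw [← B.card_G]; exact pow_card_eq_one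
theorem pow_p_GT (x : B.GT) : x ^ B.p = 1 := by rw [← B.card_GT]; exact pow_card_eq_one

theorem exp_bijective {g : B.G} (hg : g ≠ 1) : Function.Bijective (B.exp g) := by
  rw [Fintype.bijective_iff_injective_and_card, B.card_G, ZMod.card]
  exact ⟨B.exp_injective (B.pow_p g) hg, rfl⟩

theorem exp_bijective_GT {g : B.GT} (hg : g ≠ 1) : Function.Bijective (B.exp g) := by
  rw [Fintype.bijective_iff_injective_and_card, B.card_GT, ZMod.card]
  exact ⟨B.exp_injective (B.pow_p_GT g) hg, rfl⟩

theorem e_exp (x y : B.G) (a b : B.Scalar) :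
    B.e (B.exp x a) (B.exp y b) = B.exp (B.e x y) (a * b) := by
  have h := B.bilinear x y a.val b.val
  rw [zpow_natCast, zpow_natCast] at h
  rw [exp, exp, h, exp, ZMod.val_mul, ← pow_eq_pow_mod _ (B.pow_p_GT _)]
  rw [← zpow_natCast]
  push_cast
  rfl

theorem e_exp_left (x : B.G) (a : B.Scalar) : B.e (B.exp x a) x = B.exp (B.e x x) a := by
  simpa [exp_one] using B.e_exp x x a 1

theorem e_exp_right (x : B.G) (b : B.Scalar) : B.e x (B.exp x b) = B.exp (B.e x x) b := by
  simpa [exp_one] using B.e_exp x x 1 b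

instance : Nonempty B.G := ⟨1⟩
instance : Nonempty B.GT := ⟨1⟩

/-! ## Uniform distributions on scalars and group elements -/

theorem ex_uniform_exp {g : B.G} (hg : g ≠ 1) (f : B.G → ℝ≥0∞) :
    ex (PMF.uniformOfFintype B.G) f =
      ex (PMF.uniformOfFintype B.Scalar) fun s => f (B.exp g s) :=
  (ex_uniform_equiv (Equiv.ofBijective _ (B.exp_bijective hg)) f).symm

theorem ex_uniform_exp_GT {g : B.GT} (hg : g ≠ 1) (f : B.GT → ℝ≥0∞) :
    ex (PMF.uniformOfFintype B.GT) f =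
      ex (PMF.uniformOfFintype B.Scalar) fun s => f (B.exp g s) :=
  (ex_uniform_equiv (Equiv.ofBijective _ (B.exp_bijective_GT hg)) f).symm

theorem nonzero_nonempty : (Finset.univ.filter fun s : B.Scalar => s ≠ 0).Nonempty :=
  ⟨1, by simp⟩

theorem distinct_nonempty : (Finset.univ.filter fun s : B.Scalar × B.Scalar =>
    s.1 ≠ 0 ∧ s.2 ≠ 0 ∧ s.1 ≠ s.2).Nonempty := by
  have : Fact (2 < B.p) := ⟨B.two_lt⟩
  exact ⟨(1, -1), by simpa using (ZMod.neg_one_ne_one (n := B.p)).symm⟩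

theorem ex_uniform_units (f : B.Scalar → ℝ≥0∞) :
    (ex (PMF.uniformOfFintype B.Scalarˣ) fun s => f s) =
      ex (PMF.uniformOfFinset (Finset.univ.filter fun s : B.Scalar => s ≠ 0)
        B.nonzero_nonempty) f := by
  rw [ex_uniformOfFintype, ex_uniformOfFinset]
  congr 1
  · refine Finset.sum_bij (fun s _ => (s : B.Scalar)) (by simp) (fun a _ b _ h => Units.ext h)
      (fun b hb => ?_) (by simp)
    exact ⟨Units.mk0 b (by simpa using hb), by simp, rfl⟩
  · congr 1
    refine Finset.card_bij (fun s _ => (s : B.Scalar)) (by simp) (fun a _ b _ h => Units.ext h)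
      (fun b hb => ?_)
    exact ⟨Units.mk0 b (by simpa using hb), by simp, rfl⟩

theorem card_compl_units :
    (((Finset.univ.filter fun s : B.Scalar => s ≠ 0)ᶜ).card : ℝ≥0∞) / Fintype.card B.Scalar =
      (B.p : ℝ≥0∞)⁻¹ := by
  have : (Finset.univ.filter fun s : B.Scalar => s ≠ 0)ᶜ = {0} := by ext; simp
  rw [this, ZMod.card]
  simp

theorem ex_units_le {f : B.Scalar → ℝ≥0∞} (hf : ∀ s, f s ≤ 1) :
    (ex (PMF.uniformOfFintype B.Scalarˣ) fun s => f s) ≤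
      ex (PMF.uniformOfFintype B.Scalar) f + (B.p : ℝ≥0∞)⁻¹ := by
  rw [ex_uniform_units, ← card_compl_units]
  exact ex_uniformOfFinset_le _ hf

theorem le_ex_units {f : B.Scalar → ℝ≥0∞} (hf : ∀ s, f s ≤ 1) :
    ex (PMF.uniformOfFintype B.Scalar) f ≤
      (ex (PMF.uniformOfFintype B.Scalarˣ) fun s => f s) + (B.p : ℝ≥0∞)⁻¹ := by
  rw [ex_uniform_units, ← card_compl_units]
  exact le_ex_uniformOfFinset _ hf

/-- In a group of prime order every fixed `g ≠ 1` generates, so the discrete logarithm of a random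
non-identity element is a uniform unit. The element `h` of a challenge thereby becomes `g^η`. -/
theorem ex_randGen {g : B.G} (hg : g ≠ 1) (f : B.G → ℝ≥0∞) :
    ex B.randGen f =
      ex (PMF.uniformOfFintype B.Scalarˣ) fun s => f (B.exp g s) := by
  rw [B.ex_uniform_units fun s => f (B.exp g s), ex_uniformOfFinset]
  refine (ex_uniformOfFinset _ _ _).trans ?_
  have hb := B.exp_bijective hg
  have h0 : ∀ s, B.exp g s = 1 ↔ s = 0 := fun s => by
    rw [← B.exp_zero g, hb.1.eq_iff]
  have himg : (Finset.univ.filter fun s : B.Scalar => s ≠ 0).image (B.exp g) =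
      Finset.univ.filter fun x : B.G => x ≠ 1 := by
    ext y
    obtain ⟨s, rfl⟩ := hb.2 y
    simp [h0, hb.1.eq_iff]
  rw [← himg, Finset.sum_image (fun a _ b _ h => hb.1 h), Finset.card_image_of_injective _ hb.1]

theorem mem_support_randGen {g : B.G} (h : g ∈ B.randGen.support) : g ≠ 1 := by
  rw [randGen, PMF.mem_support_uniformOfFinset_iff] at h
  simpa using h

/-- A scalar hits a given value with probability `1 / p`. -/
theorem ex_uniform_eq (a : B.Scalar) :
    (ex (PMF.uniformOfFintype B.Scalar) fun s => if s = a then 1 else 0) = (B.p : ℝ≥0∞)⁻¹ := by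
  rw [← apply_eq_ex, PMF.uniformOfFintype_apply, ZMod.card]

theorem ex_randDistinct (f : B.Scalar → B.Scalar → ℝ≥0∞) :
    (ex B.randDistinct fun s => f s.1 s.2) =
      ex (PMF.uniformOfFinset (Finset.univ.filter fun s : B.Scalar × B.Scalar =>
        s.1 ≠ 0 ∧ s.2 ≠ 0 ∧ s.1 ≠ s.2) B.distinct_nonempty) fun s => f s.1 s.2 := by
  refine (ex_uniformOfFinset _ _ _).trans (Eq.trans ?_ (ex_uniformOfFinset _ _ _).symm)
  congr 1
  · refine Finset.sum_bij (fun s _ => ((s.1 : B.Scalar), (s.2 : B.Scalar)))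
      (fun s hs => by simpa [Units.ext_iff] using hs)
      (fun a _ b _ h => by simpa [Prod.ext_iff, Units.ext_iff] using h) (fun b hb => ?_) (by simp)
    simp only [Finset.mem_filter, Finset.mem_univ, true_and] at hb
    exact ⟨(Units.mk0 b.1 hb.1, Units.mk0 b.2 hb.2.1), by simp [Units.ext_iff, hb.2.2], rfl⟩
  · congr 1
    refine Finset.card_bij (fun s _ => ((s.1 : B.Scalar), (s.2 : B.Scalar)))
      (fun s hs => by simpa [Units.ext_iff] using hs)
      (fun a _ b _ h => by simpa [Prod.ext_iff, Units.ext_iff] using h) (fun b hb => ?_)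
    simp only [Finset.mem_filter, Finset.mem_univ, true_and] at hb
    exact ⟨(Units.mk0 b.1 hb.1, Units.mk0 b.2 hb.2.1), by simp [Units.ext_iff, hb.2.2], rfl⟩

theorem card_compl_distinct :
    (((Finset.univ.filter fun s : B.Scalar × B.Scalar =>
        s.1 ≠ 0 ∧ s.2 ≠ 0 ∧ s.1 ≠ s.2)ᶜ).card : ℝ≥0∞) / Fintype.card (B.Scalar × B.Scalar) ≤
      3 * (B.p : ℝ≥0∞)⁻¹ := by
  -- The excluded pairs lie on the three lines `s = 0`, `t = 0` and `s = t`, with `p` points each.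
  have hsub : (Finset.univ.filter fun s : B.Scalar × B.Scalar =>
      s.1 ≠ 0 ∧ s.2 ≠ 0 ∧ s.1 ≠ s.2)ᶜ ⊆
      Finset.univ.image (fun s : B.Scalar => ((0 : B.Scalar), s)) ∪
      Finset.univ.image (fun s : B.Scalar => (s, (0 : B.Scalar))) ∪
      Finset.univ.image (fun s : B.Scalar => (s, s)) := by
    rintro ⟨s, t⟩ h
    simp only [Finset.mem_compl, Finset.mem_filter, Finset.mem_univ, true_and, not_and, not_not]
      at h
    simp only [Finset.mem_union, Finset.mem_image, Finset.mem_univ, true_and, Prod.mk.injEq]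
    by_cases hs : s = 0
    · exact Or.inl (Or.inl ⟨t, hs.symm, rfl⟩)
    by_cases ht : t = 0
    · exact Or.inl (Or.inr ⟨s, rfl, ht.symm⟩)
    · exact Or.inr ⟨s, rfl, h hs ht⟩
  have hcard := (Finset.card_le_card hsub).trans ((Finset.card_union_le _ _).trans
    (add_le_add ((Finset.card_union_le _ _).trans
      (add_le_add Finset.card_image_le Finset.card_image_le)) Finset.card_image_le))
  rw [Finset.card_univ, ZMod.card] at hcard
  have h3 : (((Finset.univ.filter fun s : B.Scalar × B.Scalar =>
      s.1 ≠ 0 ∧ s.2 ≠ 0 ∧ s.1 ≠ s.2)ᶜ).card : ℝ≥0∞) ≤ 3 * B.p := by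
    exact_mod_cast hcard.trans (by omega)
  have hp0 : (B.p : ℝ≥0∞) ≠ 0 := by simpa using B.prime.ne_zero
  rw [Fintype.card_prod, ZMod.card]
  refine ENNReal.div_le_of_le_mul (h3.trans_eq ?_)
  push_cast
  rw [mul_assoc, ← mul_assoc (B.p : ℝ≥0∞)⁻¹, ENNReal.inv_mul_cancel hp0 (by simp), one_mul]

theorem ex_uniform_prod (f : B.Scalar → B.Scalar → ℝ≥0∞) :
    (ex (PMF.uniformOfFintype (B.Scalar × B.Scalar)) fun s => f s.1 s.2) =
      ex (PMF.uniformOfFintype B.Scalar) fun s => ex (PMF.uniformOfFintype B.Scalar) fun t =>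
        f s t := by
  simp only [ex_uniformOfFintype, Fintype.sum_prod_type, Fintype.card_prod, div_eq_mul_inv,
    ← Finset.sum_mul, mul_assoc]
  congr 1
  rw [Nat.cast_mul, ENNReal.mul_inv (Or.inr (by simp)) (Or.inl (by simp))]

theorem ex_randDistinct_le {f : B.Scalar → B.Scalar → ℝ≥0∞} (hf : ∀ s t, f s t ≤ 1) :
    (ex B.randDistinct fun s => f s.1 s.2) ≤
      (ex (PMF.uniformOfFintype B.Scalar) fun s => ex (PMF.uniformOfFintype B.Scalar) fun t =>
        f s t) + 3 * (B.p : ℝ≥0∞)⁻¹ := by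
  rw [ex_randDistinct, ← ex_uniform_prod]
  exact (ex_uniformOfFinset_le _ fun s => hf s.1 s.2).trans
    (add_le_add_right B.card_compl_distinct _)

theorem le_ex_randDistinct {f : B.Scalar → B.Scalar → ℝ≥0∞} (hf : ∀ s t, f s t ≤ 1) :
    (ex (PMF.uniformOfFintype B.Scalar) fun s => ex (PMF.uniformOfFintype B.Scalar) fun t =>
      f s t) ≤ (ex B.randDistinct fun s => f s.1 s.2) + 3 * (B.p : ℝ≥0∞)⁻¹ := by
  rw [ex_randDistinct, ← ex_uniform_prod]
  exact (le_ex_uniformOfFinset _ fun s => hf s.1 s.2).trans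
    (add_le_add_right B.card_compl_distinct _)

end BilinearGroup

/-- A list of pairs as data. -/
def encPairs (B : BilinearGroup) (L : List (B.G × B.Scalar)) : Data :=
  Data.ofList (L.map fun a => .node (B.encG a.1) (B.encZ a.2))

/-- One step of synthetic division. -/
def foldStep (B : BilinearGroup) (x : B.Scalar) (s : B.Scalar × B.G) (a : B.G × B.Scalar) :
    B.Scalar × B.G :=
  (a.2 + x * s.1, s.2 * B.exp a.1 s.1)

/-- Pair the elements of a list with the coefficients of a polynomial. -/
def setupState (B : BilinearGroup) (Gs : List B.G) (f : Polynomial B.Scalar) :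
    List (B.G × B.Scalar) :=
  Gs.zip ((List.range Gs.length).map f.coeff)

namespace Prog

/-! ## The programs of the reduction -/

def one : Prog := op1 .zone nil
def zero : Prog := op2 .zadd one (op1 .zneg one)
def sub (P Q : Prog) : Prog := op2 .zadd P (op1 .zneg Q)
/-- The identity of the group of `P`. -/
def unit (P : Prog) : Prog := op2 .gpow P zero
def ginv (P : Prog) : Prog := op2 .gpow P (op1 .zneg one)
def tinv (P : Prog) : Prog := op2 .tpow P (op1 .zneg one)

/-- Synthetic division. Environment: a list of pairs `(gᵢ, aᵢ)`, a scalar `x`, start values `v` and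
`D`. For each entry of the list, `(v, D)` is replaced by `(aᵢ + x v, D · gᵢ ^ v)`. -/
def fold (K : ℕ) : Prog :=
  right (forLoop K (pair (var 0) (pair (var 2) (var 3)))
    (cond (left (var 0))
      (pair (right (left (var 0)))
        (pair (op2 .zadd (right (left (left (var 0)))) (op2 .zmul (var 2) (left (right (var 0)))))
          (op2 .gmul (right (right (var 0)))
            (op2 .gpow (left (left (left (var 0)))) (left (right (var 0)))))))
      (var 0)))

/-- Environment: a list of group elements `gᵢ`. Chooses random scalars `aᵢ` and returns the reversed
list of pairs `(gᵢ, aᵢ)` together with the product of the `gᵢ ^ aᵢ`. -/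
def setup (K : ℕ) : Prog :=
  right (forLoop K (pair (var 0) (pair nil (unit (left (var 0)))))
    (cond (left (var 0))
      (letIn rand
        (pair (right (left (var 1)))
          (pair (pair (pair (left (left (var 1))) (var 0)) (left (right (var 1))))
            (op2 .gmul (right (right (var 1))) (op2 .gpow (left (left (var 1))) (var 0))))))
      (var 0)))

/-- Environment: `c, z, R, a, base, g`. Does the PKG accept the proof of knowledge, and is there a
key for the identity? -/
def accept : Prog :=
  cond (var 1)
    (cond (op2 .zeq (left (var 1)) (left (var 1)))
      (cond (op2 .zeq (right (var 1)) (right (var 1)))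
        (cond (op2 .geq (var 4) (unit (var 5))) nil
          (op2 .geq
            (op2 .gmul (op2 .gpow (var 5) (op1 .zneg (left (var 1))))
              (op2 .gpow (var 4) (right (var 1))))
            (op2 .gmul (var 3) (op2 .gpow (var 2) (var 0)))))
        nil)
      nil)
    nil

/-- One attempt to obtain a second transcript. Environment: the transcript found so far, the
message `z` of the user and her challenge `c`, the state of the user, `ID, R, a, base, L, g`. -/
def rewindBody (user : Prog) : Prog :=
  letIn rand (letIn (call (pair (var 4) (var 0)) user)
    (cond (op2 .zeq (var 1) (var 4)) (var 2)
      (cond (call (pair (var 1) (pair (right (var 0)) (pair (var 7) (pair (var 8) (pair (var 9)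
          (pair (var 11) nil)))))) accept)
        (pair (var 1) (right (var 0)))
        (var 2))))

/-- The answer of the simulated PKG. Environment: two transcripts, the state of the user,
`ID, R, a, base, L, g`. -/
def reply (K : ℕ) : Prog :=
  letIn (op1 .zinv (sub (left (var 0)) (var 2)))
    (letIn (call (pair (var 9) (pair (var 5) (pair zero (pair (unit (var 10)) nil)))) (fold K))
      (pair
        (op2 .gmul (right (var 0)) (op2 .gpow (var 11)
          (op2 .zmul (sub (right (right (var 2))) (right (right (var 3)))) (var 1))))
        (sub (left (var 0))
          (op2 .zmul (sub (left (right (var 2))) (left (right (var 3)))) (var 1)))))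

/-- The simulated key generation protocol after the first message of the user.
Environment: the state of the user, `ID, R, a, base, L, g`. -/
def query (K : ℕ) (user : Prog) : Prog :=
  letIn rand (letIn (call (pair (var 1) (var 0)) user)
    (pair nil (pair (left (var 0))
      (cond (call (pair (var 1) (pair (right (var 0)) (pair (var 4) (pair (var 5) (pair (var 6)
          (pair (var 8) nil)))))) accept)
        (letIn (forLoop K nil (rewindBody user)) (reply K))
        nil))))

/-- One round of the simulated game. Environment: `D, L, H, g, g₁` where `D` is `(nil, state, msg)`
while the game is running and the last move of the user afterwards. -/
def round (K : ℕ) (user : Prog) : Prog :=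
  cond (left (var 0)) (var 0)
    (letIn (call (right (var 0)) user)
      (cond (left (right (var 0))) (right (var 0))
        (call (pair (left (var 0)) (pair (left (right (right (var 0))))
            (pair (left (right (right (right (var 0)))))
            (pair (right (right (right (right (var 0)))))
            (pair (op2 .gmul (var 5) (op2 .gpow (var 4) (op1 .zneg (left (right (right (var 0)))))))
            (pair (var 2) (pair (var 4) nil)))))))
          (query K user))))

/-- The simulated game. Environment: `L, H, g, g₁`. -/
def simulate (K : ℕ) (user : Prog) : Prog :=
  forLoop K (pair nil (pair nil (pair (var 2) (pair (var 3) (var 1))))) (round K user)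

/-- Does the device open `(C₁, C₂, m · e(C₁,d) · C₂^t)` for a random message `m`? Environment:
`w, d, t, g, C₁, C₂`. -/
def deviceTest (device : Prog) : Prog :=
  letIn (op2 .tpow (op2 .pairing (var 3) (var 3)) rand)
    (op2 .teq
      (call (pair (var 1) (pair (var 5) (pair (var 6)
        (op2 .tmul (op2 .tmul (var 0) (op2 .pairing (var 5) (var 2))) (op2 .tpow (var 6) (var 3))))))
        device)
      (var 0))

/-- Environment: `base, w, d, t, g, C₁, C₂` where `(C₁, C₂)` is the challenge. Guesses whether the
challenge ciphertext is well-formed. -/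
def guess (device : Prog) : Prog :=
  letIn (letIn rand (call (pair (var 2) (pair (var 3) (pair (var 4) (pair (var 5)
      (pair (op2 .gpow (var 1) (var 0)) (pair (op2 .tpow (op2 .pairing (var 5) (var 5)) (var 0))
        nil)))))) (deviceTest device)))
    (letIn (letIn rand (call (pair (var 3) (pair (var 4) (pair (var 5) (pair (var 6)
        (pair (op2 .gpow (var 2) (var 0)) (pair (op2 .tpow (op2 .pairing (var 6) (var 6)) rand)
          nil)))))) (deviceTest device)))
      (letIn (call (pair (var 3) (pair (var 4) (pair (var 5) (pair (var 6) (pair (var 7)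
          (pair (var 8) nil)))))) (deviceTest device))
        (cond (var 2) (cond (var 1) nil (var 0))
          (cond (var 1) (cond (var 0) nil (pair nil nil)) nil))))

/-- Environment: `e(M,h), C₁, f(ID), D, base, d, t, w, g, T`. -/
def decideChallenge (device : Prog) : Prog :=
  cond (cond (op2 .geq (var 1) (unit (var 8))) nil (op2 .zeq (var 6) (var 2)))
    (call (pair (var 4) (pair (var 7) (pair (var 5) (pair (var 6) (pair (var 8) (pair (var 1)
      (pair (op2 .tmul (var 9) (var 0)) nil))))))) (guess device))
    (op2 .teq (var 9) (op2 .tmul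
      (op2 .pairing (op2 .gpow (op2 .gmul (var 3) (ginv (var 5)))
        (op1 .zinv (sub (var 6) (var 2)))) (var 1))
      (tinv (var 0))))

/-- Uses the output of the user. Environment: `base, ID, d, t, w, L, H, g, h, h', T`. -/
def exploit (K : ℕ) (device : Prog) : Prog :=
  cond (op2 .geq (var 0) (unit (var 7)))
    (op2 .teq (var 10) (op2 .tpow (op2 .pairing (left (left (var 5))) (var 8)) (var 1)))
    (letIn (call (pair (var 5) (pair (var 1) (pair zero (pair (unit (var 7)) nil)))) (fold K))
      (letIn (call (pair (var 6) (pair (var 2) (pair (var 2) (pair (unit (var 8)) nil)))) (fold K))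
        (call
          (pair (op2 .pairing (op2 .gmul (right (var 0)) (ginv (right (var 1)))) (var 10))
          (pair (op2 .gmul (var 11)
            (op2 .gpow (var 10) (op1 .zneg (sub (left (var 0)) (left (var 1))))))
          (pair (left (var 1)) (pair (right (var 1)) (pair (var 2) (pair (var 4) (pair (var 5)
          (pair (var 6) (pair (var 9) (pair (var 12) nil)))))))))) (decideChallenge device))))

/-- Environment: `ID, d, t, w, L, H, g, g₁, h, h', T`. Checks the key first. -/
def checkKey (K : ℕ) (device : Prog) : Prog :=
  cond (op2 .zeq (var 0) (var 0)) (cond (op2 .geq (var 1) (var 1))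
    (cond (op2 .zeq (var 2) (var 2))
      (letIn (op2 .gmul (var 7) (op2 .gpow (var 6) (op1 .zneg (var 0))))
        (cond (op2 .teq (op2 .pairing (var 2) (var 0))
            (op2 .tmul (op2 .pairing (var 6) (var 7))
              (op2 .tpow (op2 .pairing (var 7) (var 7)) (op1 .zneg (var 3)))))
          (call (pair (var 0) (pair (var 1) (pair (var 2) (pair (var 3) (pair (var 4)
            (pair (var 5) (pair (var 6) (pair (var 7) (pair (var 9) (pair (var 10)
              (pair (var 11) nil))))))))))) (exploit K device))
          nil))
      nil) nil) nil

/-- Environment: the final state of the simulated game, `(L, H)`, the powers of `g`, `h`, `h'`;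
the rest of the environment is `T`. -/
def finish (K : ℕ) (device : Prog) : Prog :=
  cond (left (var 0))
    (call (pair (left (right (var 0))) (pair (left (right (right (var 0))))
      (pair (left (right (right (right (var 0))))) (pair (right (right (right (right (var 0)))))
      (pair (left (var 1)) (pair (right (var 1)) (pair (left (var 2)) (pair (left (right (var 2)))
      (pair (var 3) (pair (var 4) (pair (env 5) nil)))))))))))
      (checkKey K device))
    nil

/-- The distinguisher. -/
def distinguisher (K : ℕ) (A : Adversary) : Prog :=
  letIn (setup K)
    (letIn (call (pair (left (var 0)) (pair (right (var 0)) (pair (left (var 1))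
        (pair (left (right (var 1))) nil)))) (simulate K A.user))
      (finish K A.device))

theorem isPPT_distinguisher {𝒢 : BilinearFamily} (K : ℕ) {A : Adversary} (hA : A.IsPPT 𝒢) :
    (distinguisher K A).IsPPT 𝒢 := by
  have h1 := hA.1
  have h2 := hA.2
  unfold distinguisher finish checkKey exploit decideChallenge guess deviceTest simulate round query reply
    rewindBody accept setup fold tinv ginv unit sub zero one
  repeat' with_reducible first
    | exact h1
    | exact h2
    | exact isPPT_nil
    | exact isPPT_rand
    | exact isPPT_var _
    | exact isPPT_env _
    | apply isPPT_letIn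
    | apply isPPT_call
    | apply isPPT_forLoop
    | apply isPPT_pair
    | apply isPPT_cond
    | apply isPPT_left
    | apply isPPT_right
    | apply isPPT_op1
    | apply isPPT_op2

/-! ### Semantics of the programs -/

section Semantics

variable (𝒢 : BilinearFamily) (n : ℕ) (P Q : Prog) (x : Data) (φ : Data → ℝ≥0∞)

@[simp] theorem wp_one : wp 𝒢 n one x φ = φ ((𝒢.grp n).encZ 1) := by simp [one]
@[simp] theorem wp_zero : wp 𝒢 n zero x φ = φ ((𝒢.grp n).encZ 0) := by simp [zero]
@[simp] theorem wp_sub : wp 𝒢 n (sub P Q) x φ = wp 𝒢 n P x fun a => wp 𝒢 n Q x fun b =>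
    φ (Op.eval (𝒢.grp n) .zadd (.node a (Op.eval (𝒢.grp n) .zneg b))) := by simp [sub]
@[simp] theorem wp_unit : wp 𝒢 n (unit P) x φ = wp 𝒢 n P x fun a =>
    φ (Op.eval (𝒢.grp n) .gpow (.node a ((𝒢.grp n).encZ 0))) := by simp [unit]
@[simp] theorem wp_ginv : wp 𝒢 n (ginv P) x φ = wp 𝒢 n P x fun a =>
    φ (Op.eval (𝒢.grp n) .gpow (.node a ((𝒢.grp n).encZ (-1)))) := by simp [ginv]
@[simp] theorem wp_tinv : wp 𝒢 n (tinv P) x φ = wp 𝒢 n P x fun a =>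
    φ (Op.eval (𝒢.grp n) .tpow (.node a ((𝒢.grp n).encZ (-1)))) := by simp [tinv]

variable {𝒢 n} {K : ℕ}

/-- A loop that consumes the entries of a list. -/
theorem iterate_list {α σ : Type*} {T : (Data → ℝ≥0∞) → Data → ℝ≥0∞} {enc : List α → σ → Data}
    {f : σ → α → σ} (hnil : ∀ s ψ, T ψ (enc [] s) = ψ (enc [] s))
    (hcons : ∀ a l s ψ, T ψ (enc (a :: l) s) = ψ (enc l (f s a))) (ψ : Data → ℝ≥0∞)
    {m : ℕ} {L : List α} (hL : L.length ≤ m) (s : σ) :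
    T^[m] ψ (enc L s) = ψ (enc [] (L.foldl f s)) := by
  induction m generalizing L s with
  | zero =>
    obtain rfl : L = [] := by simpa using hL
    rfl
  | succ m ih =>
    rw [Function.iterate_succ_apply']
    cases L with
    | nil => rw [hnil]; exact ih (L := []) (by simp) s
    | cons a L => rw [hcons]; exact ih (by simpa using hL) _

/-- The list is consumed after at most `n ^ K` passes, and the remaining passes are idle because an
empty list is a fixed point of the body. -/
theorem wp_fold (L : List ((𝒢.grp n).G × (𝒢.grp n).Scalar)) (hL : L.length ≤ n ^ K)
    (s v : (𝒢.grp n).Scalar) (D : (𝒢.grp n).G) (e : Data) :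
    wp 𝒢 n (fold K) (.node (encPairs _ L) (.node ((𝒢.grp n).encZ s) (.node ((𝒢.grp n).encZ v)
        (.node ((𝒢.grp n).encG D) e)))) φ =
      φ (.node ((𝒢.grp n).encZ (L.foldl (foldStep _ s) (v, D)).1)
        ((𝒢.grp n).encG (L.foldl (foldStep _ s) (v, D)).2)) := by
  simp only [fold, wp_right, wp_forLoop, wp_pair, wp_var, Function.iterate_succ,
    Function.iterate_zero, Function.comp, id, Data.left_node, Data.right_node]
  refine iterate_list (f := foldStep _ s)
    (enc := fun L r => .node (encPairs _ L) (.node ((𝒢.grp n).encZ r.1) ((𝒢.grp n).encG r.2)))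
    ?_ ?_ _ hL (v, D)
  · simp [encPairs, Data.ofList]
  · simp [encPairs, Data.ofList, foldStep]

/-- The independent exponents drawn along the list are the coefficients of a random polynomial `f`;
on the powers of `g` the product is `g^f(α)`, the simulated `h`. The accumulator reverses the list,
which puts the leading coefficient first, as synthetic division requires. -/
theorem wp_setup (Gs : List (𝒢.grp n).G) (hGs : Gs.length ≤ n ^ K) (hne : Gs ≠ []) (e : Data) :
    wp 𝒢 n (setup K) (.node (.ofList (Gs.map (𝒢.grp n).encG)) e) φ =
      ex (randPoly (𝒢.grp n).Scalar Gs.length) fun f =>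
        φ (.node (encPairs _ (setupState _ Gs f).reverse)
          ((𝒢.grp n).encG ((setupState _ Gs f).map fun a => (𝒢.grp n).exp a.1 a.2).prod)) := by
  simp only [setup, wp_right, wp_forLoop, wp_pair, wp_var, Function.iterate_zero, id, Data.left_node,
    wp_nil, wp_unit, wp_left]
  generalize hT : (fun ψ d => wp 𝒢 n _ (Data.node d _) ψ) = T
  have hnil : ∀ x ψ, T ψ (.node .nil x) = ψ (.node .nil x) := by
    intro x ψ; rw [← hT]; simp
  have hcons : ∀ (G : (𝒢.grp n).G) r acc (H : (𝒢.grp n).G) ψ,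
      T ψ (.node (.node ((𝒢.grp n).encG G) r) (.node acc ((𝒢.grp n).encG H))) =
        ex (PMF.uniformOfFintype (𝒢.grp n).Scalar) fun a => ψ (.node r (.node
          (.node (.node ((𝒢.grp n).encG G) ((𝒢.grp n).encZ a)) acc)
          ((𝒢.grp n).encG (H * (𝒢.grp n).exp G a)))) := by
    intro G r acc H ψ; rw [← hT]; simp
  clear hT
  have key : ∀ m (Gs : List (𝒢.grp n).G) (acc : List ((𝒢.grp n).G × (𝒢.grp n).Scalar))
      (H : (𝒢.grp n).G) (ψ : Data → ℝ≥0∞), Gs.length ≤ m →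
      T^[m] ψ (.node (.ofList (Gs.map (𝒢.grp n).encG))
        (.node (encPairs _ acc) ((𝒢.grp n).encG H))) =
      ex (randPoly (𝒢.grp n).Scalar Gs.length) fun f => ψ (.node .nil
        (.node (encPairs _ ((setupState _ Gs f).reverse ++ acc))
          ((𝒢.grp n).encG (H * ((setupState _ Gs f).map fun a => (𝒢.grp n).exp a.1 a.2).prod)))) := by
    intro m
    induction m with
    | zero =>
      intro Gs acc H ψ h
      obtain rfl : Gs = [] := by simpa using h
      simp [randPoly, setupState, Data.ofList]
    | succ m ih =>
      intro Gs acc H ψ h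
      rw [Function.iterate_succ_apply']
      cases Gs with
      | nil =>
        have := ih [] acc H ψ (by simp)
        simp only [List.map_nil, Data.ofList] at this ⊢
        rw [hnil, this]
      | cons G Gs =>
        simp only [List.map_cons, Data.ofList, List.length_cons]
        rw [hcons, randPoly, ex_bind]
        refine congrArg (ex _) (funext fun a => ?_)
        have := ih Gs ((G, a) :: acc) (H * (𝒢.grp n).exp G a) ψ (by simpa using h)
        simp only [encPairs, List.map_cons, Data.ofList] at this ⊢
        rw [this, ex_bind]
        refine congrArg (ex _) (funext fun f => ?_)
        have hs : setupState (𝒢.grp n) (G :: Gs) (Polynomial.C a + Polynomial.X * f) =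
            (G, a) :: setupState (𝒢.grp n) Gs f := by
          simp [setupState, List.range_succ_eq_map, Polynomial.coeff_C_succ, Function.comp_def]
        rw [ex_pure, hs]
        simp [mul_assoc]
  obtain ⟨G, Gs', rfl⟩ := List.exists_cons_of_ne_nil hne
  have := key (n ^ K) (G :: Gs') [] 1 (fun y => φ y.right) hGs
  simpa [Data.ofList, encPairs, (𝒢.grp n).exp_zero] using this

end Semantics

end Prog

/-! ## Synthetic division in the exponent -/

section Fold

variable (B : BilinearGroup)

/-- The list `g, g^α, …, g^(α^q)`. -/
def powers (q : ℕ) (g : B.G) (α : B.Scalar) : List B.G :=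
  (List.range (q + 1)).map fun i => B.exp g (α ^ i)

/-- The list of the pairs `(g^(α^i), aᵢ)` for the coefficients `aᵢ` of `f`, reversed. -/
def coeffData (q : ℕ) (g : B.G) (α : B.Scalar) (f : Polynomial B.Scalar) :
    List (B.G × B.Scalar) :=
  (setupState B (powers B q g α) f).reverse

variable {B} {q : ℕ} {g : B.G} {α : B.Scalar}

theorem length_powers : (powers B q g α).length = q + 1 := by simp [powers]

theorem setupState_powers (f : Polynomial B.Scalar) :
    setupState B (powers B q g α) f =
      (List.range (q + 1)).map fun i => (B.exp g (α ^ i), f.coeff i) := by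
  rw [setupState, length_powers, powers, List.zip_map']

theorem length_coeffData (f : Polynomial B.Scalar) : (coeffData B q g α f).length = q + 1 := by
  simp [coeffData, setupState_powers]

/-- Horner's scheme at `x`: its intermediate values are the coefficients of the quotient by `X - x`,
and raising `g^(α^i)` to them evaluates that quotient at `α` in the exponent. The scalar `v` is the
coefficient of degree `m`. Stating the relation for `(α - x) * δ` avoids assuming `α ≠ x`. -/
theorem foldr_range_map (x : B.Scalar) (c : ℕ → B.Scalar) (m : ℕ) (v : B.Scalar) (D : B.G) :
    ∃ δ : B.Scalar,
      ((List.range m).map fun i => (B.exp g (α ^ i), c i)).foldr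
        (fun a s => foldStep B x s a) (v, D) =
        (∑ i ∈ Finset.range m, c i * x ^ i + v * x ^ m, D * B.exp g δ) ∧
      (α - x) * δ = (∑ i ∈ Finset.range m, c i * α ^ i + v * α ^ m) -
        (∑ i ∈ Finset.range m, c i * x ^ i + v * x ^ m) := by
  induction m generalizing v D with
  | zero => exact ⟨0, by simp [B.exp_zero], by simp⟩
  | succ m ih =>
    obtain ⟨δ, h1, h2⟩ := ih (c m + x * v) (D * B.exp (B.exp g (α ^ m)) v)
    -- The leading coefficient `v` contributes `v X^m` to the quotient; `δ` is the contribution of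
    -- the lower degrees, entered with `c m + x * v`.
    refine ⟨α ^ m * v + δ, ?_, ?_⟩
    · rw [List.range_succ, List.map_append, List.foldr_append]
      simp only [List.map_cons, List.map_nil, List.foldr_cons, List.foldr_nil]
      refine h1.trans ?_
      rw [Finset.sum_range_succ, B.exp_add (B.pow_p g), B.exp_mul (B.pow_p g)]
      refine Prod.ext ?_ ?_
      · simp only; ring
      · simp only [mul_assoc]
    · rw [mul_add, h2, Finset.sum_range_succ, Finset.sum_range_succ]
      ring

theorem eval_eq_sum_of_degree_lt {f : Polynomial B.Scalar} {m : ℕ} (hf : f.degree < m)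
    (x : B.Scalar) : f.eval x = ∑ i ∈ Finset.range m, f.coeff i * x ^ i := by
  by_cases h0 : f = 0
  · simp [h0]
  · exact Polynomial.eval_eq_sum_range' ((Polynomial.natDegree_lt_iff_degree_lt h0).2 hf) x

/-- The divided polynomial is `f + v X^(q+1)`, whose quotient has degree at most `q`, so the given
powers suffice. The choice `v = 0` produces keys; `v = x = ID` adds the extra term `g^μ` needed for
the challenge ciphertext. -/
theorem foldl_coeffData {f : Polynomial B.Scalar} (hf : f.degree < (q + 1 : ℕ)) (x v : B.Scalar)
    (D : B.G) :
    ∃ δ : B.Scalar, (coeffData B q g α f).foldl (foldStep B x) (v, D) =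
        (f.eval x + v * x ^ (q + 1), D * B.exp g δ) ∧
      (α - x) * δ = (f.eval α + v * α ^ (q + 1)) - (f.eval x + v * x ^ (q + 1)) := by
  rw [eval_eq_sum_of_degree_lt hf, eval_eq_sum_of_degree_lt hf, coeffData, List.foldl_reverse,
    setupState_powers]
  exact foldr_range_map x _ _ v D

theorem prod_setupState {f : Polynomial B.Scalar} (hf : f.degree < (q + 1 : ℕ)) :
    ((setupState B (powers B q g α) f).map fun a => B.exp a.1 a.2).prod = B.exp g (f.eval α) := by
  rw [eval_eq_sum_of_degree_lt hf, setupState_powers, List.map_map]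
  simp only [Function.comp_def]
  generalize q + 1 = m
  induction m with
  | zero => simp [B.exp_zero]
  | succ m ih =>
    rw [List.range_succ, List.map_append, List.prod_append, ih, Finset.sum_range_succ,
      B.exp_add (B.pow_p g), mul_comm (f.coeff m), B.exp_mul (B.pow_p g)]
    simp

end Fold

/-! ## The simulated key generation protocol -/

section Accepts

variable {B : BilinearGroup}

/-- The PKG accepts the last message `z` of the proof of knowledge and does not answer `⊥`. -/
def Accepts (mpk : PublicKey B) (ID : B.Scalar) (R a : B.G) (c : B.Scalar) (z : Data) : Prop :=
  mpk.idBase ID ≠ 1 ∧ z ≠ .nil ∧ ∃ z₁ z₂, B.decZ z.left = some z₁ ∧ B.decZ z.right = some z₂ ∧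
    mpk.PokAccepts ID R a c z₁ z₂

theorem idBase_eq {mpk : PublicKey B} {α : B.Scalar} (h : mpk.g₁ = B.exp mpk.g α)
    (ID : B.Scalar) : mpk.idBase ID = B.exp mpk.g (α - ID) := by
  rw [PublicKey.idBase, h, sub_eq_add_neg, B.exp_add (B.pow_p _)]

theorem exp_eq_one_iff {g : B.G} (hg : g ≠ 1) (a : B.Scalar) : B.exp g a = 1 ↔ a = 0 := by
  rw [← B.exp_zero g, (B.exp_bijective hg).1.eq_iff]

theorem idBase_eq_one_iff {mpk : PublicKey B} {α : B.Scalar} (hg : mpk.g ≠ 1)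
    (h : mpk.g₁ = B.exp mpk.g α) (ID : B.Scalar) : mpk.idBase ID = 1 ↔ ID = α := by
  rw [idBase_eq h, exp_eq_one_iff hg, sub_eq_zero, eq_comm]

/-- The answer of the PKG with key family number `t` contributed by the PKG. -/
def answer (mpk : PublicKey B) (α ID : B.Scalar) (R : B.G) (t : B.Scalar) : Data :=
  .node (B.encG (B.exp (mpk.h * R * B.exp mpk.g (-t)) (α - ID)⁻¹)) (B.encZ t)

theorem pkgReply_of_accepts {mpk : PublicKey B} {α ID : B.Scalar} (hg : mpk.g ≠ 1)
    (h : mpk.g₁ = B.exp mpk.g α) {R a : B.G} {c : B.Scalar} {z : Data}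
    (hz : Accepts mpk ID R a c z) (φ : Data → ℝ≥0∞) :
    ex (pkgReply mpk α ID R a c z) φ =
      ex (PMF.uniformOfFintype B.Scalarˣ) fun t => φ (answer mpk α ID R t) := by
  obtain ⟨hid, hnil, z₁, z₂, h1, h2, hacc⟩ := hz
  rw [Ne, idBase_eq_one_iff hg h] at hid
  cases z with
  | nil => exact absurd rfl hnil
  | node x y =>
    simp only [Data.left_node, Data.right_node] at h1 h2
    simp [pkgReply, h1, h2, hacc, keygenAnswer, hid, answer]

theorem pkgReply_of_not_accepts {mpk : PublicKey B} {α ID : B.Scalar} (hg : mpk.g ≠ 1)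
    (h : mpk.g₁ = B.exp mpk.g α) {R a : B.G} {c : B.Scalar} {z : Data}
    (hz : ¬ Accepts mpk ID R a c z) : pkgReply mpk α ID R a c z = PMF.pure .nil := by
  cases z with
  | nil => rfl
  | node x y =>
    cases h1 : B.decZ x with
    | none => simp [pkgReply, h1]
    | some z₁ => cases h2 : B.decZ y with
      | none => simp [pkgReply, h1, h2]
      | some z₂ =>
        simp only [pkgReply, h1, h2]
        split_ifs with hacc
        · have : ID = α := by
            by_contra hid
            exact hz ⟨by rwa [Ne, idBase_eq_one_iff hg h], by simp, z₁, z₂, h1, h2, hacc⟩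
          rw [keygenAnswer, if_pos this]
        · rfl

/-- Two accepting transcripts with the same first message open the commitment. -/
theorem commit_of_accepts {mpk : PublicKey B} {ID : B.Scalar} {R a : B.G}
    {c c' x y x' y' : B.Scalar} (hg : mpk.g ≠ 1) (h : mpk.PokAccepts ID R a c x y)
    (h' : mpk.PokAccepts ID R a c' x' y') (hc : c' ≠ c) :
    R = mpk.commit ID ((x' - x) * (c' - c)⁻¹) ((y' - y) * (c' - c)⁻¹) := by
  have hb := B.exp_bijective hg
  have hp := B.pow_p mpk.g
  obtain ⟨ρ, rfl⟩ := hb.2 R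
  obtain ⟨σ, rfl⟩ := hb.2 a
  obtain ⟨τ, hτ⟩ := hb.2 (mpk.idBase ID)
  simp only [PublicKey.PokAccepts, PublicKey.commit, ← hτ, ← B.exp_mul hp, ← B.exp_add hp,
    hb.1.eq_iff] at h h' ⊢
  have hc' : c' - c ≠ 0 := sub_ne_zero.2 hc
  field_simp
  linear_combination h - h'

end Accepts

namespace Prog

variable {𝒢 : BilinearFamily} {n K : ℕ} (φ : Data → ℝ≥0∞)

/-- The program does not know `α`, but it recognises the case `ID = α`, where the PKG refuses, by
`g₁ g^(-ID) = 1`. -/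
theorem wp_accept (mpk : PublicKey (𝒢.grp n)) (ID : (𝒢.grp n).Scalar) (R a : (𝒢.grp n).G)
    (c : (𝒢.grp n).Scalar) (z e : Data) :
    wp 𝒢 n accept (.node ((𝒢.grp n).encZ c) (.node z (.node ((𝒢.grp n).encG R)
      (.node ((𝒢.grp n).encG a) (.node ((𝒢.grp n).encG (mpk.idBase ID))
      (.node ((𝒢.grp n).encG mpk.g) e)))))) φ =
    φ (.ofBool (decide (Accepts mpk ID R a c z))) := by
  have hF : ∀ {p : Prop}, ¬ p → Data.ofBool (decide p) = .nil := fun h => by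
    simp [h]
  simp only [accept, wp_cond, wp_var, wp_op2, wp_op1, wp_unit, wp_left, wp_right,
    Function.iterate_succ, Function.iterate_zero, Function.comp, id, Data.left_node,
    Data.right_node, wp_nil, Op.eval_zeq_self, Data.branch_ofBool, Op.eval_gpow, Op.eval_geq,
    (𝒢.grp n).exp_zero, decide_eq_true_eq]
  by_cases hz : z = .nil
  · rw [hz, Data.branch_nil, hF fun h => h.2.1 rfl]
  rw [Data.branch_of_ne hz]
  cases h1 : (𝒢.grp n).decZ z.left with
  | none =>
    rw [hF]
    · simp
    · rintro ⟨-, -, z₁, z₂, h, -⟩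
      simp [h1] at h
  | some z₁ => cases h2 : (𝒢.grp n).decZ z.right with
    | none =>
      rw [hF]
      · simp
      · rintro ⟨-, -, z₁, z₂, -, h, -⟩
        simp [h2] at h
    | some z₂ =>
      rw [← enc_of_decode h1, ← enc_of_decode h2]
      simp only [Option.isSome_some, if_true, Op.eval_zneg, Op.eval_gpow,
        Op.eval_gmul, Op.eval_geq]
      by_cases h3 : mpk.idBase ID = 1
      · rw [if_pos h3, hF fun h => h.1 h3]
      · rw [if_neg h3]
        have : Accepts mpk ID R a c z ↔ mpk.PokAccepts ID R a c z₁ z₂ := by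
          simp [Accepts, h1, h2, h3, hz]
        simp only [this]
        rfl

end Prog

/-! ### Moves of the user as data -/

section Moves

variable {B : BilinearGroup}

theorem eq_of_parseMove_query {t : Data} {ID : B.Scalar} {R a : B.G}
    (h : parseMove B t = some (Move.query ID R a)) :
    t = .node .nil (.node (B.encZ ID) (.node (B.encG R) (B.encG a))) := by
  unfold parseMove at h
  split at h
  · split at h
    · rename_i h1 h2 h3
      simp only [Option.some.injEq, Move.query.injEq] at h
      obtain ⟨rfl, rfl, rfl⟩ := h
      rw [enc_of_decode h1, enc_of_decode h2, enc_of_decode h3]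
    · simp at h
  · split at h <;> simp at h
  · simp at h

theorem eq_of_parseMove_finish {t : Data} {ID : B.Scalar} {k : UserKey B} {w : Data}
    (h : parseMove B t = some (Move.finish ID k w)) :
    ∃ u, u ≠ .nil ∧
      t = .node u (.node (B.encZ ID) (.node (B.encG k.d) (.node (B.encZ k.t) w))) := by
  unfold parseMove at h
  split at h
  · split at h <;> simp at h
  · split at h
    · rename_i h1 h2 h3
      simp only [Option.some.injEq, Move.finish.injEq] at h
      obtain ⟨rfl, rfl, rfl⟩ := h
      rw [enc_of_decode h1, enc_of_decode h2, enc_of_decode h3]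
      exact ⟨_, by simp, rfl⟩
    · simp at h
  · simp at h

end Moves

/-! ### Rewinding, extraction and the simulated answer -/

namespace Prog

variable {𝒢 : BilinearFamily} {n K q : ℕ} (user : Prog) (φ : Data → ℝ≥0∞)

/-- The environment of the simulated protocol after the first message of the user. -/
def queryEnv (mpk : PublicKey (𝒢.grp n)) (state : Data) (ID : (𝒢.grp n).Scalar)
    (R a : (𝒢.grp n).G) (L : Data) : Data :=
  .node state (.node ((𝒢.grp n).encZ ID) (.node ((𝒢.grp n).encG R) (.node ((𝒢.grp n).encG a)
    (.node ((𝒢.grp n).encG (mpk.idBase ID)) (.node L (.node ((𝒢.grp n).encG mpk.g) .nil))))))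

/-- A random challenge and the reaction of the user. -/
def attempt (𝒢 : BilinearFamily) (n : ℕ) (user : Prog) (state : Data) :
    PMF ((𝒢.grp n).Scalar × Data) :=
  (PMF.uniformOfFintype (𝒢.grp n).Scalar).bind fun c =>
    (user.output 𝒢 n (.node state ((𝒢.grp n).encZ c))).map fun o => (c, o)

theorem ex_attempt (state : Data) (f : (𝒢.grp n).Scalar × Data → ℝ≥0∞) :
    ex (attempt 𝒢 n user state) f = ex (PMF.uniformOfFintype (𝒢.grp n).Scalar) fun c =>
      wp 𝒢 n user (.node state ((𝒢.grp n).encZ c)) fun o => f (c, o) := by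
  simp [attempt, wp]

/-- One step of the search for a second transcript. -/
def rewindStep (user : Prog) (mpk : PublicKey (𝒢.grp n)) (state : Data) (ID : (𝒢.grp n).Scalar)
    (R a : (𝒢.grp n).G) (c : (𝒢.grp n).Scalar) (w : Data) : PMF Data :=
  (attempt 𝒢 n user state).bind fun b => PMF.pure
    (if Accepts mpk ID R a b.1 b.2.right ∧ b.1 ≠ c then .node ((𝒢.grp n).encZ b.1) b.2.right
      else w)

variable (mpk : PublicKey (𝒢.grp n)) (state : Data) (ID : (𝒢.grp n).Scalar)
  (R a : (𝒢.grp n).G) (L : Data)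

theorem wp_rewindBody (c : (𝒢.grp n).Scalar) (w o : Data) :
    wp 𝒢 n (rewindBody user)
      (.node w (.node o (.node ((𝒢.grp n).encZ c) (queryEnv mpk state ID R a L)))) φ =
    ex (rewindStep user mpk state ID R a c w) φ := by
  simp only [rewindBody, rewindStep, queryEnv, ex_bind, ex_attempt, ex_pure, wp_cond, wp_var,
    wp_op2, wp_call, wp_pair, wp_letIn, wp_rand, wp_right, wp_nil,
    Function.iterate_succ, Function.iterate_zero, Function.comp, id, Data.left_node,
    Data.right_node, Data.branch_ofBool, Op.eval_zeq, wp_accept, decide_eq_true_eq]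
  refine congrArg (ex _) (funext fun c' => congrArg (wp _ _ _ _) (funext fun o => ?_))
  by_cases h1 : c' = c
  · simp [h1]
  · by_cases h2 : Accepts mpk ID R a c' o.right <;> simp [h1, h2]

/-- The first transcript alone decides whether there is an answer. The search for a second one
restarts the user from the same state and does not involve `L`, so both transcripts are independent
of the polynomial behind `L`. -/
theorem wp_query :
    wp 𝒢 n (query K user) (queryEnv mpk state ID R a L) φ =
    ex (attempt 𝒢 n user state) fun b =>
      if Accepts mpk ID R a b.1 b.2.right then
        ex (iter (rewindStep user mpk state ID R a b.1) (n ^ K) .nil) fun w =>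
          wp 𝒢 n (reply K)
            (.node w (.node b.2 (.node ((𝒢.grp n).encZ b.1) (queryEnv mpk state ID R a L))))
            fun x => φ (.node .nil (.node b.2.left x))
      else φ (.node .nil (.node b.2.left .nil)) := by
  have hrw := fun c w o ψ => wp_rewindBody user ψ mpk state ID R a L c w o
  rw [ex_attempt]
  simp only [ex_iter]
  simp only [queryEnv] at hrw
  simp only [query, queryEnv, wp_cond, wp_var, wp_call, wp_pair, wp_letIn, wp_rand,
    wp_right, wp_left, wp_nil, wp_forLoop,
    Function.iterate_succ, Function.iterate_zero, Function.comp, id, Data.left_node,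
    Data.right_node, Data.branch_ofBool, wp_accept, decide_eq_true_eq]
  refine congrArg (ex _) (funext fun c => congrArg (wp _ _ _ _) (funext fun o => ?_))
  have hT : (fun (ψ : Data → ℝ≥0∞) w => ex (rewindStep user mpk state ID R a c w) ψ) = _ :=
    funext fun ψ => funext fun w => (hrw c w o ψ).symm
  rw [hT]

variable {mpk ID R a}

/-- With `R` opened to `(t₀, θ)`, the PKG's answer for `t₁ = f(ID) - t₀` has exponent `(f(α) -
f(ID))/(α - ID) + θ`, in which `t₀` cancels; synthetic division supplies the quotient. The order of
quantifiers matters: `t₀` comes from the transcripts alone, so `f(ID) - t₀` is uniform whenever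
`f(ID)` is. -/
theorem wp_reply {α : (𝒢.grp n).Scalar} (hq : q + 1 ≤ n ^ K) (hg : mpk.g ≠ 1)
    (hg₁ : mpk.g₁ = (𝒢.grp n).exp mpk.g α) {c c' : (𝒢.grp n).Scalar} {o z' : Data}
    (hc : c' ≠ c) (hz : Accepts mpk ID R a c o.right) (hz' : Accepts mpk ID R a c' z') :
    ∃ t₀, ∀ f : Polynomial (𝒢.grp n).Scalar, f.degree < (q + 1 : ℕ) →
      (𝒢.grp n).exp mpk.g (f.eval α) = mpk.h → ∀ φ,
      wp 𝒢 n (reply K) (.node (.node ((𝒢.grp n).encZ c') z') (.node o (.node ((𝒢.grp n).encZ c)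
        (queryEnv mpk state ID R a (encPairs _ (coeffData _ q mpk.g α f)))))) φ =
      φ (answer mpk α ID R (f.eval ID - t₀)) := by
  obtain ⟨hb, -, x, y, hx, hy, hacc⟩ := hz
  obtain ⟨-, -, x', y', hx', hy', hacc'⟩ := hz'
  have hR := commit_of_accepts hg hacc hacc' hc
  rw [Ne, idBase_eq_one_iff hg hg₁] at hb
  refine ⟨(x' - x) * (c' - c)⁻¹, fun f hf hh φ => ?_⟩
  obtain ⟨δ, hfold, hδ⟩ := foldl_coeffData (g := mpk.g) (α := α) hf ID 0 1
  simp only [reply, queryEnv, wp_var, wp_call, wp_pair, wp_letIn, wp_right, wp_left, wp_op1,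
    wp_op2, wp_sub, wp_unit, wp_zero, wp_nil,
    Function.iterate_succ, Function.iterate_zero, Function.comp, id, Data.left_node,
    Data.right_node, Op.eval_zneg, Op.eval_zadd, Op.eval_zinv, Op.eval_gpow,
    (𝒢.grp n).exp_zero]
  rw [wp_fold _ _ ((length_coeffData f).trans_le hq)]
  rw [hfold, ← enc_of_decode hx, ← enc_of_decode hy, ← enc_of_decode hx', ← enc_of_decode hy']
  simp only [Data.left_node, Data.right_node, Op.eval_zneg, Op.eval_zadd, Op.eval_zmul,
    Op.eval_gpow, Op.eval_gmul, zero_mul, add_zero, one_mul, ← sub_eq_add_neg, answer] at hδ ⊢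
  congr 3
  have hp := (𝒢.grp n).pow_p mpk.g
  rw [hR, PublicKey.commit, idBase_eq hg₁, ← hh]
  simp only [← (𝒢.grp n).exp_mul hp, ← (𝒢.grp n).exp_add hp]
  congr 1
  have hb' : α - ID ≠ 0 := sub_ne_zero.2 (Ne.symm hb)
  have hc' : c' - c ≠ 0 := sub_ne_zero.2 hc
  have hδ' : δ = (f.eval α - f.eval ID) * (α - ID)⁻¹ := by
    rw [← hδ]; field_simp
  rw [hδ']
  field_simp
  ring

/-! ### Rounds of the simulated game -/

variable (mpk)

/-- The data about the public key and the polynomial `f` that the simulated game uses. -/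
def simEnv (q : ℕ) (α : (𝒢.grp n).Scalar) (f : Polynomial (𝒢.grp n).Scalar) : Data :=
  .node (encPairs _ (coeffData _ q mpk.g α f)) (.node ((𝒢.grp n).encG mpk.h)
    (.node ((𝒢.grp n).encG mpk.g) (.node ((𝒢.grp n).encG mpk.g₁) .nil)))

theorem wp_round_of_finished (e : Data) {d : Data} (hd : d.left ≠ .nil) :
    wp 𝒢 n (round K user) (.node d e) φ = φ d := by
  simp [round, Data.branch_of_ne hd]

/-- What happens in a round after the first activation of the user. -/
def afterMove (K : ℕ) (user : Prog) (mpk : PublicKey (𝒢.grp n)) (L out : Data)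
    (φ : Data → ℝ≥0∞) : ℝ≥0∞ :=
  out.right.left.branch (φ out.right)
    (wp 𝒢 n (query K user) (.node out.left (.node out.right.right.left
      (.node out.right.right.right.left (.node out.right.right.right.right
        (.node (Op.eval (𝒢.grp n) .gmul (.node ((𝒢.grp n).encG mpk.g₁)
          (Op.eval (𝒢.grp n) .gpow (.node ((𝒢.grp n).encG mpk.g)
            (Op.eval (𝒢.grp n) .zneg out.right.right.left)))))
        (.node L (.node ((𝒢.grp n).encG mpk.g) .nil))))))) φ)

theorem wp_round (q : ℕ) (α : (𝒢.grp n).Scalar) (f : Polynomial (𝒢.grp n).Scalar)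
    (state msg : Data) :
    wp 𝒢 n (round K user) (.node (.node .nil (.node state msg)) (simEnv mpk q α f)) φ =
      wp 𝒢 n user (.node state msg) fun out =>
        afterMove K user mpk (encPairs _ (coeffData _ q mpk.g α f)) out φ := by
  simp [round, simEnv, afterMove]

theorem afterMove_query (st : Data) :
    afterMove K user mpk L
      (.node st (.node .nil (.node ((𝒢.grp n).encZ ID) (.node ((𝒢.grp n).encG R)
        ((𝒢.grp n).encG a))))) φ =
      wp 𝒢 n (query K user) (queryEnv mpk st ID R a L) φ := by
  simp [afterMove, queryEnv, PublicKey.idBase]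

/-- One round of the simulated game as a transformation of expectations. -/
def simStep (K : ℕ) (user : Prog) (e : Data) (ψ : Data → ℝ≥0∞) (d : Data) : ℝ≥0∞ :=
  wp 𝒢 n (round K user) (.node d e) ψ

theorem wp_simulate (q : ℕ) (α : (𝒢.grp n).Scalar) (f : Polynomial (𝒢.grp n).Scalar) :
    wp 𝒢 n (simulate K user) (simEnv mpk q α f) φ =
      (simStep (𝒢 := 𝒢) (n := n) K user (simEnv mpk q α f))^[n ^ K] φ
        (.node .nil (.node .nil mpk.toData)) := by
  simp only [simulate, wp_forLoop, wp_pair, wp_nil, wp_var]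
  rfl

/-- A final move has a non-`nil` left component, and such states are fixed. A fixed number of rounds
can therefore simulate a game that ends earlier. -/
theorem simStep_iterate_of_finished (e : Data) {d : Data} (hd : d.left ≠ .nil) (m : ℕ) :
    (simStep (𝒢 := 𝒢) (n := n) K user e)^[m] φ d = φ d := by
  induction m with
  | zero => rfl
  | succ m ih =>
    rw [Function.iterate_succ_apply', simStep, wp_round_of_finished _ _ _ hd, ih]

end Prog

/-! ## The simulated game wins as often as the real one -/

open Prog in
/-- One key generation query. `V` is the value of the continuation of the real game and `W` the one
of the simulated game for the polynomial `N + Z r`. -/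
theorem query_le {𝒢 : BilinearFamily} {n K q j : ℕ} (user : Prog) (hq : q + 1 ≤ n ^ K)
    {mpk : PublicKey (𝒢.grp n)} {α ID : (𝒢.grp n).Scalar} (hg : mpk.g ≠ 1)
    (hg₁ : mpk.g₁ = (𝒢.grp n).exp mpk.g α) (R a : (𝒢.grp n).G) (state : Data)
    (V : Data → Data → ℝ≥0∞) (hV : ∀ d x, V d x ≤ 1)
    (W : (𝒢.grp n).Scalar[X] → Data → ℝ≥0∞) {N Z : (𝒢.grp n).Scalar[X]}
    (hZα : Z.eval α = 0) (hNα : (𝒢.grp n).exp mpk.g (N.eval α) = mpk.h)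
    (hZ : ID ≠ α → Z.eval ID ≠ 0)
    (hdeg : ∀ r : (𝒢.grp n).Scalar[X], r.degree < (j + 1 : ℕ) →
      (N + Z * r).degree < (q + 1 : ℕ)) {κ : ℝ≥0∞}
    (hW₀ : ∀ d x, V d x ≤ ex (randPoly (𝒢.grp n).Scalar (j + 1)) (fun r =>
      W (N + Z * r) (.node .nil (.node d x))) + κ)
    (hW : ID ≠ α → ∀ y d x, V d x ≤ ex (randPoly (𝒢.grp n).Scalar j) (fun r =>
      W ((N + Z * Polynomial.C y) + (Z * (Polynomial.X - Polynomial.C ID)) * r)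
        (.node .nil (.node d x))) + κ) :
    (ex (attempt 𝒢 n user state) fun b =>
      ex (pkgReply mpk α ID R a b.1 b.2.right) fun x => V b.2.left x) ≤
    (ex (randPoly (𝒢.grp n).Scalar (j + 1)) fun r => wp 𝒢 n (query K user)
      (queryEnv mpk state ID R a (encPairs _ (coeffData _ q mpk.g α (N + Z * r))))
        (W (N + Z * r))) +
      κ + (((n ^ K : ℕ) : ℝ≥0∞)⁻¹ + 2 * ((𝒢.grp n).p : ℝ≥0∞)⁻¹) := by
  set pi : ℝ≥0∞ := ((𝒢.grp n).p : ℝ≥0∞)⁻¹ with hpi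
  set M := n ^ K with hM
  set acc : (𝒢.grp n).Scalar × Data → ℝ≥0∞ :=
    fun b => if Accepts mpk ID R a b.1 b.2.right then 1 else 0 with hacc
  set rej : (𝒢.grp n).Scalar × Data → ℝ≥0∞ :=
    fun b => if Accepts mpk ID R a b.1 b.2.right then 0 else 1 with hrej
  set μ := attempt 𝒢 n user state with hμ
  set τ := min 1 (ex μ rej + pi) with hτ
  -- the failure probability of a single attempt
  have hbad : ∀ c, (ex μ fun b => if Accepts mpk ID R a b.1 b.2.right ∧ b.1 ≠ c then 0 else 1) ≤
      τ := by
    intro c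
    refine le_min (ex_le_const fun b => by split_ifs <;> simp) ?_
    calc (ex μ fun b => if Accepts mpk ID R a b.1 b.2.right ∧ b.1 ≠ c then 0 else 1)
        ≤ ex μ fun b => rej b + if b.1 = c then 1 else 0 := by
          refine ex_mono fun b => ?_
          by_cases h1 : Accepts mpk ID R a b.1 b.2.right <;> by_cases h2 : b.1 = c <;>
            simp [hrej, h1, h2]
      _ = ex μ rej + pi := by
          rw [ex_add]
          congr 1
          rw [hμ, ex_attempt]
          refine (congrArg (ex _) (funext fun c' => ?_)).trans ((𝒢.grp n).ex_uniform_eq c)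
          by_cases h : c' = c <;> simp [h, wp]
  have hsum : ex μ acc + ex μ rej ≤ 1 := by
    rw [← ex_add]
    exact ex_le_const fun b => by
      by_cases h : Accepts mpk ID R a b.1 b.2.right <;> simp [hacc, hrej, h]
  have hM0 : M ≠ 0 := by omega
  -- pointwise comparison
  have hpt : ∀ b : (𝒢.grp n).Scalar × Data,
      (ex (pkgReply mpk α ID R a b.1 b.2.right) fun x => V b.2.left x) ≤
      (ex (randPoly (𝒢.grp n).Scalar (j + 1)) fun r =>
        if Accepts mpk ID R a b.1 b.2.right then
          ex (iter (rewindStep user mpk state ID R a b.1) M .nil) fun w =>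
            wp 𝒢 n (reply K) (.node w (.node b.2 (.node ((𝒢.grp n).encZ b.1)
              (queryEnv mpk state ID R a (encPairs _ (coeffData _ q mpk.g α (N + Z * r)))))))
              fun x => W (N + Z * r) (.node .nil (.node b.2.left x))
        else W (N + Z * r) (.node .nil (.node b.2.left .nil))) + κ + (acc b * τ ^ M + pi) := by
    intro b
    by_cases hb : Accepts mpk ID R a b.1 b.2.right
    · simp only [if_pos hb, hacc, one_mul]
      have hID : ID ≠ α := fun h => hb.1 ((idBase_eq_one_iff hg hg₁ ID).2 h)
      rw [pkgReply_of_accepts hg hg₁ hb]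
      -- The PKG draws `t₁` from the nonzero scalars, the simulation from all scalars; this costs
      -- `pi`.
      refine ((𝒢.grp n).ex_units_le fun s => hV b.2.left
        (answer mpk α ID R s)).trans ?_
      rw [← add_assoc]
      refine add_le_add_left ?_ _
      rw [ex_comm, ← ex_const (iter (rewindStep user mpk state ID R a b.1) M .nil) κ,
        ← ex_add]
      -- A draw is good if it completes a pair of transcripts with different challenges. The
      -- polynomial may be averaged after the search because the search is independent of it.
      refine (le_ex_iter μ (fun b' => Accepts mpk ID R a b'.1 b'.2.right ∧ b'.1 ≠ b.1)
        (fun b' => .node ((𝒢.grp n).encZ b'.1) b'.2.right) (fun w =>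
          (ex (randPoly (𝒢.grp n).Scalar (j + 1)) fun r =>
            wp 𝒢 n (reply K) (.node w (.node b.2 (.node ((𝒢.grp n).encZ b.1)
              (queryEnv mpk state ID R a (encPairs _ (coeffData _ q mpk.g α (N + Z * r)))))))
              fun x => W (N + Z * r) (.node .nil (.node b.2.left x))) + κ) _
        (ex_le_const fun s => hV _ _) (fun b' hb' => ?_) M .nil).trans
        (add_le_add_right (pow_le_pow_left' (hbad b.1) M) _)
      obtain ⟨t₀, ht₀⟩ := wp_reply (𝒢 := 𝒢) (n := n) (K := K) (q := q) state (α := α) hq hg hg₁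
        hb'.2 hb hb'.1
      have heval : ∀ r : (𝒢.grp n).Scalar[X], (𝒢.grp n).exp mpk.g ((N + Z * r).eval α) = mpk.h := fun r => by
        rw [Polynomial.eval_add, Polynomial.eval_mul, hZα, zero_mul, add_zero, hNα]
      have hsupp : (ex (randPoly (𝒢.grp n).Scalar (j + 1)) fun r => W (N + Z * r) (.node .nil
          (.node b.2.left (answer mpk α ID R ((N + Z * r).eval ID - t₀))))) ≤
          ex (randPoly (𝒢.grp n).Scalar (j + 1)) fun r =>
            wp 𝒢 n (reply K) (.node (.node ((𝒢.grp n).encZ b'.1) b'.2.right) (.node b.2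
              (.node ((𝒢.grp n).encZ b.1) (queryEnv mpk state ID R a
                (encPairs _ (coeffData _ q mpk.g α (N + Z * r)))))))
              fun x => W (N + Z * r) (.node .nil (.node b.2.left x)) :=
        ex_mono_support fun r hr => (ht₀ _ (hdeg r (degree_lt_of_mem_support_randPoly hr)) (heval r) _).ge
      refine le_trans ?_ (add_le_add_left hsupp κ)
      rw [ex_randPoly_succ ID]
      have hZ' := hZ hID
      -- With `y = r(ID)`, the simulated `t₁` is `N(ID) + Z(ID) y - t₀`. Since `Z(ID) ≠ 0`, this is
      -- a bijective function of the uniform `y`.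
      rw [← ex_uniform_equiv ((Equiv.mulLeft₀ _ hZ').trans
        (Equiv.addLeft (N.eval ID - t₀))), ← ex_const (PMF.uniformOfFintype (𝒢.grp n).Scalar) κ, ← ex_add]
      refine ex_mono fun y => ?_
      refine (hW hID y _ _).trans (add_le_add_left (le_of_eq ?_) _)
      refine congrArg (ex _) (funext fun r => ?_)
      have h1 : N + Z * Polynomial.C y + Z * (Polynomial.X - Polynomial.C ID) * r =
          N + Z * (Polynomial.C y + (Polynomial.X - Polynomial.C ID) * r) := by ring
      rw [h1]
      congr 4
      have h2 : (Equiv.mulLeft₀ _ hZ') y = Z.eval ID * y := rfl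
      simp only [Equiv.trans_apply, h2, Equiv.coe_addLeft, Polynomial.eval_add,
        Polynomial.eval_mul, Polynomial.eval_C, Polynomial.eval_sub, Polynomial.eval_X]
      ring
    · simp only [if_neg hb]
      rw [pkgReply_of_not_accepts hg hg₁ hb, ex_pure]
      -- A rejected proof reveals nothing about `r`, so no degree of freedom is spent.
      exact (hW₀ _ _).trans le_self_add
  refine (ex_mono hpt).trans ?_
  simp only [ex_add, ex_const, ex_mul_const]
  have h2 : ex μ acc * τ ^ M + pi ≤ ((M : ℕ) : ℝ≥0∞)⁻¹ + 2 * pi := by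
    rw [two_mul, ← add_assoc]
    exact add_le_add_left (mul_pow_failure_le hsum hM0) _
  refine add_le_add (add_le_add_left ?_ _) h2
  rw [ex_comm]
  exact ex_mono fun r => (wp_query user _ mpk state ID R a _).ge

-- Invariant: given the past, the simulator's polynomial is `N + Z r` with `r` uniform of degree
-- below `j`. Here `N` carries the values already used and fixes `h`, while `Z` vanishes at `α` and
-- otherwise at most on queried identities. At least as many coefficients of `r` remain free as
-- there are queries left, and `k < m` reserves one more round for the final move.
open Prog in
theorem play_le {𝒢 : BilinearFamily} {n K q : ℕ} (A : Adversary) (hq : q + 1 ≤ n ^ K)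
    {mpk : PublicKey (𝒢.grp n)} {α : (𝒢.grp n).Scalar} (hg : mpk.g ≠ 1)
    (hg₁ : mpk.g₁ = (𝒢.grp n).exp mpk.g α)
    (φ : Option ((𝒢.grp n).Scalar × UserKey (𝒢.grp n) × Data) → ℝ≥0∞) (hφ : ∀ x, φ x ≤ 1)
    (hnone : φ none = 0) (Φ : Data → ℝ≥0∞)
    (hΦ : ∀ u ID k w, u ≠ .nil → φ (some (ID, k, w)) ≤
      Φ (.node u (.node ((𝒢.grp n).encZ ID) (.node ((𝒢.grp n).encG k.d)
        (.node ((𝒢.grp n).encZ k.t) w)))))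
    (k : ℕ) : ∀ (j m : ℕ) (Q : List (𝒢.grp n).Scalar) (state msg : Data)
      (N Z : (𝒢.grp n).Scalar[X]), k ≤ j → k < m → Z.eval α = 0 →
      (𝒢.grp n).exp mpk.g (N.eval α) = mpk.h → (∀ x ∉ Q, x ≠ α → Z.eval x ≠ 0) →
      (∀ r : (𝒢.grp n).Scalar[X], r.degree < j → (N + Z * r).degree < (q + 1 : ℕ)) →
      ex (play 𝒢 A n mpk α k Q state msg) φ ≤
        ex (randPoly (𝒢.grp n).Scalar j) (fun r =>
          (simStep (𝒢 := 𝒢) (n := n) K A.user (simEnv mpk q α (N + Z * r)))^[m] Φ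
            (.node .nil (.node state msg))) +
          k * (((n ^ K : ℕ) : ℝ≥0∞)⁻¹ + 2 * ((𝒢.grp n).p : ℝ≥0∞)⁻¹) := by
  set δ : ℝ≥0∞ := ((n ^ K : ℕ) : ℝ≥0∞)⁻¹ + 2 * ((𝒢.grp n).p : ℝ≥0∞)⁻¹ with hδ
  have hstep : ∀ (j m : ℕ) (state msg : Data) (N Z : (𝒢.grp n).Scalar[X]),
      (ex (randPoly (𝒢.grp n).Scalar j) fun r =>
        (simStep (𝒢 := 𝒢) (n := n) K A.user (simEnv mpk q α (N + Z * r)))^[m + 1] Φ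
            (.node .nil (.node state msg))) =
      ex (A.activate 𝒢 n state msg) fun out => ex (randPoly (𝒢.grp n).Scalar j) fun r =>
        afterMove K A.user mpk (encPairs _ (coeffData _ q mpk.g α (N + Z * r))) out
          ((simStep (𝒢 := 𝒢) (n := n) K A.user (simEnv mpk q α (N + Z * r)))^[m] Φ) := by
    intro j m state msg N Z
    rw [ex_comm]
    refine congrArg (ex _) (funext fun r => ?_)
    rw [Function.iterate_succ_apply', simStep, wp_round]
    rfl
  have hfinish : ∀ (j m : ℕ) (N Z : (𝒢.grp n).Scalar[X]) (st move : Data) ID key w,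
      parseMove (𝒢.grp n) move = some (Move.finish ID key w) → φ (some (ID, key, w)) ≤
      ex (randPoly (𝒢.grp n).Scalar j) fun r =>
        afterMove K A.user mpk (encPairs _ (coeffData _ q mpk.g α (N + Z * r))) (.node st move)
          ((simStep (𝒢 := 𝒢) (n := n) K A.user (simEnv mpk q α (N + Z * r)))^[m] Φ) := by
    intro j m N Z st move ID key w h
    obtain ⟨u, hu, rfl⟩ := eq_of_parseMove_finish h
    refine const_le_ex fun r => ?_
    simp only [afterMove, Data.right_node, Data.left_node, Data.branch_of_ne hu]
    rw [simStep_iterate_of_finished _ _ _ (by exact hu)]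
    exact hΦ u ID key w hu
  induction k with
  | zero =>
    intro j m Q state msg N Z hj hm hZα hNα hZ hdeg
    obtain ⟨m, rfl⟩ : ∃ m', m = m' + 1 := ⟨m - 1, by omega⟩
    rw [hstep, play.eq_def, ex_bind]
    refine (ex_mono fun out => ?_).trans le_self_add
    cases out with
    | nil => simp [hnone]
    | node st move =>
      cases h : parseMove (𝒢.grp n) move with
      | none => simp [h, hnone]
      | some mv => cases mv with
        | finish ID key w =>
          simp only [h, ex_pure]
          exact hfinish j m N Z st move ID key w h
        | query ID R a => simp [h, hnone]
  | succ k ih =>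
    intro j m Q state msg N Z hj hm hZα hNα hZ hdeg
    obtain ⟨m, rfl⟩ : ∃ m', m = m' + 1 := ⟨m - 1, by omega⟩
    obtain ⟨j, rfl⟩ : ∃ j', j = j' + 1 := ⟨j - 1, by omega⟩
    rw [hstep, play.eq_def, ex_bind, ← ex_const (A.activate 𝒢 n state msg) (((k + 1 : ℕ)) * δ),
      ← ex_add]
    refine ex_mono fun out => ?_
    cases out with
    | nil => simp [hnone]
    | node st move =>
      cases h : parseMove (𝒢.grp n) move with
      | none => simp [h, hnone]
      | some mv => cases mv with
        | finish ID key w =>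
          simp only [h, ex_pure]
          exact (hfinish (j + 1) m N Z st move ID key w h).trans le_self_add
        | query ID R a =>
          by_cases hQ : ID ∈ Q
          · simp [h, hQ, hnone]
          simp only [h, if_neg hQ, ex_bind]
          have hmove := eq_of_parseMove_query h
          subst hmove
          simp only [afterMove_query]
          have hmain := query_le (K := K) (κ := k * δ) A.user hq hg hg₁ R a st
            (fun d x => ex (play 𝒢 A n mpk α k (ID :: Q) d x) φ)
            (fun d x => ex_le_const hφ)
            (fun f => (simStep (𝒢 := 𝒢) (n := n) K A.user (simEnv mpk q α f))^[m] Φ)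
            hZα hNα (hZ ID hQ) hdeg
            (fun d x => ih (j + 1) m (ID :: Q) _ _ N Z (by omega) (by omega) hZα hNα
              (fun x' hx => hZ x' fun h => hx (List.mem_cons_of_mem _ h)) hdeg)
            -- Once the value `y = r(ID)` has been used, it moves into `N`, and `Z` acquires the
            -- factor `X - ID`.
            (fun hID y d x => ih j m (ID :: Q) _ _ _ _ (by omega) (by omega)
              (by simp [hZα]) (by simpa [hZα] using hNα)
              (fun x' hx hxα => by
                rw [List.mem_cons, not_or] at hx
                simpa [sub_ne_zero.2 hx.1] using hZ x' hx.2 hxα)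
              (fun r hr => by
                have := hdeg _ (degree_C_add_mul_lt hr y ID)
                rwa [mul_add, ← mul_assoc, ← add_assoc] at this))
          refine le_trans ?_ (hmain.trans_eq ?_)
          · rw [ex_attempt]
            refine ex_mono fun c => ex_mono fun o => ?_
            cases o with
            | nil => simp [hnone]
            | node st₂ z =>
              rw [ex_bind]
              rfl
          · rw [← hδ, add_assoc, Nat.cast_succ, add_mul, one_mul]

/-! ## Using the output of the dishonest user -/

section DeviceBit

variable {B : BilinearGroup}

/-- Does the device open `(C₁, C₂, m · e(C₁,d) · C₂^t)` for a random message `m`? -/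
def deviceBit (𝔻 : Device) (k : UserKey B) (C₁ : B.G) (C₂ : B.GT) : PMF Bool :=
  (PMF.uniformOfFintype B.GT).bind fun m =>
    (𝔻 (ciphertext C₁ C₂ (m * B.e C₁ k.d * B.exp C₂ k.t))).bind fun m' =>
      PMF.pure (decide (m' = B.encGT m))

/-- The bit that the distinguisher derives from two trial runs of the device and from its run on
the challenge ciphertext. -/
def guessBit (x y z : Bool) : Bool := if x then (if y then false else z) else (y && !z)

end DeviceBit

/-! ### Evaluation of the last part of the distinguisher -/

namespace Prog

variable {𝒢 : BilinearFamily} {n K q : ℕ} (φ : Data → ℝ≥0∞)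

theorem e_self_ne_one {B : BilinearGroup} {g : B.G} (hg : g ≠ 1) : B.e g g ≠ 1 :=
  B.nondegenerate g g hg hg

theorem wp_deviceTest (A : Adversary) (w : Data) (k : UserKey (𝒢.grp n)) {g : (𝒢.grp n).G}
    (hg : g ≠ 1) (C₁ : (𝒢.grp n).G) (C₂ : (𝒢.grp n).GT) (e : Data) :
    wp 𝒢 n (deviceTest A.device) (.node w (.node ((𝒢.grp n).encG k.d) (.node ((𝒢.grp n).encZ k.t)
      (.node ((𝒢.grp n).encG g) (.node ((𝒢.grp n).encG C₁) (.node ((𝒢.grp n).encGT C₂) e)))))) φ =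
    ex (deviceBit (A.mkDevice 𝒢 n w) k C₁ C₂) fun b => φ (.ofBool b) := by
  simp only [deviceBit, ex_bind, ex_pure, (𝒢.grp n).ex_uniform_exp_GT (e_self_ne_one hg)]
  simp only [deviceTest, wp_letIn, wp_op2, wp_var, wp_rand, wp_call, wp_pair,
    Function.iterate_succ, Function.iterate_zero, Function.comp, id, Data.left_node,
    Data.right_node, Op.eval_pairing, Op.eval_tpow, Op.eval_tmul, Op.eval_teq_enc]
  rfl

theorem wp_guess (A : Adversary) (w : Data) (k : UserKey (𝒢.grp n)) {g : (𝒢.grp n).G}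
    (hg : g ≠ 1) (base C₁ : (𝒢.grp n).G) (C₂ : (𝒢.grp n).GT) (e : Data) :
    wp 𝒢 n (guess A.device) (.node ((𝒢.grp n).encG base) (.node w (.node ((𝒢.grp n).encG k.d)
      (.node ((𝒢.grp n).encZ k.t) (.node ((𝒢.grp n).encG g) (.node ((𝒢.grp n).encG C₁)
        (.node ((𝒢.grp n).encGT C₂) e))))))) φ =
    ex (PMF.uniformOfFintype (𝒢.grp n).Scalar) fun s =>
      ex (deviceBit (A.mkDevice 𝒢 n w) k ((𝒢.grp n).exp base s)
        ((𝒢.grp n).exp ((𝒢.grp n).e g g) s)) fun x =>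
      ex (PMF.uniformOfFintype (𝒢.grp n).Scalar) fun s =>
      ex (PMF.uniformOfFintype (𝒢.grp n).Scalar) fun r =>
      ex (deviceBit (A.mkDevice 𝒢 n w) k ((𝒢.grp n).exp base s)
        ((𝒢.grp n).exp ((𝒢.grp n).e g g) r)) fun y =>
      ex (deviceBit (A.mkDevice 𝒢 n w) k C₁ C₂) fun z => φ (.ofBool (guessBit x y z)) := by
  simp only [guess, wp_letIn, wp_op2, wp_var, wp_rand, wp_call, wp_pair, wp_cond, wp_nil,
    Function.iterate_succ, Function.iterate_zero, Function.comp, id, Data.left_node,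
    Data.right_node, Op.eval_pairing, Op.eval_tpow, Op.eval_gpow, wp_deviceTest _ _ _ _ hg,
    Data.branch_ofBool]
  refine congrArg (ex _) (funext fun s => congrArg (ex _) (funext fun x =>
    congrArg (ex _) (funext fun s' => congrArg (ex _) (funext fun r =>
    congrArg (ex _) (funext fun y => congrArg (ex _) (funext fun z => ?_))))))
  cases x <;> cases y <;> cases z <;> rfl

variable {mpk : PublicKey (𝒢.grp n)} {α : (𝒢.grp n).Scalar} {f : Polynomial (𝒢.grp n).Scalar}

/-- What the distinguisher does with a valid key for `ID` and a device, for a challenge with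
`h = g^η` and `T = e(g,g)^τ`. -/
def exploitValue (q : ℕ) (mpk : PublicKey (𝒢.grp n)) (α : (𝒢.grp n).Scalar)
    (f : Polynomial (𝒢.grp n).Scalar) (𝔻 : Device) (ID : (𝒢.grp n).Scalar)
    (k : UserKey (𝒢.grp n)) (η τ : (𝒢.grp n).Scalar) (φ : Data → ℝ≥0∞) : ℝ≥0∞ :=
  let μ := (ID * α ^ (q + 1) - ID ^ (q + 2)) * (α - ID)⁻¹
  if ID ≠ α ∧ k.t = f.eval ID ∧ α ^ (q + 1) + μ ≠ 0 then
    ex (PMF.uniformOfFintype (𝒢.grp n).Scalar) fun s =>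
      ex (deviceBit 𝔻 k ((𝒢.grp n).exp (mpk.idBase ID) s)
        ((𝒢.grp n).exp ((𝒢.grp n).e mpk.g mpk.g) s)) fun x =>
      ex (PMF.uniformOfFintype (𝒢.grp n).Scalar) fun s =>
      ex (PMF.uniformOfFintype (𝒢.grp n).Scalar) fun r =>
      ex (deviceBit 𝔻 k ((𝒢.grp n).exp (mpk.idBase ID) s)
        ((𝒢.grp n).exp ((𝒢.grp n).e mpk.g mpk.g) r)) fun y =>
      ex (deviceBit 𝔻 k ((𝒢.grp n).exp (mpk.idBase ID) (η * (α ^ (q + 1) + μ)))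
        ((𝒢.grp n).exp ((𝒢.grp n).e mpk.g mpk.g) (τ + η * μ))) fun z =>
        φ (.ofBool (guessBit x y z))
  else φ (.ofBool (decide (τ = η * α ^ (q + 1))))

theorem valid_iff (hg : mpk.g ≠ 1) (hg₁ : mpk.g₁ = (𝒢.grp n).exp mpk.g α)
    {ID ω x t : (𝒢.grp n).Scalar} (hh : mpk.h = (𝒢.grp n).exp mpk.g ω) :
    UserKey.Valid mpk ID ⟨(𝒢.grp n).exp mpk.g x, t⟩ ↔ x * (α - ID) = ω - t := by
  have hp := (𝒢.grp n).pow_p_GT ((𝒢.grp n).e mpk.g mpk.g)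
  rw [UserKey.Valid, idBase_eq hg₁, hh, (𝒢.grp n).e_exp, (𝒢.grp n).e_exp_left,
    ← (𝒢.grp n).exp_add hp, ((𝒢.grp n).exp_bijective_GT (e_self_ne_one hg)).1.eq_iff,
    sub_eq_add_neg ω]

/-- In the exponent of `g`, the element `C₁` is `(α - ID) * (η * (α ^ (q + 1) + μ))` and `M` is `μ`,
the difference of two synthetic divisions. Outside the main case the real value of `T` is
computable, and the output is the result of comparing it with `T`. -/
theorem wp_exploit (A : Adversary) (hq : q + 1 ≤ n ^ K) (hg : mpk.g ≠ 1)
    (hg₁ : mpk.g₁ = (𝒢.grp n).exp mpk.g α) (hf : f.degree < (q + 1 : ℕ))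
    (hh : mpk.h = (𝒢.grp n).exp mpk.g (f.eval α)) (w : Data) (ID : (𝒢.grp n).Scalar)
    (k : UserKey (𝒢.grp n)) (hk : k.Valid mpk ID) {η : (𝒢.grp n).Scalar} (hη : η ≠ 0)
    (τ : (𝒢.grp n).Scalar) :
    wp 𝒢 n (exploit K A.device) (.node ((𝒢.grp n).encG (mpk.idBase ID))
      (.node ((𝒢.grp n).encZ ID) (.node ((𝒢.grp n).encG k.d) (.node ((𝒢.grp n).encZ k.t)
      (.node w (.node (encPairs _ (coeffData _ q mpk.g α f)) (.node ((𝒢.grp n).encG mpk.h)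
      (.node ((𝒢.grp n).encG mpk.g) (.node ((𝒢.grp n).encG ((𝒢.grp n).exp mpk.g η))
      (.node ((𝒢.grp n).encG ((𝒢.grp n).exp ((𝒢.grp n).exp mpk.g η) (α ^ (q + 2))))
      (.node ((𝒢.grp n).encGT ((𝒢.grp n).exp ((𝒢.grp n).e mpk.g mpk.g) τ)) .nil))))))))))) φ =
    exploitValue q mpk α f (A.mkDevice 𝒢 n w) ID k η τ φ := by
  have hp := (𝒢.grp n).pow_p mpk.g
  have hpT := (𝒢.grp n).pow_p_GT ((𝒢.grp n).e mpk.g mpk.g)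
  have hb := (𝒢.grp n).exp_bijective hg
  have hbT := (𝒢.grp n).exp_bijective_GT (e_self_ne_one hg)
  -- If `ID = α`, the top power suffices: `e(g^(α^q), h')^ID` is the real value of `T`.
  have hhead : (encPairs _ (coeffData _ q mpk.g α f)).left.left =
      (𝒢.grp n).encG ((𝒢.grp n).exp mpk.g (α ^ q)) := by
    rw [coeffData, setupState_powers, List.range_succ]
    simp [encPairs, Data.ofList]
  obtain ⟨d, t⟩ := k
  obtain ⟨x, rfl⟩ := hb.2 d
  have hv := (valid_iff hg hg₁ hh).1 hk
  obtain ⟨δ₁, hfold₁, hδ₁⟩ := foldl_coeffData (g := mpk.g) (α := α) hf ID 0 1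
  obtain ⟨δ₂, hfold₂, hδ₂⟩ := foldl_coeffData (g := mpk.g) (α := α) hf ID ID 1
  have hlen := (length_coeffData (g := mpk.g) (α := α) (q := q) f).trans_le hq
  by_cases hID : ID = α
  · rw [exploitValue, if_neg (fun h => h.1 hID)]
    simp only [exploit, wp_cond, wp_op2, wp_unit, wp_var, wp_left,
      Function.iterate_succ, Function.iterate_zero, Function.comp, id, Data.left_node,
      Data.right_node, Op.eval_gpow, Op.eval_geq, Data.branch_ofBool, (𝒢.grp n).exp_zero,
      idBase_eq_one_iff hg hg₁, hID, decide_true, if_true, hhead, Op.eval_pairing, Op.eval_tpow,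
      Op.eval_teq, (𝒢.grp n).e_exp, ← (𝒢.grp n).exp_mul hpT, hbT.1.eq_iff]
    congr 4
    ring_nf
  · have hID' : α - ID ≠ 0 := sub_ne_zero.2 (Ne.symm hID)
    simp only [exploit, wp_cond, wp_op2, wp_op1, wp_unit, wp_var, wp_left, wp_right, wp_letIn,
      wp_call, wp_pair, wp_zero, wp_nil, wp_ginv, wp_sub, wp_fold _ _ hlen, hfold₁, hfold₂,
      Function.iterate_succ, Function.iterate_zero, Function.comp, id, Data.left_node,
      Data.right_node, Op.eval_gpow, Op.eval_geq, Op.eval_zneg, Op.eval_zadd, Op.eval_gmul,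
      Data.branch_ofBool, (𝒢.grp n).exp_zero,
      idBase_eq_one_iff hg hg₁, hID, decide_false, Bool.false_eq_true, if_false, Op.eval_pairing,
      ← (𝒢.grp n).exp_mul hp, ← (𝒢.grp n).exp_add hp, (𝒢.grp n).e_exp, one_mul, zero_mul,
      add_zero]
    rw [exploitValue]
    set μ := (ID * α ^ (q + 1) - ID ^ (q + 2)) * (α - ID)⁻¹ with hμ
    have hμ' : (α - ID) * μ = ID * α ^ (q + 1) - ID ^ (q + 2) := by
      rw [hμ]; field_simp
    have hδ : δ₂ - δ₁ = μ := by
      apply mul_left_cancel₀ hID'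
      rw [mul_sub, hδ₁, hδ₂, hμ']
      ring
    have e1 : (δ₂ + δ₁ * -1) * η = η * μ := by rw [← hδ]; ring
    -- The scalar results of the two divisions differ by `ID * ID ^ (q + 1)`, which is the exponent
    -- subtracted from `α ^ (q + 2)`.
    have e2 : η * α ^ (q + 2) + η * -(f.eval ID + ID * ID ^ (q + 1) + -f.eval ID) =
        (α - ID) * (η * (α ^ (q + 1) + μ)) := by
      linear_combination (-η) * hμ'
    rw [e1, e2]
    simp only [decideChallenge, wp_cond, wp_op2, wp_op1, wp_unit, wp_var, wp_nil, wp_call, wp_pair,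
      wp_ginv, wp_tinv, wp_sub,
      Function.iterate_succ, Function.iterate_zero, Function.comp, id, Data.left_node,
      Data.right_node, Op.eval_gpow, Op.eval_geq, Op.eval_zneg, Op.eval_zadd, Op.eval_gmul,
      Op.eval_zinv, Op.eval_zeq, Op.eval_tpow, Op.eval_tmul, Op.eval_teq,
      Data.branch_ofBool, (𝒢.grp n).exp_zero, decide_eq_true_eq, Op.eval_pairing,
      ← (𝒢.grp n).exp_mul hp, ← (𝒢.grp n).exp_add hp, (𝒢.grp n).e_exp,
      ← (𝒢.grp n).exp_mul hpT, ← (𝒢.grp n).exp_add hpT, hbT.1.eq_iff, exp_eq_one_iff hg,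
      mul_eq_zero, hID', hη, false_or]
    -- Two keys with different family numbers give `g^(1/(α - ID))`; pairing it with `C₁` and
    -- removing `e(M, h')` leaves the real `T`. If `α ^ (q + 1) + μ = 0`, then `C₁ = 1` and the same
    -- formula holds for any first factor.
    have hdir : t ≠ f.eval ID ∨ α ^ (q + 1) + μ = 0 →
        (δ₁ + x * -1) * (t + -f.eval ID)⁻¹ * ((α - ID) * (η * (α ^ (q + 1) + μ))) + η * μ * -1 =
          η * α ^ (q + 1) := by
      intro h
      by_cases ht : t = f.eval ID
      · have h0 := h.resolve_left (not_not.2 ht)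
        rw [h0]
        linear_combination (-η) * h0
      · have ht' : t + -f.eval ID ≠ 0 := by rwa [← sub_eq_add_neg, sub_ne_zero]
        have : (δ₁ + x * -1) * (α - ID) = t + -f.eval ID := by
          linear_combination hδ₁ - hv
        have h1 : (δ₁ + x * -1) * (t + -f.eval ID)⁻¹ * (α - ID) = 1 := by
          rw [mul_right_comm, this, mul_inv_cancel₀ ht']
        linear_combination (η * (α ^ (q + 1) + μ)) * h1
    have hC : (𝒢.grp n).exp mpk.g ((α - ID) * (η * (α ^ (q + 1) + μ))) =
        (𝒢.grp n).exp (mpk.idBase ID) (η * (α ^ (q + 1) + μ)) := by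
      rw [idBase_eq hg₁, ← (𝒢.grp n).exp_mul hp]
    have hguess := wp_guess φ A w ⟨(𝒢.grp n).exp mpk.g x, t⟩ hg (mpk.idBase ID)
      ((𝒢.grp n).exp mpk.g ((α - ID) * (η * (α ^ (q + 1) + μ))))
      ((𝒢.grp n).exp ((𝒢.grp n).e mpk.g mpk.g) (τ + η * μ)) .nil
    simp only at hguess
    rw [hguess, hC]
    by_cases h0 : α ^ (q + 1) + μ = 0
    · rw [if_pos h0, if_neg fun h => h.2.2 h0, hdir (Or.inr h0), Data.branch_nil]
    · by_cases ht : t = f.eval ID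
      · rw [if_neg h0, if_pos ht, if_pos ⟨hID, ht, h0⟩]
      · rw [if_neg h0, if_neg ht, if_neg fun h => ht h.2.1, hdir (Or.inl ht)]

/-- `d` is the last move of the user, consisting of `ID`, `k` and `w`. -/
def IsOutcome {B : BilinearGroup} (d : Data) (ID : B.Scalar) (k : UserKey B) : Prop :=
  d.left ≠ .nil ∧ B.decZ d.right.left = some ID ∧ B.decG d.right.right.left = some k.d ∧
    B.decZ d.right.right.right.left = some k.t

/-- The environment of the last part of the distinguisher. -/
def finishEnv (q : ℕ) (mpk : PublicKey (𝒢.grp n)) (α : (𝒢.grp n).Scalar)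
    (f : Polynomial (𝒢.grp n).Scalar) (d x : Data) : Data :=
  .node d (.node (.node (encPairs _ (coeffData _ q mpk.g α f)) ((𝒢.grp n).encG mpk.h))
    (.node (.ofList ((powers _ q mpk.g α).map (𝒢.grp n).encG)) x))

theorem left_ofList_powers {B : BilinearGroup} (g : B.G) (α : B.Scalar) :
    (Data.ofList ((powers B q g α).map B.encG)).left = B.encG g := by
  simp [powers, List.range_succ_eq_map, Data.ofList, B.exp_one]

theorem left_right_ofList_powers {B : BilinearGroup} (hq : 1 ≤ q) (g : B.G) (α : B.Scalar) :
    (Data.ofList ((powers B q g α).map B.encG)).right.left = B.encG (B.exp g α) := by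
  obtain ⟨q, rfl⟩ : ∃ q', q = q' + 1 := ⟨q - 1, by omega⟩
  simp [powers, List.range_succ_eq_map, Data.ofList]

theorem wp_finish (A : Adversary) (hq₁ : 1 ≤ q) (hq : q + 1 ≤ n ^ K) (hg : mpk.g ≠ 1)
    (hg₁ : mpk.g₁ = (𝒢.grp n).exp mpk.g α) (hf : f.degree < (q + 1 : ℕ))
    (hh : mpk.h = (𝒢.grp n).exp mpk.g (f.eval α)) {d : Data} {ID : (𝒢.grp n).Scalar}
    {k : UserKey (𝒢.grp n)} (hd : IsOutcome d ID k) (hk : k.Valid mpk ID)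
    {η : (𝒢.grp n).Scalar} (hη : η ≠ 0) (τ : (𝒢.grp n).Scalar) :
    wp 𝒢 n (finish K A.device) (finishEnv q mpk α f d
      (.node ((𝒢.grp n).encG ((𝒢.grp n).exp mpk.g η))
      (.node ((𝒢.grp n).encG ((𝒢.grp n).exp ((𝒢.grp n).exp mpk.g η) (α ^ (q + 2))))
      ((𝒢.grp n).encGT ((𝒢.grp n).exp ((𝒢.grp n).e mpk.g mpk.g) τ))))) φ =
    exploitValue q mpk α f (A.mkDevice 𝒢 n d.right.right.right.right) ID k η τ φ := by
  obtain ⟨hd0, hd1, hd2, hd3⟩ := hd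
  have hk' : (𝒢.grp n).e k.d (mpk.g₁ * (𝒢.grp n).exp mpk.g (-ID)) =
      (𝒢.grp n).e mpk.h mpk.g * (𝒢.grp n).exp ((𝒢.grp n).e mpk.g mpk.g) (-k.t) := hk
  simp only [finish, checkKey, finishEnv, wp_cond, wp_left, wp_var, wp_right, wp_env, wp_call,
    wp_pair, wp_nil, Function.iterate_succ, Function.iterate_zero, Function.comp, id,
    Data.left_node, Data.right_node, Data.branch_of_ne hd0, left_ofList_powers,
    left_right_ofList_powers hq₁, ← hg₁, ← enc_of_decode hd1, ← enc_of_decode hd2,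
    ← enc_of_decode hd3, wp_op2, wp_op1, wp_letIn, Op.eval_zeq, Op.eval_geq, Data.branch_ofBool,
    decide_true, if_true, Op.eval_zneg, Op.eval_gpow, Op.eval_gmul, Op.eval_pairing,
    Op.eval_tpow, Op.eval_tmul, Op.eval_teq, hk']
  exact wp_exploit φ A hq hg hg₁ hf hh _ ID k hk hη τ

/-- The output ignores the challenge, so such outcomes contribute nothing to the advantage; an
invalid key does not win the game either. -/
theorem wp_finish_of_not (A : Adversary) (hq₁ : 1 ≤ q)
    (hg₁ : mpk.g₁ = (𝒢.grp n).exp mpk.g α) {d : Data}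
    (hd : ∀ ID k, IsOutcome d ID k → ¬ k.Valid mpk ID) (x : Data) :
    wp 𝒢 n (finish K A.device) (finishEnv q mpk α f d x) φ = φ .nil := by
  by_cases h0 : d.left = .nil
  · simp [finish, finishEnv, h0]
  simp only [finish, checkKey, finishEnv, wp_cond, wp_left, wp_var, wp_right, wp_env, wp_call,
    wp_pair, wp_nil, Function.iterate_succ, Function.iterate_zero, Function.comp, id,
    Data.left_node, Data.right_node, Data.branch_of_ne h0, left_ofList_powers,
    left_right_ofList_powers hq₁, ← hg₁, wp_op2, wp_op1, wp_letIn, Op.eval_zeq_self,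
    Op.eval_geq_self, Data.branch_ofBool]
  obtain h1 | ⟨ID, h1⟩ := (𝒢.grp n).decZ d.right.left |>.eq_none_or_eq_some
  · simp [h1]
  obtain h2 | ⟨D, h2⟩ := (𝒢.grp n).decG d.right.right.left |>.eq_none_or_eq_some
  · simp [h2]
  obtain h3 | ⟨t, h3⟩ := (𝒢.grp n).decZ d.right.right.right.left |>.eq_none_or_eq_some
  · simp [h3]
  have hv : ¬ (𝒢.grp n).e D (mpk.g₁ * (𝒢.grp n).exp mpk.g (-ID)) =
      (𝒢.grp n).e mpk.h mpk.g * (𝒢.grp n).exp ((𝒢.grp n).e mpk.g mpk.g) (-t) :=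
    hd ID ⟨D, t⟩ ⟨h0, h1, h2, h3⟩
  simp only [h1, h2, h3, Option.isSome_some, if_true]
  simp only [← enc_of_decode h1, ← enc_of_decode h2, ← enc_of_decode h3, Op.eval_zneg,
    Op.eval_gpow, Op.eval_gmul, Op.eval_pairing, Op.eval_tpow, Op.eval_tmul, Op.eval_teq,
    hv, decide_false]
  rfl

end Prog

/-! ## Random bits -/

theorem ex_comm₃ {α β γ : Type*} (μ : PMF α) (ν : PMF β) (ρ : PMF γ) (f : α → β → γ → ℝ≥0∞) :
    (ex μ fun a => ex ν fun b => ex ρ fun c => f a b c) =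
      ex ρ fun c => ex μ fun a => ex ν fun b => f a b c := by
  rw [ex_comm ρ]
  exact congrArg (ex _) (funext fun a => ex_comm _ _ _)

theorem bind_apply_eq_ex {α β : Type*} (μ : PMF α) (κ : α → PMF β) (b : β) :
    (μ.bind κ) b = ex μ fun a => κ a b := rfl

theorem ex_bool (μ : PMF Bool) (f : Bool → ℝ≥0∞) :
    ex μ f = μ true * f true + μ false * f false := by
  rw [ex, tsum_bool, add_comm]

theorem toReal_true_add_false (μ : PMF Bool) : (μ true).toReal + (μ false).toReal = 1 := by
  rw [← ENNReal.toReal_add (μ.apply_ne_top _) (μ.apply_ne_top _)]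
  have h := μ.tsum_coe
  rw [tsum_bool, add_comm] at h
  rw [h, ENNReal.toReal_one]

theorem toReal_true_le_one (μ : PMF Bool) : (μ true).toReal ≤ 1 :=
  ENNReal.toReal_le_of_le_ofReal zero_le_one (by simpa using μ.coe_le_one true)

/-- Probability that `guessBit` returns `true`. -/
theorem toReal_guessBit (μ ν ρ : PMF Bool) :
    (ex μ fun x => ex ν fun y => ex ρ fun z =>
      if Data.ofBool (guessBit x y z) = Data.tt then (1 : ℝ≥0∞) else 0).toReal =
    (μ true).toReal * (1 - (ν true).toReal) * (ρ true).toReal +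
      (1 - (μ true).toReal) * (ν true).toReal * (1 - (ρ true).toReal) := by
  have hn : (Data.nil = Data.tt) = False := by simp [Data.tt]
  have h1 := toReal_true_add_false μ
  have h2 := toReal_true_add_false ν
  have h3 := toReal_true_add_false ρ
  have t1 := μ.apply_ne_top
  have t2 := ν.apply_ne_top
  have t3 := ρ.apply_ne_top
  simp only [ex_bool, guessBit, Data.ofBool, if_true, Bool.false_eq_true, if_false, hn, mul_one,
    mul_zero, add_zero, zero_add, Bool.and_true, Bool.true_and, Bool.not_true, Bool.not_false,
    Bool.false_and]
  rw [ENNReal.toReal_add (ENNReal.mul_ne_top (t1 _) (ENNReal.mul_ne_top (t2 _) (t3 _)))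
    (ENNReal.mul_ne_top (t1 _) (ENNReal.mul_ne_top (t2 _) (t3 _)))]
  simp only [ENNReal.toReal_mul]
  rw [← eq_sub_iff_add_eq'.2 h1, ← eq_sub_iff_add_eq'.2 h2, ← eq_sub_iff_add_eq'.2 h3]
  ring

theorem toReal_le_add {a b c : ℝ≥0∞} (h : a ≤ b + c) (hb : b ≠ ∞) (hc : c ≠ ∞) :
    a.toReal ≤ b.toReal + c.toReal := by
  rw [← ENNReal.toReal_add hb hc]
  exact ENNReal.toReal_mono (by finiteness) h

/-! ### Probability that the PKG is accused -/

section Trace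

variable {B : BilinearGroup} {b : ProbeBase} {mpk : PublicKey B} {ID : B.Scalar} {k : UserKey B}
  {𝔻 : Device}

theorem counter_apply_zero (L : ℕ) :
    counter b mpk ID k 𝔻 L 0 = (probe b mpk ID k 𝔻 false) ^ L := by
  induction L with
  | zero => simp [counter]
  | succ L ih =>
    rw [counter, bind_apply_eq_ex, pow_succ, ← ih, apply_eq_ex (counter b mpk ID k 𝔻 L),
      ← ex_mul_const]
    refine congrArg (ex _) (funext fun c => ?_)
    rw [bind_apply_eq_ex, ex_bool]
    by_cases hc : c = 0 <;> simp [hc, PMF.pure_apply, eq_comm]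

theorem trace_apply_pkg {n : ℕ} {ε : ℝ} (hk : k.Valid mpk ID) :
    trace b n ε mpk ID k 𝔻 Verdict.pkg =
      (probe b mpk ID k 𝔻 false) ^ ⌈16 * (n : ℝ) / ε⌉₊ := by
  rw [trace, if_pos hk, bind_apply_eq_ex, ← counter_apply_zero, apply_eq_ex (counter _ _ _ _ _ _)]
  refine congrArg (ex _) (funext fun c => ?_)
  by_cases hc : c = 0 <;> simp [hc, PMF.pure_apply]

theorem trace_apply_pkg_of_not {n : ℕ} {ε : ℝ} (hk : ¬ k.Valid mpk ID) :
    trace b n ε mpk ID k 𝔻 Verdict.pkg = 0 := by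
  simp [trace, hk, PMF.pure_apply]

/-- Each probe fails with probability at most `1 - ε/2 ≤ exp(-ε/2)`, and `16 n / ε` independent
probes bring the exponent to `8 n`. -/
theorem trace_le_exp {n : ℕ} {ε : ℝ} (hε : 0 < ε) (hk : k.Valid mpk ID)
    (hv : ε / 2 ≤ (probe b mpk ID k 𝔻 true).toReal) :
    (trace b n ε mpk ID k 𝔻 Verdict.pkg).toReal ≤ Real.exp (-(8 * n)) := by
  have h1 := toReal_true_add_false (probe b mpk ID k 𝔻)
  rw [trace_apply_pkg hk, ENNReal.toReal_pow]
  calc _ ≤ Real.exp (-(ε / 2)) ^ ⌈16 * (n : ℝ) / ε⌉₊ := by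
        refine pow_le_pow_left₀ ENNReal.toReal_nonneg ?_ _
        have := Real.add_one_le_exp (-(ε / 2))
        linarith
    _ = Real.exp (-(ε / 2 * ⌈16 * (n : ℝ) / ε⌉₊)) := by
        rw [← Real.exp_nat_mul]; congr 1; ring
    _ ≤ _ := by
        refine Real.exp_le_exp.2 (neg_le_neg ?_)
        calc (8 * n : ℝ) = ε / 2 * (16 * n / ε) := by field_simp; ring
          _ ≤ _ := by gcongr; exact Nat.le_ceil _

end Trace

/-- The gain of the distinguisher, in terms of the probabilities `u`, `v` that the device opens
well-formed ciphertexts and probes, and of the estimates `u₀`, `v₀` of these. -/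
theorem gain_bound {ε u v u₀ v₀ z δ W E : ℝ} (hε0 : 0 < ε) (hε1 : ε ≤ 1)
    (hu0 : 0 ≤ u) (hu1 : u ≤ 1) (hz0 : 0 ≤ z) (hz1 : z ≤ 1) (hv0 : 0 ≤ v) (hv1 : v ≤ 1)
    (huu : |u₀ - u| ≤ δ) (hvv : |v₀ - v| ≤ 3 * δ) (hzz : |z - v₀| ≤ 2 * δ)
    (hE : 0 ≤ E)
    (hW : W = 0 ∨ ε ≤ u ∧ W ≤ 1 ∧ (ε / 2 ≤ v → W ≤ E)) :
    (u₀ * (1 - v₀) * z + (1 - u₀) * v₀ * (1 - z)) + ε ^ 2 / 4 * W ≤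
      (u₀ * (1 - v₀) * u + (1 - u₀) * v₀ * (1 - u)) + (9 * δ + E) := by
  -- The right-hand side is exactly the advantage, after expanding both acceptance probabilities.
  -- Replacing `u₀ - v₀` by `u - v` costs `δ + 3δ`, and replacing `z` by `v` costs `2δ + 3δ`.
  have key : (u - v) ^ 2 - 9 * δ ≤ (u - z) * (u₀ - v₀) := by
    have e1 : |(u - z) * ((u₀ - v₀) - (u - v))| ≤ 4 * δ := by
      rw [abs_mul]
      have h1 : |u - z| ≤ 1 := abs_le.2 ⟨by linarith, by linarith⟩
      have h2 : |(u₀ - v₀) - (u - v)| ≤ 4 * δ := by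
        rw [abs_le] at *; constructor <;> linarith
      calc _ ≤ 1 * (4 * δ) := mul_le_mul h1 h2 (abs_nonneg _) zero_le_one
        _ = _ := one_mul _
    have e2 : |(u - v) * ((u - z) - (u - v))| ≤ 5 * δ := by
      rw [abs_mul]
      have h1 : |u - v| ≤ 1 := abs_le.2 ⟨by linarith, by linarith⟩
      have h2 : |(u - z) - (u - v)| ≤ 5 * δ := by
        rw [abs_le] at *; constructor <;> linarith
      calc _ ≤ 1 * (5 * δ) := mul_le_mul h1 h2 (abs_nonneg _) zero_le_one
        _ = _ := one_mul _
    have := (abs_le.1 e1).1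
    have := (abs_le.1 e2).1
    nlinarith
  -- A device that opens many probes is caught, so `W ≤ E`. One that opens few has a gap `u - v ≥ ε
  -- / 2`.
  have hmain : ε ^ 2 / 4 * W ≤ (u - v) ^ 2 + E := by
    obtain rfl | ⟨hu, hW1, hW⟩ := hW
    · nlinarith [sq_nonneg (u - v)]
    by_cases h : ε / 2 ≤ v
    · have hε1 : ε ^ 2 / 4 ≤ 1 := by nlinarith
      have : ε ^ 2 / 4 * W ≤ E := by
        calc _ ≤ ε ^ 2 / 4 * E := by gcongr; exact hW h
          _ ≤ 1 * E := by gcongr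
          _ = E := one_mul _
      nlinarith [sq_nonneg (u - v)]
    · have h1 : ε / 2 ≤ u - v := by linarith [not_le.1 h]
      have h2 : ε ^ 2 / 4 * W ≤ ε ^ 2 / 4 * 1 := by gcongr
      nlinarith
  nlinarith

/-! ### Success of the device on the different kinds of ciphertexts -/

section Leaf

variable {B : BilinearGroup} {b : ProbeBase} {mpk : PublicKey B} {ID : B.Scalar} {k : UserKey B}
  {𝔻 : Device}

/-- On a valid key, decrypting with the key and with the randomness agree. -/
theorem mask_eq (hg : mpk.g ≠ 1) (hk : k.Valid mpk ID) (s : B.Scalar) :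
    B.e (B.exp (mpk.idBase ID) s) k.d * B.exp (B.exp (B.e mpk.g mpk.g) s) k.t =
      B.exp (B.e mpk.g mpk.h) s := by
  have hpT := B.pow_p_GT (B.e mpk.g mpk.g)
  have hb := B.exp_bijective hg
  obtain ⟨x, hx⟩ := hb.2 k.d
  obtain ⟨y, hy⟩ := hb.2 (mpk.idBase ID)
  obtain ⟨ω, hω⟩ := hb.2 mpk.h
  have hk' : x * y = ω + -k.t := by
    apply (B.exp_bijective_GT (Prog.e_self_ne_one hg)).1
    have := hk
    rw [UserKey.Valid, ← hx, ← hy, ← hω, B.e_exp, B.e_exp_left, ← B.exp_add hpT] at this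
    exact this
  rw [← hx, ← hy, ← hω, ← B.exp_mul (B.pow_p _), B.e_exp, ← B.exp_mul hpT, ← B.exp_add hpT,
    B.e_exp_right, ← B.exp_mul hpT]
  congr 1
  linear_combination s * hk'

/-- By `mask_eq`, masking with the key agrees with masking by `e(g,h)^s` when both exponents are
`s`. Encryptions and probes thus become instances of one experiment `deviceBit`. -/
theorem decryptTest_eq (hg : mpk.g ≠ 1) (hk : k.Valid mpk ID) :
    decryptTest mpk ID 𝔻 true = ex (PMF.uniformOfFintype B.Scalarˣ) fun s =>
      deviceBit 𝔻 k (B.exp (mpk.idBase ID) s) (B.exp (B.e mpk.g mpk.g) s) true := by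
  simp only [decryptTest, encrypt, deviceBit, bind_apply_eq_ex, ex_bind, ex_pure]
  rw [ex_comm]
  refine congrArg (ex _) (funext fun s => congrArg (ex _) (funext fun m => ?_))
  rw [mul_assoc, mask_eq hg hk]

/-- For `h ≠ 1` both choices of the probe base generate `GT`. Rescaling the second exponent by `κ`
makes them interchangeable, so one argument covers both. -/
theorem exists_probeBase (hg : mpk.g ≠ 1) (hh : mpk.h ≠ 1) :
    ∃ κ : B.Scalarˣ, b.value mpk = B.exp (B.e mpk.g mpk.g) (κ : B.Scalar) := by
  cases b with
  | gg => exact ⟨1, by simp [ProbeBase.value, B.exp_one]⟩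
  | gh =>
    obtain ⟨ω, hω⟩ := (B.exp_bijective hg).2 mpk.h
    have h0 : ω ≠ 0 := by
      rintro rfl
      exact hh (by rw [← hω, B.exp_zero])
    exact ⟨Units.mk0 ω h0, by simp [ProbeBase.value, ← hω, B.e_exp_right]⟩

theorem probe_eq {κ : B.Scalar} (hκ : b.value mpk = B.exp (B.e mpk.g mpk.g) κ) :
    probe b mpk ID k 𝔻 true = ex B.randDistinct fun s =>
      deviceBit 𝔻 k (B.exp (mpk.idBase ID) s.1)
        (B.exp (B.e mpk.g mpk.g) (κ * s.2)) true := by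
  simp only [probe, deviceBit, bind_apply_eq_ex, hκ, B.exp_mul (B.pow_p_GT _)]

/-- Probability that the device opens a ciphertext with independent exponents. -/
def mixedBit (mpk : PublicKey B) (ID : B.Scalar) (k : UserKey B) (𝔻 : Device) : PMF Bool :=
  (PMF.uniformOfFintype B.Scalar).bind fun s => (PMF.uniformOfFintype B.Scalar).bind fun r =>
    deviceBit 𝔻 k (B.exp (mpk.idBase ID) s) (B.exp (B.e mpk.g mpk.g) r)

/-- Probability that the device opens a ciphertext with equal exponents. -/
def equalBit (mpk : PublicKey B) (ID : B.Scalar) (k : UserKey B) (𝔻 : Device) : PMF Bool :=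
  (PMF.uniformOfFintype B.Scalar).bind fun s =>
    deviceBit 𝔻 k (B.exp (mpk.idBase ID) s) (B.exp (B.e mpk.g mpk.g) s)

theorem abs_toReal_sub_le {a b c : ℝ≥0∞} (hab : a ≤ b + c) (hba : b ≤ a + c) (ha : a ≠ ∞)
    (hb : b ≠ ∞) (hc : c ≠ ∞) : |a.toReal - b.toReal| ≤ c.toReal := by
  have h1 := toReal_le_add hab hb hc
  have h2 := toReal_le_add hba ha hc
  rw [abs_le]
  constructor <;> linarith

theorem inv_p_ne_top : (B.p : ℝ≥0∞)⁻¹ ≠ ∞ := by simpa using B.prime.ne_zero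

theorem abs_equalBit_sub_le (hg : mpk.g ≠ 1) (hk : k.Valid mpk ID) :
    |(equalBit mpk ID k 𝔻 true).toReal - (decryptTest mpk ID 𝔻 true).toReal| ≤ (B.p : ℝ)⁻¹ := by
  have h := abs_toReal_sub_le (a := equalBit mpk ID k 𝔻 true) (b := decryptTest mpk ID 𝔻 true)
    (c := (B.p : ℝ≥0∞)⁻¹) ?_ ?_ (PMF.apply_ne_top _ _) (PMF.apply_ne_top _ _) inv_p_ne_top
  · simpa using h
  · rw [decryptTest_eq hg hk]
    exact B.le_ex_units fun s => PMF.coe_le_one _ _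
  · rw [decryptTest_eq hg hk]
    exact B.ex_units_le fun s => PMF.coe_le_one _ _

theorem mixedBit_eq (κ : B.Scalarˣ) : mixedBit mpk ID k 𝔻 true =
    ex (PMF.uniformOfFintype B.Scalar) fun s => ex (PMF.uniformOfFintype B.Scalar) fun r =>
      deviceBit 𝔻 k (B.exp (mpk.idBase ID) s) (B.exp (B.e mpk.g mpk.g) (κ * r)) true := by
  rw [mixedBit, bind_apply_eq_ex]
  refine congrArg (ex _) (funext fun s => ?_)
  rw [bind_apply_eq_ex, ← ex_uniform_equiv (Units.mulLeft κ)]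
  rfl

theorem abs_mixedBit_sub_le (hg : mpk.g ≠ 1) (hh : mpk.h ≠ 1) :
    |(mixedBit mpk ID k 𝔻 true).toReal - (probe b mpk ID k 𝔻 true).toReal| ≤
      3 * (B.p : ℝ)⁻¹ := by
  obtain ⟨κ, hκ⟩ := exists_probeBase (b := b) hg hh
  have h := abs_toReal_sub_le (a := mixedBit mpk ID k 𝔻 true) (b := probe b mpk ID k 𝔻 true)
    (c := 3 * (B.p : ℝ≥0∞)⁻¹) ?_ ?_ (PMF.apply_ne_top _ _) (PMF.apply_ne_top _ _)
    (ENNReal.mul_ne_top (by simp) inv_p_ne_top)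
  · simpa using h
  · rw [probe_eq hκ, mixedBit_eq κ]
    exact B.le_ex_randDistinct (f := fun s t => deviceBit 𝔻 k (B.exp (mpk.idBase ID) s)
      (B.exp (B.e mpk.g mpk.g) (κ * t)) true) fun s t => PMF.coe_le_one _ _
  · rw [probe_eq hκ, mixedBit_eq κ]
    exact B.ex_randDistinct_le (f := fun s t => deviceBit 𝔻 k (B.exp (mpk.idBase ID) s)
      (B.exp (B.e mpk.g mpk.g) (κ * t)) true) fun s t => PMF.coe_le_one _ _

/-- The device on the ciphertext derived from a real challenge. -/
def realBit (mpk : PublicKey B) (ID : B.Scalar) (k : UserKey B) (𝔻 : Device) (A μ : B.Scalar) :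
    PMF Bool :=
  (PMF.uniformOfFintype B.Scalarˣ).bind fun η =>
    deviceBit 𝔻 k (B.exp (mpk.idBase ID) (η * (A + μ)))
      (B.exp (B.e mpk.g mpk.g) (η * A + η * μ))

/-- The device on the ciphertext derived from a random challenge. -/
def randomBit (mpk : PublicKey B) (ID : B.Scalar) (k : UserKey B) (𝔻 : Device) (A μ : B.Scalar) :
    PMF Bool :=
  (PMF.uniformOfFintype B.Scalarˣ).bind fun η => (PMF.uniformOfFintype B.Scalarˣ).bind fun β =>
    deviceBit 𝔻 k (B.exp (mpk.idBase ID) (η * (A + μ)))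
      (B.exp (B.e mpk.g mpk.g) (η * β + η * μ))

/-- Multiplication by the nonzero scalar `A + μ` permutes the units, so the exponent of a real
challenge is that of a fresh encryption, without any error. -/
theorem realBit_eq (hg : mpk.g ≠ 1) (hk : k.Valid mpk ID) {A μ : B.Scalar} (h : A + μ ≠ 0) :
    realBit mpk ID k 𝔻 A μ true = decryptTest mpk ID 𝔻 true := by
  rw [decryptTest_eq hg hk, realBit, bind_apply_eq_ex,
    ← ex_uniform_equiv (Equiv.mulRight (Units.mk0 _ h)) (fun s : B.Scalarˣ =>
      deviceBit 𝔻 k (B.exp (mpk.idBase ID) s) (B.exp (B.e mpk.g mpk.g) s) true)]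
  simp [mul_add]

theorem abs_randomBit_sub_le {A μ : B.Scalar} (h : A + μ ≠ 0) :
    |(randomBit mpk ID k 𝔻 A μ true).toReal - (mixedBit mpk ID k 𝔻 true).toReal| ≤
      2 * (B.p : ℝ)⁻¹ := by
  set D : B.Scalar → B.Scalar → ℝ≥0∞ := fun s r =>
    deviceBit 𝔻 k (B.exp (mpk.idBase ID) s) (B.exp (B.e mpk.g mpk.g) r) true with hD
  have hD1 : ∀ s r, D s r ≤ 1 := fun s r => PMF.coe_le_one _ _
  have hr : randomBit mpk ID k 𝔻 A μ true = ex (PMF.uniformOfFintype B.Scalarˣ) fun η =>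
      ex (PMF.uniformOfFintype B.Scalarˣ) fun β => D (η * (A + μ)) (η * β + η * μ) := rfl
  have hm : mixedBit mpk ID k 𝔻 true = ex (PMF.uniformOfFintype B.Scalar) fun s =>
      ex (PMF.uniformOfFintype B.Scalar) fun r => D s r := rfl
  -- For fixed `η` the map `β ↦ η β + η μ` permutes the scalars, so the second exponent becomes
  -- independent of the first. Passing from units to scalars, once for `β` and once for `η`, gives
  -- the `2 / p`.
  have hβ : ∀ η : B.Scalarˣ, (ex (PMF.uniformOfFintype B.Scalar) fun β =>
      D (η * (A + μ)) (η * β + η * μ)) =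
      ex (PMF.uniformOfFintype B.Scalar) fun r => D (η * (A + μ)) r := fun η => by
    exact ex_uniform_equiv ((Units.mulLeft η).trans (Equiv.addRight ((η : B.Scalar) * μ)))
      (D (η * (A + μ)))
  have hη : (ex (PMF.uniformOfFintype B.Scalarˣ) fun η =>
      ex (PMF.uniformOfFintype B.Scalar) fun r => D (η * (A + μ)) r) =
      ex (PMF.uniformOfFintype B.Scalarˣ) fun s =>
        ex (PMF.uniformOfFintype B.Scalar) fun r => D s r := by
    rw [← ex_uniform_equiv (Equiv.mulRight (Units.mk0 _ h)) (fun s : B.Scalarˣ =>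
      ex (PMF.uniformOfFintype B.Scalar) fun r => D s r)]
    simp
  have hone : ∀ s, (ex (PMF.uniformOfFintype B.Scalar) fun r => D s r) ≤ 1 :=
    fun s => ex_le_const fun r => hD1 s r
  have h := abs_toReal_sub_le (a := randomBit mpk ID k 𝔻 A μ true)
    (b := mixedBit mpk ID k 𝔻 true) (c := 2 * (B.p : ℝ≥0∞)⁻¹) ?_ ?_ (PMF.apply_ne_top _ _)
    (PMF.apply_ne_top _ _) (ENNReal.mul_ne_top (by simp) inv_p_ne_top)
  · simpa using h
  · calc _ ≤ ex (PMF.uniformOfFintype B.Scalarˣ) fun η =>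
          (ex (PMF.uniformOfFintype B.Scalar) fun r => D (η * (A + μ)) r) + (B.p : ℝ≥0∞)⁻¹ := by
          rw [hr]
          refine ex_mono fun η => ?_
          rw [← hβ η]
          exact B.ex_units_le (f := fun β => D (η * (A + μ)) (η * β + η * μ)) fun β => hD1 _ _
      _ ≤ _ := by
          rw [ex_add, ex_const, hη, two_mul, ← add_assoc, hm]
          exact add_le_add_left (B.ex_units_le (f := fun s =>
            ex (PMF.uniformOfFintype B.Scalar) fun r => D s r) hone) _
  · calc _ ≤ (ex (PMF.uniformOfFintype B.Scalarˣ) fun s =>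
          ex (PMF.uniformOfFintype B.Scalar) fun r => D s r) + (B.p : ℝ≥0∞)⁻¹ := by
          rw [hm]
          exact B.le_ex_units (f := fun s =>
            ex (PMF.uniformOfFintype B.Scalar) fun r => D s r) hone
      _ ≤ (ex (PMF.uniformOfFintype B.Scalarˣ) fun η =>
          (ex (PMF.uniformOfFintype B.Scalarˣ) fun β => D (η * (A + μ)) (η * β + η * μ)) +
            (B.p : ℝ≥0∞)⁻¹) + (B.p : ℝ≥0∞)⁻¹ := by
          rw [← hη]
          refine add_le_add_left (ex_mono fun η => ?_) _
          rw [← hβ η]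
          exact B.le_ex_units (f := fun β => D (η * (A + μ)) (η * β + η * μ)) fun β => hD1 _ _
      _ = _ := by rw [ex_add, ex_const, two_mul, ← add_assoc, hr]

end Leaf

/-- The indicator function of `Data.tt`. -/
def isTrue (d : Data) : ℝ≥0∞ := if d = Data.tt then 1 else 0

theorem isTrue_le_one (d : Data) : isTrue d ≤ 1 := by
  rw [isTrue]; split_ifs <;> simp

theorem isTrue_ofBool (b : Bool) : isTrue (.ofBool b) = if b then 1 else 0 := by
  cases b <;> simp [isTrue, Data.ofBool, Data.tt]

/-! ### The gain from a single final output -/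

section Exploit

variable {𝒢 : BilinearFamily} {n q : ℕ} {b : ProbeBase} {mpk : PublicKey (𝒢.grp n)}
  {α : (𝒢.grp n).Scalar} {f : Polynomial (𝒢.grp n).Scalar} {𝔻 : Device}
  {ID : (𝒢.grp n).Scalar} {k : UserKey (𝒢.grp n)}

/-- The probability that the user wins with her final output, except that `h = 1` does not count. -/
def winValue (b : ProbeBase) (ε : ℝ) (mpk : PublicKey (𝒢.grp n)) (ID : (𝒢.grp n).Scalar)
    (k : UserKey (𝒢.grp n)) (𝔻 : Device) : ℝ≥0∞ :=
  if Useful mpk ID ε 𝔻 ∧ mpk.h ≠ 1 then trace b n ε mpk ID k 𝔻 Verdict.pkg else 0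

theorem winValue_le_one {ε : ℝ} : winValue b ε mpk ID k 𝔻 ≤ 1 := by
  rw [winValue]; split_ifs
  · exact PMF.coe_le_one _ _
  · simp

theorem winValue_of_not_valid {ε : ℝ} (hk : ¬ k.Valid mpk ID) :
    winValue b ε mpk ID k 𝔻 = 0 := by
  rw [winValue, trace_apply_pkg_of_not hk, ite_self]

/-- The loss in a single execution of the distinguisher. -/
def gainError (𝒢 : BilinearFamily) (n : ℕ) : ℝ≥0∞ :=
  ENNReal.ofReal (9 * ((𝒢.grp n).p : ℝ)⁻¹ + Real.exp (-(8 * n)))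

theorem gainError_ne_top : gainError 𝒢 n ≠ ∞ := ENNReal.ofReal_ne_top

/-- Stated for every valid key, whether or not the device is useful: the gain is bounded below for
each output separately, so it can be averaged over the outcome of the simulated game. -/
theorem exploit_gain (hg : mpk.g ≠ 1) (hk : k.Valid mpk ID) {ε : ℝ}
    (hε : 0 < ε) (hε1 : ε ≤ 1) :
    (ex (PMF.uniformOfFintype (𝒢.grp n).Scalarˣ) fun η =>
      ex (PMF.uniformOfFintype (𝒢.grp n).Scalarˣ) fun β =>
        Prog.exploitValue q mpk α f 𝔻 ID k η (η * β) isTrue) +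
      ENNReal.ofReal (ε ^ 2 / 4) * winValue b ε mpk ID k 𝔻 ≤
    (ex (PMF.uniformOfFintype (𝒢.grp n).Scalarˣ) fun η =>
      Prog.exploitValue q mpk α f 𝔻 ID k η (η * α ^ (q + 1)) isTrue) + gainError 𝒢 n := by
  have hδ : 0 ≤ ((𝒢.grp n).p : ℝ)⁻¹ := by positivity
  have hexp := (Real.exp_pos (-(8 * n : ℝ))).le
  have hW1 : (winValue b ε mpk ID k 𝔻).toReal ≤ 1 :=
    ENNReal.toReal_le_of_le_ofReal zero_le_one (by simpa using winValue_le_one)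
  have hWt : winValue b ε mpk ID k 𝔻 ≠ ∞ := ne_top_of_le_ne_top (by simp) winValue_le_one
  have hmul : (ENNReal.ofReal (ε ^ 2 / 4) * winValue b ε mpk ID k 𝔻).toReal =
      ε ^ 2 / 4 * (winValue b ε mpk ID k 𝔻).toReal := by
    rw [ENNReal.toReal_mul, ENNReal.toReal_ofReal (by positivity)]
  have hmt : ENNReal.ofReal (ε ^ 2 / 4) * winValue b ε mpk ID k 𝔻 ≠ ∞ :=
    ENNReal.mul_ne_top (by simp) hWt
  have herr : (gainError 𝒢 n).toReal = 9 * ((𝒢.grp n).p : ℝ)⁻¹ + Real.exp (-(8 * n)) :=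
    ENNReal.toReal_ofReal (by positivity)
  have hμ : ∃ μ, μ = (ID * α ^ (q + 1) - ID ^ (q + 2)) * (α - ID)⁻¹ := ⟨_, rfl⟩
  obtain ⟨μ, hμ⟩ := hμ
  simp only [Prog.exploitValue, ← hμ]
  by_cases hc : ID ≠ α ∧ k.t = f.eval ID ∧ α ^ (q + 1) + μ ≠ 0
  · simp only [if_pos hc]
    have hreal : (ex (PMF.uniformOfFintype (𝒢.grp n).Scalarˣ) fun η =>
        ex (PMF.uniformOfFintype (𝒢.grp n).Scalar) fun s =>
        ex (deviceBit 𝔻 k ((𝒢.grp n).exp (mpk.idBase ID) s)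
          ((𝒢.grp n).exp ((𝒢.grp n).e mpk.g mpk.g) s)) fun x =>
        ex (PMF.uniformOfFintype (𝒢.grp n).Scalar) fun s =>
        ex (PMF.uniformOfFintype (𝒢.grp n).Scalar) fun r =>
        ex (deviceBit 𝔻 k ((𝒢.grp n).exp (mpk.idBase ID) s)
          ((𝒢.grp n).exp ((𝒢.grp n).e mpk.g mpk.g) r)) fun y =>
        ex (deviceBit 𝔻 k ((𝒢.grp n).exp (mpk.idBase ID) (η * (α ^ (q + 1) + μ)))
          ((𝒢.grp n).exp ((𝒢.grp n).e mpk.g mpk.g) (η * α ^ (q + 1) + η * μ))) fun z =>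
          isTrue (.ofBool (guessBit x y z))) =
        ex (equalBit mpk ID k 𝔻) fun x => ex (mixedBit mpk ID k 𝔻) fun y =>
          ex (realBit mpk ID k 𝔻 (α ^ (q + 1)) μ) fun z =>
            isTrue (.ofBool (guessBit x y z)) := by
      simp only [equalBit, mixedBit, realBit, ex_bind]
      rw [ex_comm]
      refine congrArg (ex _) (funext fun s => ?_)
      rw [ex_comm]
      refine congrArg (ex _) (funext fun x => ?_)
      rw [ex_comm]
      refine congrArg (ex _) (funext fun s' => ?_)
      rw [ex_comm]
      refine congrArg (ex _) (funext fun r => ?_)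
      rw [ex_comm]
    have hrandom : (ex (PMF.uniformOfFintype (𝒢.grp n).Scalarˣ) fun η =>
        ex (PMF.uniformOfFintype (𝒢.grp n).Scalarˣ) fun β =>
        ex (PMF.uniformOfFintype (𝒢.grp n).Scalar) fun s =>
        ex (deviceBit 𝔻 k ((𝒢.grp n).exp (mpk.idBase ID) s)
          ((𝒢.grp n).exp ((𝒢.grp n).e mpk.g mpk.g) s)) fun x =>
        ex (PMF.uniformOfFintype (𝒢.grp n).Scalar) fun s =>
        ex (PMF.uniformOfFintype (𝒢.grp n).Scalar) fun r =>
        ex (deviceBit 𝔻 k ((𝒢.grp n).exp (mpk.idBase ID) s)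
          ((𝒢.grp n).exp ((𝒢.grp n).e mpk.g mpk.g) r)) fun y =>
        ex (deviceBit 𝔻 k ((𝒢.grp n).exp (mpk.idBase ID) (η * (α ^ (q + 1) + μ)))
          ((𝒢.grp n).exp ((𝒢.grp n).e mpk.g mpk.g) (η * β + η * μ))) fun z =>
          isTrue (.ofBool (guessBit x y z))) =
        ex (equalBit mpk ID k 𝔻) fun x => ex (mixedBit mpk ID k 𝔻) fun y =>
          ex (randomBit mpk ID k 𝔻 (α ^ (q + 1)) μ) fun z =>
            isTrue (.ofBool (guessBit x y z)) := by
      simp only [equalBit, mixedBit, randomBit, ex_bind]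
      rw [ex_comm₃]
      refine congrArg (ex _) (funext fun s => ?_)
      rw [ex_comm₃]
      refine congrArg (ex _) (funext fun x => ?_)
      rw [ex_comm₃]
      refine congrArg (ex _) (funext fun s' => ?_)
      rw [ex_comm₃]
      refine congrArg (ex _) (funext fun r => ?_)
      rw [ex_comm₃]
    rw [hreal, hrandom]
    have hle : ∀ μ ν ρ : PMF Bool, (ex μ fun x => ex ν fun y => ex ρ fun z =>
        isTrue (.ofBool (guessBit x y z))) ≠ ∞ := fun μ ν ρ =>
      ne_top_of_le_ne_top ENNReal.one_ne_top (ex_le_const fun x => ex_le_const fun y =>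
        ex_le_const fun z => isTrue_le_one _)
    rw [← ENNReal.toReal_le_toReal (ENNReal.add_ne_top.2 ⟨hle _ _ _, hmt⟩)
      (ENNReal.add_ne_top.2 ⟨hle _ _ _, gainError_ne_top⟩),
      ENNReal.toReal_add (hle _ _ _) hmt, ENNReal.toReal_add (hle _ _ _) gainError_ne_top,
      hmul, herr]
    simp only [isTrue, toReal_guessBit, realBit_eq hg hk hc.2.2]
    by_cases hU : Useful mpk ID ε 𝔻 ∧ mpk.h ≠ 1
    · refine gain_bound (v := (probe b mpk ID k 𝔻 true).toReal) hε hε1 ENNReal.toReal_nonneg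
        (toReal_true_le_one _) ENNReal.toReal_nonneg (toReal_true_le_one _) ENNReal.toReal_nonneg
        (toReal_true_le_one _) (abs_equalBit_sub_le hg hk) (abs_mixedBit_sub_le hg hU.2)
        (abs_randomBit_sub_le hc.2.2) hexp (Or.inr ⟨hU.1, hW1, fun hv => ?_⟩)
      rw [winValue, if_pos hU]
      exact trace_le_exp hε hk hv
    -- Only nonnegativity up to the error is needed here. Taking the estimate itself for `v` avoids
    -- the comparison with probes, which requires `h ≠ 1`.
    · refine gain_bound (v := (mixedBit mpk ID k 𝔻 true).toReal) hε hε1 ENNReal.toReal_nonneg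
        (toReal_true_le_one _) ENNReal.toReal_nonneg (toReal_true_le_one _) ENNReal.toReal_nonneg
        (toReal_true_le_one _) (abs_equalBit_sub_le hg hk) ?_
        (abs_randomBit_sub_le hc.2.2) hexp (Or.inl ?_)
      · rw [sub_self, abs_zero]
        positivity
      · rw [winValue, if_neg hU, ENNReal.toReal_zero]
  -- The direct cases accept every real challenge, and a random one only if `β = α ^ (q + 1)`, with
  -- probability at most `2 / p`. This gain dominates any value of the second summand.
  · simp only [if_neg hc, isTrue_ofBool, decide_true, if_true, ex_const]
    have hβ : (ex (PMF.uniformOfFintype (𝒢.grp n).Scalarˣ) fun η =>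
        ex (PMF.uniformOfFintype (𝒢.grp n).Scalarˣ) fun β =>
        if decide ((η : (𝒢.grp n).Scalar) * β = η * α ^ (q + 1)) = true then (1 : ℝ≥0∞) else 0) ≤
        2 * ((𝒢.grp n).p : ℝ≥0∞)⁻¹ := by
      refine ex_le_const fun η => ?_
      simp only [decide_eq_true_eq, mul_right_inj' η.ne_zero]
      refine ((𝒢.grp n).ex_units_le (f := fun β => if β = α ^ (q + 1) then 1 else 0)
        fun β => by split_ifs <;> simp).trans ?_
      rw [(𝒢.grp n).ex_uniform_eq, two_mul]
    have hq : ENNReal.ofReal (ε ^ 2 / 4) * winValue b ε mpk ID k 𝔻 ≤ 1 :=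
      mul_le_one' (by simpa using by nlinarith) winValue_le_one
    calc _ ≤ 2 * ((𝒢.grp n).p : ℝ≥0∞)⁻¹ + 1 := add_le_add hβ hq
      _ ≤ _ := by
        rw [add_comm]
        refine add_le_add_right ?_ _
        rw [← ENNReal.toReal_le_toReal (ENNReal.mul_ne_top (by simp) inv_p_ne_top)
          gainError_ne_top, herr]
        rw [ENNReal.toReal_mul, ENNReal.toReal_inv, ENNReal.toReal_natCast, ENNReal.toReal_ofNat]
        linarith

end Exploit

/-! ## The advantage of the distinguisher -/

section Final

open Prog

variable {𝒢 : BilinearFamily} {n K q : ℕ} {b : ProbeBase} {ε : ℝ} (A : Adversary)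

theorem eq_of_isOutcome {B : BilinearGroup} {d : Data} {ID ID' : B.Scalar} {k k' : UserKey B}
    (h : IsOutcome d ID k) (h' : IsOutcome d ID' k') : ID = ID' ∧ k = k' := by
  obtain ⟨-, h1, h2, h3⟩ := h
  obtain ⟨-, h1', h2', h3'⟩ := h'
  obtain ⟨x, t⟩ := k
  obtain ⟨x', t'⟩ := k'
  rw [h1, Option.some_inj] at h1'
  rw [h2, Option.some_inj] at h2'
  rw [h3, Option.some_inj] at h3'
  simp only at h2' h3'
  exact ⟨h1', by rw [h2', h3']⟩

/-- The probability that the user wins if the simulated game ends in the state `d`. -/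
def stateValue (b : ProbeBase) (ε : ℝ) (A : Adversary) (mpk : PublicKey (𝒢.grp n)) (d : Data) :
    ℝ≥0∞ :=
  ⨆ (ID : (𝒢.grp n).Scalar) (k : UserKey (𝒢.grp n)) (_ : IsOutcome d ID k),
    winValue b ε mpk ID k (A.mkDevice 𝒢 n d.right.right.right.right)

theorem stateValue_le {mpk : PublicKey (𝒢.grp n)} {d : Data} {c : ℝ≥0∞}
    (h : ∀ ID k, IsOutcome d ID k →
      winValue b ε mpk ID k (A.mkDevice 𝒢 n d.right.right.right.right) ≤ c) :
    stateValue b ε A mpk d ≤ c :=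
  iSup_le fun ID => iSup_le fun k => iSup_le fun hd => h ID k hd

/-- The part of a challenge that follows the powers of `g`, for `h = g^η` and
`T = e(g,g)^τ`. -/
def challenge {B : BilinearGroup} (q : ℕ) (g : B.G) (α η τ : B.Scalar) : Data :=
  .node (B.encG (B.exp g η)) (.node (B.encG (B.exp (B.exp g η) (α ^ (q + 2))))
    (B.encGT (B.exp (B.e g g) τ)))

theorem finish_gain {mpk : PublicKey (𝒢.grp n)} {α : (𝒢.grp n).Scalar}
    {f : Polynomial (𝒢.grp n).Scalar} (hq₁ : 1 ≤ q) (hq : q + 1 ≤ n ^ K) (hg : mpk.g ≠ 1)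
    (hg₁ : mpk.g₁ = (𝒢.grp n).exp mpk.g α) (hf : f.degree < (q + 1 : ℕ))
    (hh : mpk.h = (𝒢.grp n).exp mpk.g (f.eval α)) (hε : 0 < ε) (hε1 : ε ≤ 1) (d : Data) :
    (ex (PMF.uniformOfFintype (𝒢.grp n).Scalarˣ) fun η =>
      ex (PMF.uniformOfFintype (𝒢.grp n).Scalarˣ) fun β =>
        wp 𝒢 n (finish K A.device) (finishEnv q mpk α f d (challenge q mpk.g α η (η * β)))
          isTrue) + ENNReal.ofReal (ε ^ 2 / 4) * stateValue b ε A mpk d ≤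
    (ex (PMF.uniformOfFintype (𝒢.grp n).Scalarˣ) fun η =>
      wp 𝒢 n (finish K A.device) (finishEnv q mpk α f d (challenge q mpk.g α η (η * α ^ (q + 1))))
        isTrue) + gainError 𝒢 n := by
  by_cases hd : ∃ ID k, IsOutcome d ID k ∧ k.Valid mpk ID
  · obtain ⟨ID, k, hd, hk⟩ := hd
    simp only [challenge, wp_finish _ A hq₁ hq hg hg₁ hf hh hd hk (Units.ne_zero _)]
    have hv : stateValue b ε A mpk d ≤
        winValue b ε mpk ID k (A.mkDevice 𝒢 n d.right.right.right.right) := by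
      refine stateValue_le A fun ID' k' hd' => ?_
      obtain ⟨rfl, rfl⟩ := eq_of_isOutcome hd hd'
      exact le_rfl
    exact (add_le_add_right (mul_le_mul_right hv _) _).trans (exploit_gain hg hk hε hε1)
  · have hd' : ∀ ID k, IsOutcome d ID k → ¬ k.Valid mpk ID := fun ID k h hk => hd ⟨ID, k, h, hk⟩
    have h0 : stateValue b ε A mpk d = 0 :=
      le_antisymm (stateValue_le A fun ID k h => (winValue_of_not_valid (hd' ID k h)).le)
        zero_le
    simp only [wp_finish_of_not _ A hq₁ hg₁ hd', h0, mul_zero, add_zero, ex_const]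
    exact le_self_add

/-- The public key for the polynomial `f`. -/
def polyKey (B : BilinearGroup) (g : B.G) (α : B.Scalar) (f : B.Scalar[X]) : PublicKey B :=
  ⟨g, B.exp g α, B.exp g (f.eval α)⟩

/-- The final state of the simulated game. -/
def finalState (K : ℕ) (user : Prog) (q : ℕ) (g : (𝒢.grp n).G) (α : (𝒢.grp n).Scalar)
    (f : (𝒢.grp n).Scalar[X]) : PMF Data :=
  iter (fun d => (round K user).output 𝒢 n (.node d (simEnv (polyKey _ g α f) q α f)))
    (n ^ K) (.node .nil (.node .nil (polyKey _ g α f).toData))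

theorem ex_finalState (user : Prog) (g : (𝒢.grp n).G) (α : (𝒢.grp n).Scalar)
    (f : (𝒢.grp n).Scalar[X]) (φ : Data → ℝ≥0∞) :
    ex (finalState K user q g α f) φ =
      (simStep (𝒢 := 𝒢) (n := n) K user (simEnv (polyKey _ g α f) q α f))^[n ^ K] φ
        (.node .nil (.node .nil (polyKey _ g α f).toData)) :=
  ex_iter _ _ _ _

theorem ex_congr_support {α : Type*} {μ : PMF α} {f g : α → ℝ≥0∞}
    (h : ∀ a ∈ μ.support, f a = g a) : ex μ f = ex μ g :=
  le_antisymm (ex_mono_support fun a ha => (h a ha).le) (ex_mono_support fun a ha => (h a ha).ge)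

/-- The law of `f` and of the final state does not involve `η` and `τ`. Hence the real and the
random experiment share the same simulation and differ only in `finish`. -/
theorem wp_distinguisher (hq₁ : 1 ≤ q) (hq : q + 1 ≤ n ^ K) (g : (𝒢.grp n).G)
    (α η τ : (𝒢.grp n).Scalar) (φ : Data → ℝ≥0∞) :
    wp 𝒢 n (distinguisher K A) (.node (.ofList ((powers _ q g α).map (𝒢.grp n).encG))
      (challenge q g α η τ)) φ =
    ex (randPoly (𝒢.grp n).Scalar (q + 1)) fun f =>
      ex (finalState K A.user q g α f) fun d =>
        wp 𝒢 n (finish K A.device) (finishEnv q (polyKey _ g α f) α f d (challenge q g α η τ))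
          φ := by
  have hne : powers (𝒢.grp n) q g α ≠ [] := by
    rw [← List.length_pos_iff_ne_nil, length_powers]
    exact q.succ_pos
  rw [distinguisher, wp_letIn, wp_setup _ _ (length_powers.trans_le hq) hne, length_powers]
  refine ex_congr_support fun f hf => ?_
  have hdeg := degree_lt_of_mem_support_randPoly hf
  rw [prod_setupState (by exact_mod_cast hdeg), wp_letIn, wp_call, ex_finalState, ← wp_simulate]
  simp only [wp_pair, wp_left, wp_right, wp_var, wp_nil, Function.iterate_succ,
    Function.iterate_zero, Function.comp, id, Data.left_node, Data.right_node,
    left_ofList_powers, left_right_ofList_powers hq₁]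
  rfl

theorem adbdheTuple_eq {B : BilinearGroup} (g : B.G) (α η : B.Scalar) (τ : B.Scalar) :
    adbdheTuple B q g (B.exp g η) α (B.exp (B.e g (B.exp g η)) τ) =
      .node (.ofList ((powers B q g α).map B.encG)) (challenge q g α η (η * τ)) := by
  rw [adbdheTuple, challenge, powers, List.map_map, B.e_exp_right, ← B.exp_mul (B.pow_p_GT _)]
  rfl

/-- The game value `E[stateValue]` of the simulated game. -/
def simulatedValue (K : ℕ) (b : ProbeBase) (ε : ℝ) (A : Adversary) (q : ℕ) (g : (𝒢.grp n).G)
    (α : (𝒢.grp n).Scalar) : ℝ≥0∞ :=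
  ex (randPoly (𝒢.grp n).Scalar (q + 1)) fun f => ex (finalState K A.user q g α f) fun d =>
    stateValue b ε A (polyKey _ g α f) d

theorem distinguisher_gain_aux (hq₁ : 1 ≤ q) (hq : q + 1 ≤ n ^ K) (hε : 0 < ε) (hε1 : ε ≤ 1)
    {g : (𝒢.grp n).G} (hg : g ≠ 1) (α : (𝒢.grp n).Scalar) :
    (ex (PMF.uniformOfFintype (𝒢.grp n).Scalarˣ) fun η =>
      ex (PMF.uniformOfFintype (𝒢.grp n).Scalarˣ) fun β =>
        wp 𝒢 n (distinguisher K A) (.node (.ofList ((powers _ q g α).map (𝒢.grp n).encG))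
          (challenge q g α η (η * β))) isTrue) +
      ENNReal.ofReal (ε ^ 2 / 4) * simulatedValue K b ε A q g α ≤
    (ex (PMF.uniformOfFintype (𝒢.grp n).Scalarˣ) fun η =>
      wp 𝒢 n (distinguisher K A) (.node (.ofList ((powers _ q g α).map (𝒢.grp n).encG))
        (challenge q g α η (η * α ^ (q + 1)))) isTrue) + gainError 𝒢 n := by
  simp only [wp_distinguisher A hq₁ hq]
  rw [ex_comm₃ _ _ (randPoly _ _), ex_comm _ (randPoly _ _), simulatedValue, ← ex_const_mul, ← ex_add]
  conv_rhs => rw [← ex_const (randPoly (𝒢.grp n).Scalar (q + 1)) (gainError 𝒢 n), ← ex_add]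
  refine ex_mono_support fun f hf => ?_
  have hdeg := degree_lt_of_mem_support_randPoly hf
  rw [ex_comm₃ _ _ (finalState _ _ _ _ _ _), ex_comm _ (finalState _ _ _ _ _ _), ← ex_const_mul, ← ex_add]
  conv_rhs => rw [← ex_const (finalState K A.user q g α f) (gainError 𝒢 n), ← ex_add]
  exact ex_mono fun d => finish_gain A (mpk := polyKey _ g α f) hq₁ hq hg rfl
    (by exact_mod_cast hdeg) rfl hε hε1 d

variable {Q : ℕ → ℕ}

theorem adbdheReal_apply (D : Prog) : adbdheReal 𝒢 Q D n Data.tt =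
    ex (𝒢.grp n).randGen fun g => ex (PMF.uniformOfFintype (𝒢.grp n).Scalarˣ) fun α =>
      ex (PMF.uniformOfFintype (𝒢.grp n).Scalarˣ) fun η =>
        wp 𝒢 n D (.node (.ofList ((powers _ (Q n) g α).map (𝒢.grp n).encG))
          (challenge (Q n) g α η (η * (α : (𝒢.grp n).Scalar) ^ (Q n + 1)))) isTrue := by
  rw [adbdheReal, apply_eq_ex]
  simp only [ex_bind]
  refine ex_congr_support fun g hg => ?_
  rw [(𝒢.grp n).ex_randGen ((𝒢.grp n).mem_support_randGen hg), ex_comm]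
  simp only [adbdheTuple_eq]
  rfl

theorem adbdheRandom_apply (D : Prog) : adbdheRandom 𝒢 Q D n Data.tt =
    ex (𝒢.grp n).randGen fun g => ex (PMF.uniformOfFintype (𝒢.grp n).Scalarˣ) fun α =>
      ex (PMF.uniformOfFintype (𝒢.grp n).Scalarˣ) fun η =>
      ex (PMF.uniformOfFintype (𝒢.grp n).Scalarˣ) fun β =>
        wp 𝒢 n D (.node (.ofList ((powers _ (Q n) g α).map (𝒢.grp n).encG))
          (challenge (Q n) g α η (η * β))) isTrue := by
  rw [adbdheRandom, apply_eq_ex]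
  simp only [ex_bind]
  refine ex_congr_support fun g hg => ?_
  rw [(𝒢.grp n).ex_randGen ((𝒢.grp n).mem_support_randGen hg), ex_comm]
  simp only [adbdheTuple_eq]
  rfl

/-- The total value of the simulated game. -/
def totalValue (𝒢 : BilinearFamily) (n K : ℕ) (b : ProbeBase) (ε : ℝ) (A : Adversary) (q : ℕ) :
    ℝ≥0∞ :=
  ex (𝒢.grp n).randGen fun g => ex (PMF.uniformOfFintype (𝒢.grp n).Scalarˣ) fun α =>
    simulatedValue K b ε A q g (α : (𝒢.grp n).Scalar)

theorem distinguisher_gain (hq₁ : 1 ≤ Q n) (hq : Q n + 1 ≤ n ^ K) (hε : 0 < ε) (hε1 : ε ≤ 1) :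
    adbdheRandom 𝒢 Q (distinguisher K A) n Data.tt +
      ENNReal.ofReal (ε ^ 2 / 4) * totalValue 𝒢 n K b ε A (Q n) ≤
    adbdheReal 𝒢 Q (distinguisher K A) n Data.tt + gainError 𝒢 n := by
  rw [adbdheReal_apply, adbdheRandom_apply, totalValue, ← ex_const_mul, ← ex_add]
  conv_rhs => rw [← ex_const (𝒢.grp n).randGen (gainError 𝒢 n), ← ex_add]
  refine ex_mono_support fun g hg => ?_
  rw [← ex_const_mul, ← ex_add]
  conv_rhs => rw [← ex_const (PMF.uniformOfFintype (𝒢.grp n).Scalarˣ) (gainError 𝒢 n), ← ex_add]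
  exact ex_mono fun α =>
    distinguisher_gain_aux A hq₁ hq hε hε1 ((𝒢.grp n).mem_support_randGen hg) _

end Final

/-! ## The advantage of the dishonest user -/

section Adversary

open Prog

variable {𝒢 : BilinearFamily} {n K : ℕ} {Q : ℕ → ℕ} {b : ProbeBase} {ε : ℕ → ℝ} (A : Adversary)

/-- `winValue` for the outcome of the interaction with the PKG. -/
def outcomeValue (b : ProbeBase) (ε : ℝ) (A : Adversary) (mpk : PublicKey (𝒢.grp n)) :
    Option ((𝒢.grp n).Scalar × UserKey (𝒢.grp n) × Data) → ℝ≥0∞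
  | none => 0
  | some (ID, k, w) => winValue b ε mpk ID k (A.mkDevice 𝒢 n w)

theorem outcomeValue_le_one {ε : ℝ} (mpk : PublicKey (𝒢.grp n)) (x) :
    outcomeValue b ε A mpk x ≤ 1 := by
  rcases x with - | ⟨ID, k, w⟩
  · simp [outcomeValue]
  · exact winValue_le_one

/-- The event `h = 1`, on which `e(g,h)` would be a trivial probe base, is given away for `1 / p`.
-/
theorem game_le : computeNewKeyGame 𝒢 Q b ε A n true ≤
    ex (𝒢.grp n).randGen fun g => ex (PMF.uniformOfFintype (𝒢.grp n).Scalarˣ) fun α =>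
      (ex (PMF.uniformOfFintype (𝒢.grp n).G) fun h =>
        ex (play 𝒢 A n ⟨g, (𝒢.grp n).exp g (α : (𝒢.grp n).Scalar), h⟩ α (Q n) [] .nil
          (PublicKey.toData ⟨g, (𝒢.grp n).exp g (α : (𝒢.grp n).Scalar), h⟩))
          (outcomeValue b (ε n) A ⟨g, (𝒢.grp n).exp g (α : (𝒢.grp n).Scalar), h⟩)) +
        ((𝒢.grp n).p : ℝ≥0∞)⁻¹ := by
  have h1 : (ex (PMF.uniformOfFintype (𝒢.grp n).G) fun h => if h = 1 then (1 : ℝ≥0∞) else 0) =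
      ((𝒢.grp n).p : ℝ≥0∞)⁻¹ := by
    rw [← apply_eq_ex, PMF.uniformOfFintype_apply, (𝒢.grp n).card_G]
  rw [computeNewKeyGame, bind_apply_eq_ex, setup]
  simp only [ex_bind, ex_pure]
  refine ex_mono fun g => ?_
  rw [ex_comm]
  refine ex_mono fun α => ?_
  rw [← h1, ← ex_add]
  refine ex_mono fun h => ?_
  by_cases hh : h = 1
  · simp only [if_pos hh]
    exact (PMF.coe_le_one _ _).trans le_add_self
  · simp only [if_neg hh, add_zero]
    rw [bind_apply_eq_ex]
    refine ex_mono fun x => ?_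
    rcases x with - | ⟨ID, k, w⟩
    · simp [PMF.pure_apply]
    · simp only [outcomeValue, winValue, hh, ne_eq, not_false_eq_true, and_true]
      split_ifs
      · rw [bind_apply_eq_ex, apply_eq_ex (trace _ _ _ _ _ _ _)]
        refine ex_mono fun v => ?_
        cases v <;> simp [PMF.pure_apply]
      · simp [PMF.pure_apply]

/-- Decomposing `f = y + (X - α) r` makes `h = g^y` uniform, as in the real setup. The invariant of
`play_le` then starts with `N = y`, `Z = X - α` and all `q` coefficients of `r` free. -/
theorem play_le_simulatedValue {q : ℕ} {ε : ℝ} (hq : q + 1 ≤ n ^ K) {g : (𝒢.grp n).G} (hg : g ≠ 1)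
    (α : (𝒢.grp n).Scalar) :
    (ex (PMF.uniformOfFintype (𝒢.grp n).G) fun h =>
      ex (play 𝒢 A n ⟨g, (𝒢.grp n).exp g α, h⟩ α q [] .nil
        (PublicKey.toData ⟨g, (𝒢.grp n).exp g α, h⟩))
        (outcomeValue b ε A ⟨g, (𝒢.grp n).exp g α, h⟩)) ≤
      simulatedValue K b ε A q g α +
        q * (((n ^ K : ℕ) : ℝ≥0∞)⁻¹ + 2 * ((𝒢.grp n).p : ℝ≥0∞)⁻¹) := by
  rw [(𝒢.grp n).ex_uniform_exp hg, simulatedValue, ex_randPoly_succ α,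
    ← ex_const (PMF.uniformOfFintype (𝒢.grp n).Scalar) (_ * _), ← ex_add]
  refine ex_mono fun y => ?_
  have hev : ∀ r : (𝒢.grp n).Scalar[X],
      (Polynomial.C y + (Polynomial.X - Polynomial.C α) * r).eval α = y := by simp
  refine (play_le (K := K) A hq (mpk := ⟨g, (𝒢.grp n).exp g α, (𝒢.grp n).exp g y⟩) hg rfl
    (outcomeValue b ε A _) (outcomeValue_le_one A _) rfl
    (stateValue b ε A ⟨g, (𝒢.grp n).exp g α, (𝒢.grp n).exp g y⟩) ?_ q q (n ^ K) [] .nil _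
    (Polynomial.C y) (Polynomial.X - Polynomial.C α) le_rfl hq (by simp) (by simp)
    (fun x _ hx => by simpa [sub_ne_zero] using hx)
    (fun r hr => degree_C_add_mul_lt hr y α)).trans_eq ?_
  · intro u ID k w hu
    refine le_trans ?_ (le_iSup_of_le ID (le_iSup_of_le k (le_iSup_of_le
      ⟨hu, BilinearGroup.decZ_encZ _ _, BilinearGroup.decG_encG _ _, BilinearGroup.decZ_encZ _ _⟩ le_rfl)))
    exact le_rfl
  · congr 1
    refine congrArg (ex _) (funext fun r => ?_)
    rw [ex_finalState]
    simp only [polyKey, hev]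

theorem game_le_totalValue (hq : Q n + 1 ≤ n ^ K) : computeNewKeyGame 𝒢 Q b ε A n true ≤
    totalValue 𝒢 n K b (ε n) A (Q n) +
      (Q n * (((n ^ K : ℕ) : ℝ≥0∞)⁻¹ + 2 * ((𝒢.grp n).p : ℝ≥0∞)⁻¹) +
        ((𝒢.grp n).p : ℝ≥0∞)⁻¹) := by
  refine (game_le A).trans ?_
  generalize hδ : Q n * (((n ^ K : ℕ) : ℝ≥0∞)⁻¹ + 2 * ((𝒢.grp n).p : ℝ≥0∞)⁻¹) = δ
  rw [totalValue, ← ex_const (𝒢.grp n).randGen (δ + _), ← ex_add]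
  refine ex_mono_support fun g hg => ?_
  rw [← ex_const (PMF.uniformOfFintype (𝒢.grp n).Scalarˣ) (δ + _), ← ex_add]
  refine ex_mono fun α => ?_
  rw [← add_assoc, ← hδ]
  exact add_le_add_left
    (play_le_simulatedValue A hq ((𝒢.grp n).mem_support_randGen hg) _) _

/-- The advantage of the dishonest user, in terms of the advantage of the distinguisher. -/
theorem computeNewKeyAdv_le (hq₁ : 1 ≤ Q n) (hq : Q n + 1 ≤ n ^ K) (hε : 0 < ε n)
    (hε1 : ε n ≤ 1) :
    ε n ^ 2 / 4 * computeNewKeyAdv 𝒢 Q b ε A n ≤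
      adbdheAdv 𝒢 Q (distinguisher K A) n + Real.exp (-(8 * n)) +
        (10 + 2 * Q n) * ((𝒢.grp n).p : ℝ)⁻¹ + Q n * ((n : ℝ) ^ K)⁻¹ := by
  have hp : ((𝒢.grp n).p : ℝ≥0∞)⁻¹ ≠ ∞ := inv_p_ne_top
  have hnK : ((n ^ K : ℕ) : ℝ≥0∞)⁻¹ ≠ ∞ := by
    rw [ne_eq, ENNReal.inv_eq_top, Nat.cast_eq_zero]
    omega
  have hV1 : totalValue 𝒢 n K b (ε n) A (Q n) ≤ 1 :=
    ex_le_const fun g => ex_le_const fun α => ex_le_const fun f => ex_le_const fun d =>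
      stateValue_le A fun _ _ _ => winValue_le_one
  have hV : totalValue 𝒢 n K b (ε n) A (Q n) ≠ ∞ := ne_top_of_le_ne_top ENNReal.one_ne_top hV1
  have hQ : (Q n : ℝ≥0∞) * (((n ^ K : ℕ) : ℝ≥0∞)⁻¹ + 2 * ((𝒢.grp n).p : ℝ≥0∞)⁻¹) ≠ ∞ :=
    ENNReal.mul_ne_top (by simp) (ENNReal.add_ne_top.2 ⟨hnK, ENNReal.mul_ne_top (by simp) hp⟩)
  have h1 := toReal_le_add (game_le_totalValue (b := b) (ε := ε) A hq) hV
    (ENNReal.add_ne_top.2 ⟨hQ, hp⟩)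
  have h2 := ENNReal.toReal_mono (ENNReal.add_ne_top.2 ⟨PMF.apply_ne_top _ _, gainError_ne_top⟩)
    (distinguisher_gain (𝒢 := 𝒢) (b := b) A hq₁ hq hε hε1)
  rw [ENNReal.toReal_add hQ hp, ENNReal.toReal_mul,
    ENNReal.toReal_add hnK (ENNReal.mul_ne_top (by simp) hp), ENNReal.toReal_mul,
    ENNReal.toReal_inv, ENNReal.toReal_inv, ENNReal.toReal_natCast, ENNReal.toReal_natCast,
    ENNReal.toReal_natCast, ENNReal.toReal_ofNat, Nat.cast_pow] at h1
  rw [ENNReal.toReal_add (PMF.apply_ne_top _ _) (ENNReal.mul_ne_top ENNReal.ofReal_ne_top hV),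
    ENNReal.toReal_add (PMF.apply_ne_top _ _) gainError_ne_top, ENNReal.toReal_mul,
    ENNReal.toReal_ofReal (by positivity), gainError, ENNReal.toReal_ofReal (by positivity)] at h2
  have h3 := le_abs_self ((adbdheReal 𝒢 Q (distinguisher K A) n Data.tt).toReal -
    (adbdheRandom 𝒢 Q (distinguisher K A) n Data.tt).toReal)
  rw [← adbdheAdv] at h3
  have hε4 : ε n ^ 2 / 4 ≤ 1 := by nlinarith
  set err : ℝ := Q n * (((n : ℝ) ^ K)⁻¹ + 2 * ((𝒢.grp n).p : ℝ)⁻¹) + ((𝒢.grp n).p : ℝ)⁻¹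
  have herr : 0 ≤ err := by positivity
  -- The simulation error is multiplied by `ε n ^ 2 / 4 ≤ 1` only, so it can be kept without this
  -- factor.
  calc _ ≤ ε n ^ 2 / 4 * ((totalValue 𝒢 n K b (ε n) A (Q n)).toReal + err) := by
        exact mul_le_mul_of_nonneg_left h1 (by positivity)
    _ ≤ ε n ^ 2 / 4 * (totalValue 𝒢 n K b (ε n) A (Q n)).toReal + 1 * err := by
        rw [mul_add]
        gcongr
    _ ≤ _ := by
        simp only [err]
        linarith

end Adversary

/-! ## Asymptotics -/

section Asymptotics

open Filter Topology

theorem eventually_eval_le_pow (P : Polynomial ℕ) : ∃ e : ℕ, ∀ᶠ n : ℕ in atTop, P.eval n ≤ n ^ e := by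
  induction P using Polynomial.induction_on' with
  | add P R hP hR =>
    obtain ⟨a, ha⟩ := hP
    obtain ⟨c, hc⟩ := hR
    refine ⟨max a c + 1, ?_⟩
    filter_upwards [ha, hc, eventually_ge_atTop 2] with n h1 h2 h3
    rw [Polynomial.eval_add, pow_succ]
    have := h1.trans (Nat.pow_le_pow_right (by omega) (le_max_left a c))
    have := h2.trans (Nat.pow_le_pow_right (by omega) (le_max_right a c))
    nlinarith [Nat.zero_le (n ^ max a c)]
  | monomial m a =>
    refine ⟨m + 1, ?_⟩
    filter_upwards [eventually_ge_atTop a] with n hn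
    rw [Polynomial.eval_monomial, pow_succ']
    exact Nat.mul_le_mul_right _ hn

theorem PolyBounded.exists_pow {q : ℕ → ℕ} (hq : PolyBounded q) :
    ∃ e : ℕ, ∀ᶠ n : ℕ in atTop, q n + 1 ≤ n ^ e := by
  obtain ⟨P, hP⟩ := hq
  obtain ⟨e, he⟩ := eventually_eval_le_pow (P + 1)
  refine ⟨e, he.mono fun n hn => le_trans ?_ hn⟩
  simpa using hP n

theorem inv_p_le (𝒢 : BilinearFamily) (n : ℕ) : ((𝒢.grp n).p : ℝ)⁻¹ ≤ (1 / 2 : ℝ) ^ n := by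
  rw [one_div, inv_pow]
  exact inv_anti₀ (by positivity) (by exact_mod_cast (𝒢.order_gt n).le)

theorem negligible_computeNewKeyAdv (𝒢 : BilinearFamily) (q : ℕ → ℕ) (hq_pos : ∀ n, 1 ≤ q n)
    (hq : PolyBounded q)
    (hADBDHE : ADBDHEAssumption 𝒢 q) (b : ProbeBase) (ε : ℕ → ℝ)
    (hε_pos : ∀ n, 0 < ε n) (hε_le : ∀ n, ε n ≤ 1) (hε : Noticeable ε)
    (A : Adversary) (hA : A.IsPPT 𝒢) :
    Negligible (computeNewKeyAdv 𝒢 q b ε A) := by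
  intro k
  obtain ⟨c, hc⟩ := hε
  obtain ⟨e, he⟩ := hq.exists_pow
  -- Dividing by `ε ^ 2` costs a factor `n ^ (2 * c)`, on top of the factor `n ^ k` under test.
  set m := 2 * c + k with hm
  -- The rewinding loss is at most `n ^ e / n ^ (e + m + 1)`, hence `1 / n` after multiplication by
  -- `n ^ m`. The distinguisher may depend on `k`, since each `k` needs only one PPT program.
  set D := Prog.distinguisher (e + m + 1) A
  have h1 : Tendsto (fun n : ℕ => (n : ℝ) ^ m * adbdheAdv 𝒢 q D n) atTop (𝓝 0) :=
    hADBDHE D (Prog.isPPT_distinguisher _ hA) m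
  have h2 : Tendsto (fun n : ℕ => (n : ℝ) ^ m * Real.exp (-8) ^ n) atTop (𝓝 0) :=
    tendsto_pow_const_mul_const_pow_of_abs_lt_one m (by
      rw [abs_of_pos (Real.exp_pos _), Real.exp_lt_one_iff]; norm_num)
  have h3 : Tendsto (fun n : ℕ => (n : ℝ) ^ (m + e) * (1 / 2 : ℝ) ^ n) atTop (𝓝 0) :=
    tendsto_pow_const_mul_const_pow_of_abs_lt_one _ (by rw [abs_of_pos] <;> norm_num)
  have h4 : Tendsto (fun n : ℕ => (n : ℝ)⁻¹) atTop (𝓝 0) :=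
    tendsto_inv_atTop_zero.comp tendsto_natCast_atTop_atTop
  -- The factor `4` comes from `ε ^ 2 / 4`, and `48 = 4 * (10 + 2)` collects the terms in `1 / p`
  -- after bounding `q n` and `1` by `n ^ e`.
  have hlim := (((h1.const_mul 4).add (h2.const_mul 4)).add (h3.const_mul 48)).add (h4.const_mul 4)
  simp only [mul_zero, add_zero] at hlim
  refine squeeze_zero' (Eventually.of_forall fun n => by
    have : 0 ≤ computeNewKeyAdv 𝒢 q b ε A n := ENNReal.toReal_nonneg
    positivity) ?_ hlim
  filter_upwards [hc, he, eventually_ge_atTop 1] with n hcn hen hn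
  have hn' : (1 : ℝ) ≤ n := by exact_mod_cast hn
  have hn0 : (0 : ℝ) < n := by linarith
  have hadv := computeNewKeyAdv_le (𝒢 := 𝒢) (b := b) (ε := ε) (K := e + m + 1) A (hq_pos n)
    (hen.trans (Nat.pow_le_pow_right hn (by omega))) (hε_pos n) (hε_le n)
  have hA0 : 0 ≤ computeNewKeyAdv 𝒢 q b ε A n := ENNReal.toReal_nonneg
  have hqe : (q n : ℝ) ≤ (n : ℝ) ^ e := by
    have : q n ≤ n ^ e := by omega
    exact_mod_cast this
  have hne : (1 : ℝ) ≤ (n : ℝ) ^ e := one_le_pow₀ hn'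
  have hε2 : 1 ≤ (n : ℝ) ^ (2 * c) * ε n ^ 2 := by
    rw [mul_comm 2 c, pow_mul, ← mul_pow]
    refine one_le_pow₀ ?_
    calc (1 : ℝ) = (n : ℝ) ^ c * ((n : ℝ) ^ c)⁻¹ := (mul_inv_cancel₀ (by positivity)).symm
      _ ≤ _ := by gcongr
  have hexp : Real.exp (-(8 * (n : ℝ))) = Real.exp (-8) ^ n := by
    rw [← Real.exp_nat_mul]; congr 1; ring
  have hp := inv_p_le 𝒢 n
  have hp0 : 0 ≤ ((𝒢.grp n).p : ℝ)⁻¹ := by positivity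
  calc (n : ℝ) ^ k * computeNewKeyAdv 𝒢 q b ε A n
      ≤ (n : ℝ) ^ k * ((n : ℝ) ^ (2 * c) * ε n ^ 2 * computeNewKeyAdv 𝒢 q b ε A n) := by
        refine mul_le_mul_of_nonneg_left ?_ (by positivity)
        exact le_mul_of_one_le_left hA0 hε2
    _ = 4 * (n : ℝ) ^ m * (ε n ^ 2 / 4 * computeNewKeyAdv 𝒢 q b ε A n) := by
        rw [hm, pow_add]; ring
    _ ≤ 4 * (n : ℝ) ^ m * (adbdheAdv 𝒢 q D n + Real.exp (-(8 * n)) +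
        (10 * (n : ℝ) ^ e + 2 * (n : ℝ) ^ e) * (1 / 2 : ℝ) ^ n +
        (n : ℝ) ^ e * ((n : ℝ) ^ (e + m + 1))⁻¹) := by
        refine mul_le_mul_of_nonneg_left (hadv.trans ?_) (by positivity)
        gcongr
        linarith
    _ = _ := by
        rw [hexp]
        field_simp
        ring

end Asymptotics

end

end AIBE

theorem mainTheorem7 (𝒢 : AIBE.BilinearFamily) (q : ℕ → ℕ) (hq_pos : ∀ n, 1 ≤ q n)
    (hq : AIBE.PolyBounded q)
    (hADBDHE : AIBE.ADBDHEAssumption 𝒢 q) (b : AIBE.ProbeBase) (ε : ℕ → ℝ)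
    (hε_pos : ∀ n, 0 < ε n) (hε_le : ∀ n, ε n ≤ 1) (hε : AIBE.Noticeable ε)
    (A : AIBE.Adversary) (hA : A.IsPPT 𝒢) :
    AIBE.Negligible (AIBE.computeNewKeyAdv 𝒢 q b ε A) :=
  AIBE.negligible_computeNewKeyAdv 𝒢 q hq_pos hq hADBDHE b ε hε_pos hε_le hε A hA
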